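/- Let $\mathsf E_-$ and $\mathsf E_+$ be finite or countable sets (no relation between their cardinalities is assumed), and let $\mathsf G$ be the metric star graph with edges $(-\infty,0)$ for $\mathsf e\in\mathsf E_-$ and $(0,\infty)$ for $\mathsf e\in\mathsf E_+$. Let $\alpha_{\mathsf e}>0$ and $\beta_{\mathsf e}\in\mathbb R$ $(\mathsf e\in\mathsf E:=\mathsf E_-\cup\mathsf E_+)$ be such that the families $(\alpha_{\mathsf e})$, $(1/\alpha_{\mathsf e})$ and $(\beta_{\mathsf e})$ are bounded. On the complex Hilbert space $L^2(\mathsf G)=\bigoplus_{\mathsf e\in\mathsf E_-}L^2(-\infty,0)\oplus\bigoplus_{\mathsf e\in\mathsf E_+}L^2(0,\infty)$ let $A_0$ be the operator $(u_{\mathsf e})\mapsto(\alpha_{\mathsf e}u_{\mathsf e}'''+\beta_{\mathsf e}u_{\mathsf e}')$ whose domain consists of the families, with finitely many nonzero members, of functions $u_{\mathsf e}\in C_c^\infty$ of the open half-line $\mathsf e$. Let $\mathcal G_\pm=\ell^2(\mathsf E_\pm)\oplus\ell^2(\mathsf E_\pm)\oplus\ell^2(\mathsf E_\pm)$, and equip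 it with the indefinite inner product $\langle x\mid y\rangle_\pm=(B_\pm x\mid y)$, where $B_\pm(x,x',x'')=(-\beta_\pm x-\alpha_\pm x'',\ \alpha_\pm x',\ -\alpha_\pm x)$ and $\alpha_\pm,\beta_\pm$ denote the multiplication operators by $(\alpha_{\mathsf e})_{\mathsf e\in\mathsf E_\pm}$, $(\beta_{\mathsf e})_{\mathsf e\in\mathsf E_\pm}$. For a densely defined linear operator $L$ from $\mathcal G_-$ to $\mathcal G_+$, its $(\mathcal G_-,\mathcal G_+)$-adjoint $L^\sharp$, from $\mathcal G_+$ to $\mathcal G_-$, is defined by: $y\in D(L^\sharp)$ and $L^\sharp y=z$ if and only if $\langle Lx\mid y\rangle_+=\langle x\mid z\rangle_-$ for all $x\in D(L)$. The operator $L$ is a $(\mathcal G_-,\mathcal G_+)$-contraction if $\langle Lx\mid Lx\rangle_+\le\langle x\mid x\rangle_-$ for all $x\in D(L)$, and $L^\sharp$ is a $(\mathcal G_+,\mathcal G_-)$-contraction if $\langle L^\sharp y\mid L^\sharp y\rangle_-\le\langle y\mid y\rangle_+$ for all $y\in D(L^\sharp)$. Let $A_L$ be the restriction of $-A_0^*$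 to those $u\in D(A_0^*)$ for which $(u(0-),u'(0-),u''(0-))\in D(L)$ and $$L\bigl(u(0-),u'(0-),u''(0-)\bigr)=\bigl(u(0+),u'(0+),u''(0+)\bigr).$$ **Theorem.** Let $L$ be a densely defined linear operator from $\mathcal G_-$ to $\mathcal G_+$. Then $A_L$ is the generator of a contraction $C_0$-semigroup on $L^2(\mathsf G)$ if and only if $L$ is closed, $L$ is a $(\mathcal G_-,\mathcal G_+)$-contraction and $L^\sharp$ is a $(\mathcal G_+,\mathcal G_-)$-contraction. -/

import Mathlib

open MeasureTheory Filter Topology Set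
open scoped NNReal ContDiff InnerProductSpace LinearPMap

noncomputable section

namespace AiryStar

/-! ### Contraction semigroups and their generators -/

section Semigroup

variable {X : Type*} [NormedAddCommGroup X] [NormedSpace ℂ X]

/-- `T` is a strongly continuous one-parameter semigroup of contractions on `X`. -/
structure IsContractionC0Semigroup (T : ℝ≥0 → X →L[ℂ] X) : Prop where
  map_zero : T 0 = ContinuousLinearMap.id ℂ X
  map_add : ∀ s t, T (s + t) = (T s).comp (T t)
  strongly_continuous : ∀ x, Tendsto (fun t => T t x) (𝓝 0) (𝓝 x)
  norm_le_one : ∀ t, ‖T t‖ ≤ 1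

/-- `A` is the infinitesimal generator of `T`: `x ∈ D(A)` and `A x = y` hold exactly when
`(T(t) x - x) / t → y` as `t → 0+`. -/
def IsGeneratorOf (A : X →ₗ.[ℂ] X) (T : ℝ≥0 → X →L[ℂ] X) : Prop :=
  ∀ x y : X, (x, y) ∈ A.graph ↔
    Tendsto (fun t : ℝ≥0 => (((t : ℝ) : ℂ))⁻¹ • (T t x - x)) (𝓝[>] 0) (𝓝 y)

/-- `A` is the generator of a contraction `C₀`-semigroup. -/
def GeneratesContractionSemigroup (A : X →ₗ.[ℂ] X) : Prop :=
  ∃ T : ℝ≥0 → X →L[ℂ] X, IsContractionC0Semigroup T ∧ IsGeneratorOf A T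

end Semigroup

/-! ### Krein spaces

A Krein space is given as a Hilbert space `K` with the indefinite inner product
`⟨x | y⟩ = (B x | y)` of a Gram operator `B`. Mathlib's `inner ℂ y z` is linear in `z`, so the
form below is linear in its first argument and antilinear in the second. -/

section Krein

variable {K : Type*} [NormedAddCommGroup K] [InnerProductSpace ℂ K]
variable {K₁ : Type*} [NormedAddCommGroup K₁] [InnerProductSpace ℂ K₁]
variable {K₂ : Type*} [NormedAddCommGroup K₂] [InnerProductSpace ℂ K₂]

/-- The indefinite inner product `⟨x | y⟩ = (B x | y)`. -/
def kreinForm (B : K →ₗ[ℂ] K) (x y : K) : ℂ := inner ℂ y (B x)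

/-- `L` is a `(K₁, K₂)`-contraction: `⟨L x | L x⟩ ≤ ⟨x | x⟩` for all `x ∈ D(L)`. Both sides are
real numbers since Gram operators are symmetric; they are compared through their real parts. -/
def IsKreinContraction (B₁ : K₁ →ₗ[ℂ] K₁) (B₂ : K₂ →ₗ[ℂ] K₂) (L : K₁ →ₗ.[ℂ] K₂) : Prop :=
  ∀ x : L.domain, (kreinForm B₂ (L x) (L x)).re ≤ (kreinForm B₁ (x : K₁) (x : K₁)).re

/-- The graph of the Krein adjoint: all `(y, z)` with `⟨L x | y⟩ = ⟨x | z⟩` for `x ∈ D(L)`. -/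
def kreinAdjointGraph (B₁ : K₁ →ₗ[ℂ] K₁) (B₂ : K₂ →ₗ[ℂ] K₂) (L : K₁ →ₗ.[ℂ] K₂) :
    Submodule ℂ (K₂ × K₁) where
  carrier := {p | ∀ x : L.domain, kreinForm B₂ (L x) p.1 = kreinForm B₁ (x : K₁) p.2}
  zero_mem' := by intro x; simp [kreinForm]
  add_mem' := by
    intro p q hp hq x
    have h1 := hp x
    have h2 := hq x
    simp only [kreinForm, Prod.fst_add, Prod.snd_add, inner_add_left] at *
    rw [h1, h2]
  smul_mem' := by
    intro a p hp x
    have h1 := hp x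
    simp only [kreinForm, Prod.smul_fst, Prod.smul_snd, inner_smul_left] at *
    rw [h1]

/-- The Krein adjoint `L^♯`, a linear operator from `K₂` to `K₁`. -/
def kreinAdjoint (B₁ : K₁ →ₗ[ℂ] K₁) (B₂ : K₂ →ₗ[ℂ] K₂) (L : K₁ →ₗ.[ℂ] K₂) : K₂ →ₗ.[ℂ] K₁ :=
  (kreinAdjointGraph B₁ B₂ L).toLinearPMap

/-- For densely defined `L` and a symmetric injective Gram operator, the relation defining the
Krein adjoint is single-valued, so it is the graph of the operator `L^♯`. -/
theorem mem_graph_kreinAdjoint {B₁ : K₁ →ₗ[ℂ] K₁} (hs : B₁.IsSymmetric)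
    (hi : Function.Injective B₁) (B₂ : K₂ →ₗ[ℂ] K₂) (L : K₁ →ₗ.[ℂ] K₂)
    (hL : Dense (L.domain : Set K₁)) (y : K₂) (z : K₁) :
    (y, z) ∈ (kreinAdjoint B₁ B₂ L).graph ↔
      ∀ x : L.domain, kreinForm B₂ (L x) y = kreinForm B₁ (x : K₁) z := by
  have hg : ∀ p : K₂ × K₁, p ∈ kreinAdjointGraph B₁ B₂ L → p.1 = 0 → p.2 = 0 := by
    intro p hp hp0
    apply hi
    rw [map_zero]
    refine hL.eq_zero_of_inner_left ℂ (fun v hv => ?_)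
    have h := hp ⟨v, hv⟩
    rw [hp0] at h
    simp only [kreinForm, inner_zero_left] at h
    rw [hs]
    exact h.symm
  rw [kreinAdjoint, Submodule.toLinearPMap_graph_eq _ hg]
  rfl

end Krein

/-! ### Coefficients and spaces of boundary values -/

/-- Admissible coefficients of the Airy equation on a family `E` of edges: `α > 0`, and `α`, `1/α`
and `β` are bounded. -/
structure EdgeCoeffs (E : Type*) where
  α : E → ℝ
  β : E → ℝ
  α_pos : ∀ e, 0 < α e
  α_bdd : ∃ C, ∀ e, α e ≤ C
  α_inv_bdd : ∃ C, ∀ e, 1 / α e ≤ C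
  β_bdd : ∃ C, ∀ e, |β e| ≤ C

/-- `ℓ²(E)`. -/
abbrev ℓ2 (E : Type*) : Type _ := lp (fun _ : E => ℂ) 2

/-- `𝒢 = ℓ²(E) ⊕ ℓ²(E) ⊕ ℓ²(E)`, with its Hilbert space structure. -/
abbrev BdSpace (E : Type*) : Type _ := PiLp 2 (fun _ : Fin 3 => ℓ2 E)

/-- Multiplication of a square-summable family by a bounded real family. -/
def mulOp {E : Type*} (a : E → ℝ) (ha : ∃ C, ∀ e, |a e| ≤ C) : ℓ2 E →ₗ[ℂ] ℓ2 E where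
  toFun x := ⟨fun e => (a e : ℂ) * x e, by
    obtain ⟨C, hC⟩ := ha
    refine Memℓp.of_norm (((lp.memℓp x).norm.const_mul C).mono fun e => ?_)
    simp only [norm_mul, Complex.norm_real, Real.norm_eq_abs, abs_abs, abs_norm]
    exact mul_le_mul_of_nonneg_right (hC e) (norm_nonneg _)⟩
  map_add' x y := by
    ext e
    exact mul_add (a e : ℂ) (x e) (y e)
  map_smul' c x := by ext e; simp [mul_left_comm]

namespace EdgeCoeffs

variable {E : Type*} (c : EdgeCoeffs E)

theorem α_abs_bdd : ∃ C, ∀ e, |c.α e| ≤ C :=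
  c.α_bdd.imp fun _ h e => (abs_of_pos (c.α_pos e)).le.trans (h e)

/-- The multiplication operator by `α`. -/
def mulα : ℓ2 E →ₗ[ℂ] ℓ2 E := mulOp c.α c.α_abs_bdd

/-- The multiplication operator by `β`. -/
def mulβ : ℓ2 E →ₗ[ℂ] ℓ2 E := mulOp c.β c.β_bdd

/-- The block operator
`B (x, x', x'') = (- β x - α x'', α x', - α x)` on `𝒢`. -/
def gram : BdSpace E →ₗ[ℂ] BdSpace E where
  toFun x := WithLp.toLp 2 ![-c.mulβ (x 0) - c.mulα (x 2), c.mulα (x 1), -c.mulα (x 0)]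
  map_add' x y := by
    ext i : 1
    fin_cases i <;> simp <;> abel
  map_smul' a x := by
    ext i : 1
    fin_cases i <;> simp [smul_sub]

end EdgeCoeffs

theorem mulOp_isSymmetric {E : Type*} (a : E → ℝ) (ha : ∃ C, ∀ e, |a e| ≤ C) :
    (mulOp a ha).IsSymmetric := by
  intro x y
  rw [lp.inner_eq_tsum, lp.inner_eq_tsum]
  refine tsum_congr fun e => ?_
  simp only [mulOp, LinearMap.coe_mk, AddHom.coe_mk, RCLike.inner_apply, map_mul,
    Complex.conj_ofReal]
  ring

theorem EdgeCoeffs.gram_isSymmetric {E : Type*} (c : EdgeCoeffs E) : c.gram.IsSymmetric := by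
  intro x y
  have hα := mulOp_isSymmetric c.α c.α_abs_bdd
  have hβ := mulOp_isSymmetric c.β c.β_bdd
  simp only [PiLp.inner_apply, Fin.sum_univ_three, EdgeCoeffs.gram, EdgeCoeffs.mulα,
    EdgeCoeffs.mulβ, LinearMap.coe_mk, AddHom.coe_mk, Matrix.cons_val_zero, Matrix.cons_val_one,
    Matrix.cons_val, inner_sub_left, inner_neg_left, inner_sub_right, inner_neg_right]
  rw [hβ, hα (x 2), hα (x 1), hα (x 0)]
  ring

theorem EdgeCoeffs.gram_injective {E : Type*} (c : EdgeCoeffs E) :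
    Function.Injective c.gram := by
  have hz : ∀ v : ℓ2 E, c.mulα v = 0 → v = 0 := by
    intro v hv
    ext e
    have h : (c.α e : ℂ) * v e = 0 := congrFun (congrArg Subtype.val hv) e
    simpa [(c.α_pos e).ne'] using h
  refine (injective_iff_map_eq_zero c.gram).2 fun x hx => ?_
  have h (i : Fin 3) : c.gram x i = 0 := by rw [hx]; rfl
  have h0 : x 0 = 0 := hz _ (neg_eq_zero.1 (h 2))
  have h1 : x 1 = 0 := hz _ (h 1)
  have h2 : x 2 = 0 := hz _ (by
    have := h 0
    simp only [EdgeCoeffs.gram, LinearMap.coe_mk, AddHom.coe_mk, Matrix.cons_val_zero, h0,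
      map_zero, neg_zero, zero_sub] at this
    exact neg_eq_zero.1 this)
  ext i : 1
  fin_cases i
  · exact h0
  · exact h1
  · exact h2

/-! ### The star graph and the Airy operators on it -/

section Graph

variable {Em Ep : Type*}

/-- The half-line carrying an edge: `(-∞, 0)` for the edges in `E₋`, `(0, ∞)` for those in `E₊`. -/
def halfLine : Em ⊕ Ep → Set ℝ := Sum.elim (fun _ => Iio 0) (fun _ => Ioi 0)

theorem isOpen_halfLine (e : Em ⊕ Ep) : IsOpen (halfLine e) := by
  cases e
  · exact isOpen_Iio
  · exact isOpen_Ioi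

variable (Em Ep) in
/-- `L²(G)`, the Hilbert space direct sum of the spaces `L²(-∞, 0)`, `e ∈ E₋`, and `L²(0, ∞)`,
`e ∈ E₊`. -/
abbrev L2Graph : Type _ :=
  lp (fun e : Em ⊕ Ep => Lp ℂ 2 ((volume : Measure ℝ).restrict (halfLine e))) 2

/-- `φ` is a family of test functions `φ_e ∈ C_c^∞(halfLine e)`, only finitely many of them
nonzero. -/
structure IsTestFamily (φ : Em ⊕ Ep → ℝ → ℂ) : Prop where
  smooth : ∀ e, ContDiff ℝ ∞ (φ e)
  hasCompactSupport : ∀ e, HasCompactSupport (φ e)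
  tsupport_subset : ∀ e, tsupport (φ e) ⊆ halfLine e
  finite : {e | φ e ≠ 0}.Finite

/-- The expression `α_e φ''' + β_e φ'` on the edge `e`. -/
def airyExpr (cm : EdgeCoeffs Em) (cp : EdgeCoeffs Ep) (e : Em ⊕ Ep) (φ : ℝ → ℂ) (x : ℝ) : ℂ :=
  ((Sum.elim cm.α cp.α e : ℝ) : ℂ) * iteratedDeriv 3 φ x + ((Sum.elim cm.β cp.β e : ℝ) : ℂ) * deriv φ x

theorem iteratedDeriv_zero_fun (n : ℕ) : iteratedDeriv n (0 : ℝ → ℂ) = 0 :=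
  funext fun _ => iteratedDeriv_const_zero

/-- The graph of `A₀`: pairs `(u, v)` for which `u` is (the class of) a finite family of test
functions `φ` and `v` that of `(α_e φ_e''' + β_e φ_e')_e`. -/
def A₀Graph (cm : EdgeCoeffs Em) (cp : EdgeCoeffs Ep) :
    Submodule ℂ (L2Graph Em Ep × L2Graph Em Ep) where
  carrier := {p | ∃ φ : Em ⊕ Ep → ℝ → ℂ, IsTestFamily φ ∧
    (∀ e, p.1 e =ᵐ[volume.restrict (halfLine e)] φ e) ∧
    (∀ e, p.2 e =ᵐ[volume.restrict (halfLine e)] airyExpr cm cp e (φ e))}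
  zero_mem' := by
    refine ⟨fun _ => 0, ⟨fun _ => contDiff_const, fun _ => HasCompactSupport.zero, ?_, ?_⟩, ?_, ?_⟩
    · intro e; simp
    · simp
    · intro e; exact Lp.coeFn_zero _ _ _
    · intro e
      refine (Lp.coeFn_zero ℂ 2 (volume.restrict (halfLine e))).trans (ae_of_all _ fun x => ?_)
      change (0 : ℂ) = airyExpr cm cp e (0 : ℝ → ℂ) x
      simp [airyExpr]
  add_mem' := by
    rintro p q ⟨φ, hφ, hp1, hp2⟩ ⟨ψ, hψ, hq1, hq2⟩
    refine ⟨fun e => φ e + ψ e, ⟨fun e => (hφ.smooth e).add (hψ.smooth e),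
      fun e => (hφ.hasCompactSupport e).add (hψ.hasCompactSupport e), ?_, ?_⟩, ?_, ?_⟩
    · intro e
      exact (tsupport_add _ _).trans (union_subset (hφ.tsupport_subset e) (hψ.tsupport_subset e))
    · refine (hφ.finite.union hψ.finite).subset fun e he => ?_
      by_contra hcon
      simp only [mem_union, mem_ofPred_eq, not_or, not_not] at hcon
      exact he (by simp [hcon.1, hcon.2])
    · intro e
      exact (Lp.coeFn_add _ _).trans ((hp1 e).add (hq1 e))
    · intro e
      refine (Lp.coeFn_add _ _).trans (((hp2 e).add (hq2 e)).trans (ae_of_all _ fun x => ?_))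
      have h3 : iteratedDeriv 3 (φ e + ψ e) x = iteratedDeriv 3 (φ e) x + iteratedDeriv 3 (ψ e) x :=
        iteratedDeriv_add (contDiff_infty.1 (hφ.smooth e) 3).contDiffAt
          (contDiff_infty.1 (hψ.smooth e) 3).contDiffAt
      have h1 : deriv (φ e + ψ e) x = deriv (φ e) x + deriv (ψ e) x :=
        deriv_add ((hφ.smooth e).differentiable (by simp) x)
          ((hψ.smooth e).differentiable (by simp) x)
      simp only [airyExpr, Pi.add_apply, h3, h1]
      ring
  smul_mem' := by
    rintro a p ⟨φ, hφ, hp1, hp2⟩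
    refine ⟨fun e => a • φ e, ⟨fun e => contDiff_const.smul (hφ.smooth e),
      fun e => (hφ.hasCompactSupport e).smul_left, ?_, ?_⟩, ?_, ?_⟩
    · intro e
      exact (closure_mono (Function.support_const_smul_subset a (φ e))).trans
        (hφ.tsupport_subset e)
    · refine hφ.finite.subset fun e he h0 => he (by simp [h0])
    · intro e
      exact (Lp.coeFn_smul _ _).trans ((hp1 e).const_smul a)
    · intro e
      refine (Lp.coeFn_smul _ _).trans (((hp2 e).const_smul a).trans (ae_of_all _ fun x => ?_))
      have h3 : iteratedDeriv 3 (a • φ e) x = a • iteratedDeriv 3 (φ e) x :=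
        iteratedDeriv_const_smul (contDiff_infty.1 (hφ.smooth e) 3).contDiffAt a
      have h1 : deriv (a • φ e) x = a • deriv (φ e) x :=
        deriv_const_smul a ((hφ.smooth e).differentiable (by simp) x)
      simp only [airyExpr, Pi.smul_apply, h3, h1, smul_eq_mul]
      ring

/-- The minimal Airy operator `A₀ : (u_e) ↦ (α_e u_e''' + β_e u_e')` on finite families of test
functions, as an unbounded operator in `L²(G)`. -/
def A₀ (cm : EdgeCoeffs Em) (cp : EdgeCoeffs Ep) : L2Graph Em Ep →ₗ.[ℂ] L2Graph Em Ep :=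
  (A₀Graph cm cp).toLinearPMap

/-- `A₀Graph` is single-valued, so it is the graph of `A₀`. -/
theorem A₀_graph (cm : EdgeCoeffs Em) (cp : EdgeCoeffs Ep) : (A₀ cm cp).graph = A₀Graph cm cp := by
  refine Submodule.toLinearPMap_graph_eq _ ?_
  rintro ⟨u, v⟩ ⟨φ, hφ, h1, h2⟩ hu
  obtain rfl : u = 0 := hu
  have hφ0 (e : Em ⊕ Ep) : φ e = 0 := by
    have hae : φ e =ᵐ[volume.restrict (halfLine e)] (0 : ℝ → ℂ) :=
      (h1 e).symm.trans (Lp.coeFn_zero ℂ 2 (volume.restrict (halfLine e)))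
    have hon : EqOn (φ e) 0 (halfLine e) :=
      Measure.eqOn_open_of_ae_eq hae (isOpen_halfLine e) (hφ.smooth e).continuous.continuousOn
        continuousOn_const
    funext x
    by_cases hx : x ∈ halfLine e
    · exact hon hx
    · exact image_eq_zero_of_notMem_tsupport fun h => hx (hφ.tsupport_subset e h)
  ext e : 2
  refine Lp.ext ((h2 e).trans (EventuallyEq.trans (ae_of_all _ fun x => ?_)
    (Lp.coeFn_zero ℂ 2 (volume.restrict (halfLine e))).symm))
  simp [airyExpr, hφ0]

/-- The function `u` on the open half-line `I` with endpoint `0` has a representative `f` of class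
`C²` such that `f`, `f'`, `f''` have the limits `a 0`, `a 1`, `a 2` at `0` from inside `I`. -/
def HasEndpointValues (I : Set ℝ) (u : ℝ → ℂ) (a : Fin 3 → ℂ) : Prop :=
  ∃ f : ℝ → ℂ, ContDiffOn ℝ 2 f I ∧ u =ᵐ[volume.restrict I] f ∧
    ∀ k : Fin 3, Tendsto (iteratedDeriv (k : ℕ) f) (𝓝[I] 0) (𝓝 (a k))

/-- `u` has the boundary values `(u(0-), u'(0-), u''(0-)) = ξ` and
`(u(0+), u'(0+), u''(0+)) = η`. -/
def HasBoundaryValues (u : L2Graph Em Ep) (ξ : BdSpace Em) (η : BdSpace Ep) : Prop :=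
  (∀ e : Em, HasEndpointValues (halfLine (Sum.inl e : Em ⊕ Ep)) (u (Sum.inl e))
    (fun k => ξ k e)) ∧
  ∀ e : Ep, HasEndpointValues (halfLine (Sum.inr e : Em ⊕ Ep)) (u (Sum.inr e))
    (fun k => η k e)

theorem HasEndpointValues.zero (I : Set ℝ) : HasEndpointValues I 0 0 := by
  refine ⟨0, contDiffOn_const, EventuallyEq.rfl, fun k => ?_⟩
  rw [iteratedDeriv_zero_fun]
  exact tendsto_const_nhds

theorem HasEndpointValues.add {I : Set ℝ} (hI : IsOpen I) {u v : ℝ → ℂ} {a b : Fin 3 → ℂ}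
    (hu : HasEndpointValues I u a) (hv : HasEndpointValues I v b) :
    HasEndpointValues I (u + v) (a + b) := by
  obtain ⟨f, hf, huf, hfa⟩ := hu
  obtain ⟨g, hg, hvg, hgb⟩ := hv
  refine ⟨f + g, hf.add hg, huf.add hvg, fun k => ((hfa k).add (hgb k)).congr' ?_⟩
  filter_upwards [self_mem_nhdsWithin] with x hx
  have hk : ((k : ℕ) : WithTop ℕ∞) ≤ 2 := by
    exact_mod_cast Nat.lt_succ_iff.1 k.2
  exact (iteratedDeriv_add ((hf.contDiffAt (hI.mem_nhds hx)).of_le hk)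
    ((hg.contDiffAt (hI.mem_nhds hx)).of_le hk)).symm

theorem HasEndpointValues.const_smul {I : Set ℝ} (hI : IsOpen I) {u : ℝ → ℂ} {a : Fin 3 → ℂ}
    (c : ℂ) (hu : HasEndpointValues I u a) : HasEndpointValues I (c • u) (c • a) := by
  obtain ⟨f, hf, huf, hfa⟩ := hu
  refine ⟨c • f, contDiffOn_const.smul hf, huf.const_smul c,
    fun k => ((hfa k).const_smul c).congr' ?_⟩
  filter_upwards [self_mem_nhdsWithin] with x hx
  have hk : ((k : ℕ) : WithTop ℕ∞) ≤ 2 := by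
    exact_mod_cast Nat.lt_succ_iff.1 k.2
  exact (iteratedDeriv_const_smul ((hf.contDiffAt (hI.mem_nhds hx)).of_le hk) c).symm

theorem HasEndpointValues.congr {I : Set ℝ} {u v : ℝ → ℂ} {a : Fin 3 → ℂ}
    (hu : HasEndpointValues I u a) (h : v =ᵐ[volume.restrict I] u) : HasEndpointValues I v a := by
  obtain ⟨f, hf, huf, hfa⟩ := hu
  exact ⟨f, hf, h.trans huf, hfa⟩

/-- The functions satisfying the transmission condition
`(u(0-), u'(0-), u''(0-)) ∈ D(L)`,
`L (u(0-), u'(0-), u''(0-)) = (u(0+), u'(0+), u''(0+))`. -/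
def transmission (L : BdSpace Em →ₗ.[ℂ] BdSpace Ep) : Submodule ℂ (L2Graph Em Ep) where
  carrier := {u | ∃ ξ : L.domain, HasBoundaryValues u (ξ : BdSpace Em) (L ξ)}
  zero_mem' := by
    refine ⟨0, fun e => ?_, fun e => ?_⟩
    · exact (HasEndpointValues.zero _).congr (Lp.coeFn_zero ℂ 2 (volume.restrict _))
    · rw [LinearPMap.map_zero]
      exact (HasEndpointValues.zero _).congr (Lp.coeFn_zero ℂ 2 (volume.restrict _))
  add_mem' := by
    rintro u v ⟨ξ, hξm, hξp⟩ ⟨η, hηm, hηp⟩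
    refine ⟨ξ + η, fun e => ?_, fun e => ?_⟩
    · exact ((hξm e).add (isOpen_halfLine _) (hηm e)).congr (Lp.coeFn_add _ _)
    · rw [LinearPMap.map_add]
      exact ((hξp e).add (isOpen_halfLine _) (hηp e)).congr (Lp.coeFn_add _ _)
  smul_mem' := by
    rintro c u ⟨ξ, hξm, hξp⟩
    refine ⟨c • ξ, fun e => ?_, fun e => ?_⟩
    · exact ((hξm e).const_smul (isOpen_halfLine _) c).congr (Lp.coeFn_smul _ _)
    · rw [LinearPMap.map_smul]
      exact ((hξp e).const_smul (isOpen_halfLine _) c).congr (Lp.coeFn_smul _ _)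

/-- The operator `A_L`: the restriction of `-A₀^*` to those `u ∈ D(A₀^*)` that satisfy the
transmission condition given by `L`. -/
def airyOp (cm : EdgeCoeffs Em) (cp : EdgeCoeffs Ep) (L : BdSpace Em →ₗ.[ℂ] BdSpace Ep) :
    L2Graph Em Ep →ₗ.[ℂ] L2Graph Em Ep :=
  (-(A₀ cm cp)†).domRestrict (transmission L)

end Graph

end AiryStar

end

noncomputable section

namespace AiryStar

/-! ### Properties of generators of contraction semigroups -/

section Generator

variable {H : Type*} [NormedAddCommGroup H] [InnerProductSpace ℂ H]
variable {T : ℝ≥0 → H →L[ℂ] H} {A : H →ₗ.[ℂ] H}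

/-! On a Hilbert space, a densely defined operator generates a contraction semigroup exactly when it
is closed and both it and its adjoint are dissipative (Lumer–Phillips). For `A_L` these three
properties are carried over to `L` through boundary values at the vertex.

The operator `-A₀^*` acts on each edge as `α ∂³ + β ∂` on its maximal domain: integrating the weak
equation three times shows that `u`, `u'`, `u''` are locally absolutely continuous up to the vertex
(`exists_isJet_of_weak`, `mem_graph_neg_adjoint_iff`). Pairing a solution with cutoff monomials
bounds its first three jet components at a point by the `L²` mass of `u` and of the Airy expression
on an adjacent unit interval (`exists_trace_bound`). Hence they decay at infinity, and, the
coefficients being uniformly bounded, their values at the vertex are square summable over the edges.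
Green's formula (`MaxRel.green`) then has vertex terms only, and these are the two Krein forms: for
`w = -A₀^* u` with boundary values `(ξ, η)` it gives `2 Re (u, w) = ⟨η | η⟩₊ - ⟨ξ | ξ⟩₋`.

Conversely, every `(ξ, η)` is attained, with norm control, by cut-off quadratic polynomials
(`exists_maxRel_lift`). So the boundary map is continuous from the graph of `-A₀^*` onto `𝒢₋ ⊕ 𝒢₊`,
with a norm-controlled lift, and the graph of `A_L` is the preimage of the graph of `L`
(`mem_graph_airyOp_iff`). Therefore `A_L` is closed iff `L` is, and it is dissipative iff `L` is a
contraction. Since `A_L` extends `A₀`, its adjoint is a restriction of `A₀^*`, and by Green's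
formula its domain consists of the `v` whose boundary values `(z, y)` satisfy `L^♯ y = z`
(`mem_graph_kreinAdjoint_iff_of_maxRel`). On it `2 Re (v, A_L^* v) = ⟨z | z⟩₋ - ⟨y | y⟩₊`, so the
adjoint is dissipative iff `L^♯` is a contraction. -/

theorem IsContractionC0Semigroup.norm_apply_le (hT : IsContractionC0Semigroup T) (t : ℝ≥0) (x : H) :
    ‖T t x‖ ≤ ‖x‖ := by
  simpa using (T t).le_of_opNorm_le (hT.norm_le_one t) x

theorem IsContractionC0Semigroup.map_add_apply (hT : IsContractionC0Semigroup T) (s t : ℝ≥0)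
    (x : H) : T (s + t) x = T s (T t x) := by
  rw [hT.map_add]; rfl

theorem IsContractionC0Semigroup.re_inner_sub_nonpos (hT : IsContractionC0Semigroup T) (t : ℝ≥0)
    (x : H) : (inner ℂ x (T t x - x)).re ≤ 0 := by
  have h1 : (inner ℂ x (T t x)).re ≤ ‖x‖ * ‖x‖ :=
    ((Complex.re_le_norm _).trans (norm_inner_le_norm _ _)).trans
      (mul_le_mul_of_nonneg_left (hT.norm_apply_le t x) (norm_nonneg _))
  have h2 : (inner ℂ x x).re = ‖x‖ * ‖x‖ := by
    have := inner_self_eq_norm_mul_norm (𝕜 := ℂ) x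
    simpa using this
  rw [inner_sub_right, Complex.sub_re, h2]
  linarith

theorem IsGeneratorOf.re_inner_nonpos (hT : IsContractionC0Semigroup T) (hA : IsGeneratorOf A T)
    {x y : H} (h : (x, y) ∈ A.graph) : (inner ℂ x y).re ≤ 0 := by
  have h1 := (hA x y).1 h
  have h2 : Tendsto (fun t : ℝ≥0 => (inner ℂ x ((((t : ℝ) : ℂ))⁻¹ • (T t x - x))).re) (𝓝[>] 0)
      (𝓝 (inner ℂ x y).re) :=
    (Complex.continuous_re.tendsto _).comp (tendsto_const_nhds.inner (𝕜 := ℂ) h1)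
  refine le_of_tendsto h2 (Eventually.of_forall fun t => ?_)
  rw [inner_smul_right, ← Complex.ofReal_inv, Complex.re_ofReal_mul]
  exact mul_nonpos_of_nonneg_of_nonpos (inv_nonneg.2 t.2) (hT.re_inner_sub_nonpos t x)

/-- By the semigroup law and contractivity, the increment over `[a, a + d]` is at most the increment
over `[0, d]`, so continuity at `0` propagates to every time, from both sides. -/
theorem IsContractionC0Semigroup.continuous_orbit (hT : IsContractionC0Semigroup T) (x : H) :
    Continuous fun t => T t x := by
  refine continuous_iff_continuousAt.2 fun s => ?_
  rw [ContinuousAt, tendsto_iff_norm_sub_tendsto_zero]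
  have key : ∀ a d : ℝ≥0, ‖T (a + d) x - T a x‖ ≤ ‖T d x - x‖ := fun a d => by
    rw [hT.map_add_apply, ← _root_.map_sub]; exact hT.norm_apply_le _ _
  have h0 : Tendsto (fun t => ‖T (nndist t s) x - x‖) (𝓝 s) (𝓝 0) := by
    rw [← tendsto_iff_norm_sub_tendsto_zero]
    refine (hT.strongly_continuous x).comp ?_
    have : Continuous fun t : ℝ≥0 => nndist t s := by fun_prop
    simpa using this.tendsto s
  refine squeeze_zero (fun _ => norm_nonneg _) (fun t => ?_) h0
  rcases le_total s t with h | h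
  · have : t = s + nndist t s := by
      rw [NNReal.nndist_eq, tsub_eq_zero_of_le h, max_eq_left zero_le, add_tsub_cancel_of_le h]
    conv_lhs => rw [this]
    exact key _ _
  · have : s = t + nndist t s := by
      rw [NNReal.nndist_eq, tsub_eq_zero_of_le h, max_eq_right zero_le, add_tsub_cancel_of_le h]
    conv_lhs => rw [this, norm_sub_rev]
    simpa [this.symm] using key t (nndist t s)

theorem IsContractionC0Semigroup.continuous_orbit_real (hT : IsContractionC0Semigroup T) (x : H) :
    Continuous fun s : ℝ => T s.toNNReal x :=
  (hT.continuous_orbit x).comp continuous_real_toNNReal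

/-- The operator `x ↦ ∫₀ᵗ T(s) x ds`. -/
def orbitIntegral (hT : IsContractionC0Semigroup T) (t : ℝ≥0) : H →L[ℂ] H :=
  LinearMap.mkContinuous
    { toFun := fun x => ∫ s in (0 : ℝ)..t, T s.toNNReal x
      map_add' := fun x y => by
        simp only [map_add]
        exact intervalIntegral.integral_add ((hT.continuous_orbit_real x).intervalIntegrable _ _)
          ((hT.continuous_orbit_real y).intervalIntegrable _ _)
      map_smul' := fun c x => by
        simp only [map_smul, RingHom.id_apply]
        exact intervalIntegral.integral_smul c _ } t fun x => by
    have := intervalIntegral.norm_integral_le_of_norm_le_const (a := (0 : ℝ)) (b := t)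
      (f := fun s => T s.toNNReal x) (C := ‖x‖) fun s _ => hT.norm_apply_le _ x
    simpa [mul_comm] using this

theorem orbitIntegral_apply (hT : IsContractionC0Semigroup T) (t : ℝ≥0) (x : H) :
    orbitIntegral hT t x = ∫ s in (0 : ℝ)..t, T s.toNNReal x := rfl

variable [CompleteSpace H]

theorem map_orbitIntegral (hT : IsContractionC0Semigroup T) (h t : ℝ≥0) (x : H) :
    T h (orbitIntegral hT t x) = orbitIntegral hT t (T h x) := by
  rw [orbitIntegral_apply, orbitIntegral_apply, ← ContinuousLinearMap.intervalIntegral_comp_comm _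
    ((hT.continuous_orbit_real x).intervalIntegrable _ _)]
  refine intervalIntegral.integral_congr fun s _ => ?_
  simp only [← hT.map_add_apply, add_comm]

theorem hasDerivAt_orbit (hT : IsContractionC0Semigroup T) (x : H) (t : ℝ) :
    HasDerivAt (fun r : ℝ => ∫ s in (0 : ℝ)..r, T s.toNNReal x) (T t.toNNReal x) t :=
  intervalIntegral.integral_hasDerivAt_right
    ((hT.continuous_orbit_real x).intervalIntegrable _ _)
    ((hT.continuous_orbit_real x).stronglyMeasurableAtFilter _ _)
    (hT.continuous_orbit_real x).continuousAt

theorem tendsto_coe_nhdsGT :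
    Tendsto (fun t : ℝ≥0 => (t : ℝ)) (𝓝[>] 0) (𝓝[≠] 0) := by
  refine tendsto_nhdsWithin_iff.2 ⟨?_, ?_⟩
  · exact (NNReal.continuous_coe.tendsto' 0 0 rfl).mono_left nhdsWithin_le_nhds
  · filter_upwards [self_mem_nhdsWithin] with t ht
    exact (NNReal.coe_pos.2 ht).ne'

/-- Applying `T h` shifts the interval of integration, so the increment is the integral over `[t, t
+ h]` minus that over `[0, h]`; divided by `h`, each converges by the fundamental theorem of
calculus. -/
theorem tendsto_orbitIntegral_quotient (hT : IsContractionC0Semigroup T) (t : ℝ≥0) (x : H) :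
    Tendsto (fun h : ℝ≥0 => (((h : ℝ) : ℂ))⁻¹ • (T h (orbitIntegral hT t x) - orbitIntegral hT t x))
      (𝓝[>] 0) (𝓝 (T t x - x)) := by
  have h1 := ((hasDerivAt_iff_tendsto_slope_zero.1 (hasDerivAt_orbit hT x t)).comp
    tendsto_coe_nhdsGT)
  have h0 := ((hasDerivAt_iff_tendsto_slope_zero.1 (hasDerivAt_orbit hT x 0)).comp
    tendsto_coe_nhdsGT)
  have h := h1.sub h0
  simp only [Real.toNNReal_coe, Real.toNNReal_zero, hT.map_zero, ContinuousLinearMap.id_apply] at h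
  refine h.congr fun h => ?_
  have e1 : T h (orbitIntegral hT t x) =
      (∫ s in (0 : ℝ)..(t + h), T s.toNNReal x) - ∫ s in (0 : ℝ)..h, T s.toNNReal x := by
    rw [map_orbitIntegral, orbitIntegral_apply,
      intervalIntegral.integral_interval_sub_left
        ((hT.continuous_orbit_real x).intervalIntegrable _ _)
        ((hT.continuous_orbit_real x).intervalIntegrable _ _)]
    have := intervalIntegral.integral_comp_add_right (a := 0) (b := (t : ℝ))
      (fun s : ℝ => T s.toNNReal x) (h : ℝ)
    rw [zero_add] at this
    rw [← this]
    refine intervalIntegral.integral_congr fun s hs => ?_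
    rw [uIcc_of_le t.coe_nonneg] at hs
    simp only [← hT.map_add_apply, Real.toNNReal_add hs.1 h.coe_nonneg, Real.toNNReal_coe]
  simp only [Function.comp_apply, zero_add, intervalIntegral.integral_same, sub_zero, ← smul_sub]
  rw [e1, orbitIntegral_apply, ← Complex.ofReal_inv, Complex.coe_smul]
  congr 1
  abel

theorem IsGeneratorOf.orbitIntegral_mem (hT : IsContractionC0Semigroup T) (hA : IsGeneratorOf A T)
    (t : ℝ≥0) (x : H) : (orbitIntegral hT t x, T t x - x) ∈ A.graph :=
  (hA _ _).2 (tendsto_orbitIntegral_quotient hT t x)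

/-- The orbit integral is bounded and commutes with the semigroup, so applied to the difference
quotients of `x` it yields those of `orbitIntegral hT t x`, whose limit is known. -/
theorem IsGeneratorOf.orbitIntegral_eq (hT : IsContractionC0Semigroup T) (hA : IsGeneratorOf A T)
    (t : ℝ≥0) {x y : H} (h : (x, y) ∈ A.graph) : orbitIntegral hT t y = T t x - x := by
  have h1 := ((orbitIntegral hT t).continuous.tendsto y).comp ((hA x y).1 h)
  refine tendsto_nhds_unique (h1.congr fun s => ?_) (tendsto_orbitIntegral_quotient hT t x)
  simp only [Function.comp_apply, map_smul, _root_.map_sub, map_orbitIntegral]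

theorem tendsto_orbitIntegral_average (hT : IsContractionC0Semigroup T) (x : H) :
    Tendsto (fun t : ℝ≥0 => (((t : ℝ) : ℂ))⁻¹ • orbitIntegral hT t x) (𝓝[>] 0) (𝓝 x) := by
  have h0 := ((hasDerivAt_iff_tendsto_slope_zero.1 (hasDerivAt_orbit hT x 0)).comp
    tendsto_coe_nhdsGT)
  simp only [Real.toNNReal_zero, hT.map_zero, ContinuousLinearMap.id_apply] at h0
  refine h0.congr fun h => ?_
  simp only [Function.comp_apply, zero_add, intervalIntegral.integral_same, sub_zero]
  rw [orbitIntegral_apply, ← Complex.ofReal_inv, Complex.coe_smul]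

/-- Unlike the defining limit, the identity `∫₀ᵗ T(s) y ds = T(t) x - x` is continuous in `(x, y)`
and so passes to limits of graph elements; dividing by `t` recovers membership in the graph. -/
theorem IsGeneratorOf.isClosed (hT : IsContractionC0Semigroup T) (hA : IsGeneratorOf A T) :
    A.IsClosed := by
  refine isSeqClosed_iff_isClosed.1 fun p q hp hpq => ?_
  have h1 := (continuous_fst.tendsto q).comp hpq
  have h2 := (continuous_snd.tendsto q).comp hpq
  have key (t : ℝ≥0) : orbitIntegral hT t q.2 = T t q.1 - q.1 := by
    refine tendsto_nhds_unique (((orbitIntegral hT t).continuous.tendsto _).comp h2)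
      (((((T t).continuous.tendsto _).comp h1).sub h1).congr fun n => ?_)
    exact (hA.orbitIntegral_eq hT t (hp n)).symm
  refine (hA q.1 q.2).2 ?_
  simp only [← key]
  exact tendsto_orbitIntegral_average hT q.2

/-- The adjoint of the generator of a contraction semigroup is dissipative. -/
theorem IsGeneratorOf.re_inner_adjoint_nonpos (hT : IsContractionC0Semigroup T)
    (hA : IsGeneratorOf A T) {v w : H} (h : ∀ x : A.domain, inner ℂ v (A x) = inner ℂ w (x : H)) :
    (inner ℂ v w).re ≤ 0 := by
  have h1 : Tendsto (fun t : ℝ≥0 => (inner ℂ w ((((t : ℝ) : ℂ))⁻¹ • orbitIntegral hT t v)).re)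
      (𝓝[>] 0) (𝓝 (inner ℂ w v).re) :=
    (Complex.continuous_re.tendsto _).comp 
      (tendsto_const_nhds.inner (𝕜 := ℂ) (tendsto_orbitIntegral_average hT v))
  have h2 : (inner ℂ v w).re = (inner ℂ w v).re := by
    rw [← inner_conj_symm, Complex.conj_re]
  rw [h2]
  refine le_of_tendsto h1 (Eventually.of_forall fun t => ?_)
  -- The test element is the orbit integral of `v` itself: it lies in the domain and `A` maps it to
  -- `T(t) v - v`, whose inner product with `v` has nonpositive real part.
  obtain ⟨y, hy1, hy2⟩ := (LinearPMap.mem_graph_iff A).1 (hA.orbitIntegral_mem hT t v)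
  simp only at hy1 hy2
  rw [inner_smul_right, ← hy1, ← h y, hy2, ← Complex.ofReal_inv, Complex.re_ofReal_mul]
  exact mul_nonpos_of_nonneg_of_nonpos (inv_nonneg.2 t.2) (hT.re_inner_sub_nonpos t v)

end Generator

/-! ### The Lumer–Phillips theorem -/

section LumerPhillips

variable {H : Type*} [NormedAddCommGroup H] [InnerProductSpace ℂ H]

/-- `R` is the resolvent `(l - A)⁻¹` of a dissipative operator `A` at the point `l > 0`. -/
structure IsDissipativeResolvent (A : H →ₗ.[ℂ] H) (l : ℝ) (R : H →L[ℂ] H) : Prop where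
  mem_graph : ∀ y, (R y, (l : ℂ) • R y - y) ∈ A.graph
  apply_sub : ∀ p ∈ A.graph, R ((l : ℂ) • p.1 - p.2) = p.1
  norm_smul_le : ‖(l : ℂ) • R‖ ≤ 1

/-- Dissipativity gives `l ‖x‖² ≤ Re (x, l x - y)`; then Cauchy–Schwarz. -/
theorem mul_norm_le_norm_smul_sub {l : ℝ} {x y : H} (h : (inner ℂ x y).re ≤ 0) :
    l * ‖x‖ ≤ ‖(l : ℂ) • x - y‖ := by
  rcases eq_or_ne x 0 with rfl | hx
  · simp
  have hx' : 0 < ‖x‖ := norm_pos_iff.2 hx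
  have h1 : (inner ℂ x ((l : ℂ) • x - y)).re ≤ ‖x‖ * ‖(l : ℂ) • x - y‖ :=
    (Complex.re_le_norm _).trans (norm_inner_le_norm _ _)
  have h2 : (inner ℂ x x).re = ‖x‖ * ‖x‖ := by
    have := inner_self_eq_norm_mul_norm (𝕜 := ℂ) x
    simpa using this
  rw [inner_sub_right, inner_smul_right, Complex.sub_re, Complex.re_ofReal_mul, h2] at h1
  refine le_of_mul_le_mul_left ?_ hx'
  linarith

/-- The Yosida approximation `l² R - l` associated with the resolvent `R` at `l`. -/
def yosida (l : ℝ) (R : H →L[ℂ] H) : H →L[ℂ] H := (l : ℂ) • ((l : ℂ) • R) - (l : ℂ) • 1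

variable {A : H →ₗ.[ℂ] H} {l m : ℝ} {R Q : H →L[ℂ] H}

/-- This is where the approximation gets its use: on `D(A)` it equals `(l R) A`, with `l R` a
contraction that tends strongly to the identity as `l` grows. -/
theorem yosida_apply (hR : IsDissipativeResolvent A l R) {x y : H} (h : (x, y) ∈ A.graph) :
    yosida l R x = ((l : ℂ) • R) y := by
  have h1 := hR.apply_sub _ h
  simp only [_root_.map_sub, map_smul] at h1
  simp only [yosida, smul_apply, sub_apply,
    one_apply_eq_self]
  rw [← smul_sub, sub_eq_iff_eq_add.1 h1]
  congr 1
  abel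

/-- By the resolvent identity both products become `Q y - R y` after multiplication by `l - m`. For
`l = m` the two resolvents coincide. -/
theorem IsDissipativeResolvent.apply_comm (hR : IsDissipativeResolvent A l R)
    (hQ : IsDissipativeResolvent A m Q) (y : H) : R (Q y) = Q (R y) := by
  rcases eq_or_ne l m with rfl | hlm
  · have h3 (z : H) : R z = Q z := by
      have := hQ.apply_sub _ (hR.mem_graph z)
      simp only [sub_sub_cancel] at this
      exact this.symm
    simp [h3]
  have h1 := hR.apply_sub _ (hQ.mem_graph y)
  have h2 := hQ.apply_sub _ (hR.mem_graph y)
  simp only [_root_.map_sub, map_smul] at h1 h2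
  have e1 : ((l : ℂ) - m) • R (Q y) = Q y - R y := by
    nth_rw 2 [← h1]; module
  have e2 : ((l : ℂ) - m) • Q (R y) = Q y - R y := by
    nth_rw 2 [← h2]; module
  have h3 : ((l : ℂ) - m) • (R (Q y) - Q (R y)) = 0 := by rw [smul_sub, e1, e2, sub_self]
  rcases smul_eq_zero.1 h3 with h | h
  · exact absurd (by exact_mod_cast sub_eq_zero.1 h) hlm
  · exact sub_eq_zero.1 h

theorem commute_yosida (hR : IsDissipativeResolvent A l R) (hQ : IsDissipativeResolvent A m Q) :
    Commute (yosida l R) (yosida m Q) := by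
  have h : Commute R Q := ContinuousLinearMap.ext fun y => hR.apply_comm hQ y
  have h1 : Commute ((l : ℂ) • ((l : ℂ) • R)) ((m : ℂ) • ((m : ℂ) • Q)) :=
    (((h.smul_left _).smul_left _).smul_right _).smul_right _
  exact (h1.sub_right ((Commute.one_right _).smul_right _)).sub_left
    (((Commute.one_left _).smul_left _))

theorem cauchySeq_apply_of_dense {S : ℕ → H →L[ℂ] H} (hS : ∀ n, ‖S n‖ ≤ 1) {D : Set H}
    (hD : Dense D) (h : ∀ x ∈ D, CauchySeq fun n => S n x) (x : H) : CauchySeq fun n => S n x := by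
  refine Metric.cauchySeq_iff'.2 fun ε hε => ?_
  obtain ⟨z, hz, hxz⟩ := hD.exists_dist_lt x (ε := ε / 3) (by positivity)
  obtain ⟨N, hN⟩ := Metric.cauchySeq_iff'.1 (h z hz) (ε / 3) (by positivity)
  refine ⟨N, fun n hn => ?_⟩
  have hle (k : ℕ) (v w : H) : dist (S k v) (S k w) ≤ dist v w := by
    rw [dist_eq_norm, dist_eq_norm, ← _root_.map_sub]
    simpa using ContinuousLinearMap.le_of_opNorm_le _ (hS k) (v - w)
  calc dist (S n x) (S N x) ≤ dist (S n x) (S n z) + dist (S n z) (S N z) + dist (S N z) (S N x) :=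
        dist_triangle4 _ _ _ _
    _ < ε / 3 + ε / 3 + ε / 3 := by
        gcongr
        · exact (hle _ _ _).trans_lt hxz
        · exact hN n hn
        · exact (hle _ _ _).trans_lt (by rwa [dist_comm])
    _ = ε := by ring

theorem tendsto_apply_of_dense {ι : Type*} {u : Filter ι} {S : ι → H →L[ℂ] H}
    (hS : ∀ n, ‖S n‖ ≤ 1) {D : Set H}
    (hD : Dense D) (h : ∀ x ∈ D, Tendsto (fun n => S n x) u (𝓝 x)) (x : H) :
    Tendsto (fun n => S n x) u (𝓝 x) := by
  refine Metric.tendsto_nhds.2 fun ε hε => ?_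
  obtain ⟨z, hz, hxz⟩ := hD.exists_dist_lt x (ε := ε / 3) (by positivity)
  filter_upwards [Metric.tendsto_nhds.1 (h z hz) (ε / 3) (by positivity)] with n hn
  have hle : dist (S n x) (S n z) ≤ dist x z := by
    rw [dist_eq_norm, dist_eq_norm, ← _root_.map_sub]
    simpa using ContinuousLinearMap.le_of_opNorm_le _ (hS n) (x - z)
  calc dist (S n x) x ≤ dist (S n x) (S n z) + dist (S n z) z + dist z x :=
        dist_triangle4 _ _ _ _
    _ < ε / 3 + ε / 3 + ε / 3 := by
        gcongr
        · exact hle.trans_lt hxz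
        · rwa [dist_comm]
    _ = ε := by ring

theorem norm_apply_le_of_norm_le_one {B : H →L[ℂ] H} (hB : ‖B‖ ≤ 1) (x : H) : ‖B x‖ ≤ ‖x‖ := by
  simpa using B.le_of_opNorm_le hB x

variable [CompleteSpace H]

/-- On the graph, complete because `A` is closed, `l - A` is a bounded operator `S`. Dissipativity
bounds `S` from below, so it is injective with closed range. A vector `v` orthogonal to the range
satisfies `A^* v = l v`, and dissipativity of the adjoint forces `l ‖v‖² ≤ 0`. -/
theorem exists_dissipativeResolvent (hc : A.IsClosed)
    (hdis : ∀ p ∈ A.graph, (inner ℂ p.1 p.2).re ≤ 0)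
    (hadj : ∀ v w : H, (∀ p ∈ A.graph, inner ℂ v p.2 = inner ℂ w p.1) → (inner ℂ v w).re ≤ 0)
    (hl : 0 < l) : ∃ R, IsDissipativeResolvent A l R := by
  let S : A.graph →L[ℂ] H := ((l : ℂ) • ContinuousLinearMap.fst ℂ H H -
    ContinuousLinearMap.snd ℂ H H).comp A.graph.subtypeL
  have hS (p : A.graph) : S p = (l : ℂ) • p.1.1 - p.1.2 := rfl
  have hb (p : A.graph) : l * ‖p.1.1‖ ≤ ‖S p‖ := mul_norm_le_norm_smul_sub (hdis _ p.2)
  have hb1 (p : A.graph) : ‖p.1.1‖ ≤ l⁻¹ * ‖S p‖ := by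
    rw [inv_mul_eq_div, le_div_iff₀ hl, mul_comm]; exact hb p
  have hb2 (p : A.graph) : ‖p.1.2‖ ≤ 2 * ‖S p‖ := by
    have : p.1.2 = (l : ℂ) • p.1.1 - S p := by rw [hS]; abel
    rw [this]
    refine (norm_sub_le _ _).trans ?_
    rw [norm_smul, Complex.norm_real, Real.norm_of_nonneg hl.le]
    linarith [hb p]
  have : CompleteSpace A.graph := IsClosed.completeSpace_coe (hs := hc)
  -- The product norm is a maximum; the sum of the bounds `l⁻¹` for the first and `2` for the second
  -- component dominates both.
  have hanti : AntilipschitzWith (⟨l⁻¹ + 2, by positivity⟩ : ℝ≥0) S := by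
    refine S.antilipschitz_of_bound fun p => ?_
    have : 0 ≤ l⁻¹ := by positivity
    change ‖p.1‖ ≤ (l⁻¹ + 2) * ‖S p‖
    refine max_le ((hb1 p).trans ?_) ((hb2 p).trans ?_) <;> nlinarith [norm_nonneg (S p)]
  have hclosed : IsClosed (S.range : Set H) := by
    exact hanti.isClosed_range S.uniformContinuous
  have hperp : S.rangeᗮ = ⊥ := by
    refine (Submodule.eq_bot_iff _).2 fun v hv => ?_
    have hv' : ∀ p ∈ A.graph, inner ℂ v p.2 = inner ℂ ((l : ℂ) • v) p.1 := fun p hp => by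
      have := (Submodule.mem_orthogonal' _ _).1 hv _ (LinearMap.mem_range_self _ ⟨p, hp⟩)
      have h2 : inner ℂ v ((l : ℂ) • p.1 - p.2) = 0 := this
      rw [inner_sub_right, inner_smul_right, sub_eq_zero] at h2
      rw [inner_smul_left, Complex.conj_ofReal, h2]
    have h3 := hadj v _ hv'
    rw [inner_smul_right, Complex.re_ofReal_mul] at h3
    have h4 : (inner ℂ v v).re = ‖v‖ * ‖v‖ := by
      have := inner_self_eq_norm_mul_norm (𝕜 := ℂ) v
      simpa using this
    rw [h4] at h3
    have : ‖v‖ * ‖v‖ ≤ 0 := by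
      by_contra! hcon
      nlinarith [mul_pos hl hcon]
    exact norm_eq_zero.1 (by nlinarith [norm_nonneg v])
  have hrange : S.range = ⊤ := by
    have h1 := (Submodule.topologicalClosure_eq_top_iff (K := S.range)).2 hperp
    rwa [hclosed.submodule_topologicalClosure_eq] at h1
  let e : A.graph ≃ₗ[ℂ] H := LinearEquiv.ofBijective (S : A.graph →ₗ[ℂ] H)
    ⟨hanti.injective, LinearMap.range_eq_top.1 hrange⟩
  have he (p : A.graph) : e p = S p := rfl
  let R : H →L[ℂ] H := LinearMap.mkContinuous
    (LinearMap.fst ℂ H H ∘ₗ A.graph.subtype ∘ₗ e.symm.toLinearMap) l⁻¹ fun y => by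
      have := hb1 (e.symm y)
      rwa [← he, e.apply_symm_apply] at this
  have hR (y : H) : R y = (e.symm y).1.1 := rfl
  refine ⟨R, fun y => ?_, fun p hp => ?_, ?_⟩
  · have h1 : (l : ℂ) • R y - y = (e.symm y).1.2 := by
      have := e.apply_symm_apply y
      rw [he, hS] at this
      nth_rw 2 [← this]
      rw [hR]; abel
    rw [h1, hR]
    exact (e.symm y).2
  · have : (l : ℂ) • p.1 - p.2 = e ⟨p, hp⟩ := rfl
    rw [this, hR, e.symm_apply_apply]
  · rw [norm_smul, Complex.norm_real, Real.norm_of_nonneg hl.le]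
    calc l * ‖R‖ ≤ l * l⁻¹ := by
          gcongr
          exact LinearMap.mkContinuous_norm_le _ (by positivity) _
      _ = 1 := mul_inv_cancel₀ hl.ne'

theorem norm_exp_le_exp_norm (B : H →L[ℂ] H) : ‖NormedSpace.exp B‖ ≤ Real.exp ‖B‖ := by
  rw [NormedSpace.exp_eq_tsum ℝ, Real.exp_eq_exp_ℝ, NormedSpace.exp_eq_tsum ℝ]
  have hle (n : ℕ) : ‖((n.factorial : ℝ)⁻¹) • B ^ n‖ ≤ ((n.factorial : ℝ)⁻¹) • ‖B‖ ^ n := by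
    rw [norm_smul, norm_inv, Real.norm_natCast, smul_eq_mul]
    refine mul_le_mul_of_nonneg_left ?_ (by positivity)
    -- The term `n = 0` is separate because the identity has norm `0`, not `1`, on the trivial
    -- space.
    rcases n.eq_zero_or_pos with rfl | hn
    · rw [pow_zero, pow_zero]; exact ContinuousLinearMap.norm_id_le
    · exact norm_pow_le' B hn
  have hs : Summable fun n : ℕ => ((n.factorial : ℝ)⁻¹) • ‖B‖ ^ n :=
    NormedSpace.expSeries_summable' (𝕂 := ℝ) ‖B‖
  exact tsum_of_norm_bounded hs.hasSum hle

/-- The exponential factors as `e^{-tl} exp(t l · l R)`, and `‖l R‖ ≤ 1` bounds the second factor by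
`e^{tl}`. -/
theorem norm_exp_smul_yosida_le (hl : 0 < l) (hR : IsDissipativeResolvent A l R) {t : ℝ}
    (ht : 0 ≤ t) : ‖NormedSpace.exp (t • yosida l R)‖ ≤ 1 := by
  have h1 : t • yosida l R = (t * l) • ((l : ℂ) • R) + (-(t * l)) • (1 : H →L[ℂ] H) := by
    ext x
    simp only [yosida, smul_apply, sub_apply,
      add_apply, Complex.coe_smul]
    module
  let +nondep : NormedAlgebra ℚ (H →L[ℂ] H) := .restrictScalars ℚ ℝ _
  have h2 : Commute ((t * l) • ((l : ℂ) • R)) ((-(t * l)) • (1 : H →L[ℂ] H)) :=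
    (Commute.one_right _).smul_right _
  have h3 : NormedSpace.exp ((-(t * l)) • (1 : H →L[ℂ] H)) =
      Real.exp (-(t * l)) • (1 : H →L[ℂ] H) := by
    rw [← Algebra.algebraMap_eq_smul_one, ← Algebra.algebraMap_eq_smul_one,
      Real.exp_eq_exp_ℝ, NormedSpace.algebraMap_exp_comm]
  have h4 : ‖(t * l) • ((l : ℂ) • R)‖ ≤ t * l := by
    rw [norm_smul, Real.norm_of_nonneg (by positivity)]
    exact mul_le_of_le_one_right (by positivity) hR.norm_smul_le
  rw [h1, NormedSpace.exp_add_of_commute h2, h3, mul_smul_comm, mul_one, norm_smul,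
    Real.norm_of_nonneg (Real.exp_pos _).le]
  calc _ ≤ Real.exp (-(t * l)) * Real.exp (t * l) := by
        gcongr
        exact (norm_exp_le_exp_norm _).trans (Real.exp_le_exp.2 h4)
    _ = 1 := by rw [← Real.exp_add]; simp

theorem hasDerivAt_exp_smul_apply (B : H →L[ℂ] H) (x : H) (t : ℝ) :
    HasDerivAt (fun s : ℝ => NormedSpace.exp (s • B) x) (NormedSpace.exp (t • B) (B x)) t := by
  have h := hasDerivAt_exp_smul_const (𝕂 := ℝ) B t
  have := ((ContinuousLinearMap.apply ℂ H x).restrictScalars ℝ).hasFDerivAt.comp_hasDerivAt t h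
  exact this

theorem norm_exp_smul_apply_sub_le {B : H →L[ℂ] H}
    (hB : ∀ s : ℝ, 0 ≤ s → ‖NormedSpace.exp (s • B)‖ ≤ 1) {t : ℝ} (ht : 0 ≤ t) (x : H) :
    ‖NormedSpace.exp (t • B) x - x‖ ≤ t * ‖B x‖ := by
  have h := norm_image_sub_le_of_norm_deriv_le_segment' (a := 0) (b := t) (C := ‖B x‖)
    (f := fun s : ℝ => NormedSpace.exp (s • B) x)
    (fun s _ => (hasDerivAt_exp_smul_apply B x s).hasDerivWithinAt)
    (fun s hs => by simpa using ContinuousLinearMap.le_of_opNorm_le _ (hB s hs.1) (B x)) t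
    ⟨ht, le_rfl⟩
  simpa [mul_comm] using h

/-- Intended for `y = A x` and `z ∈ D(A)` close to `y`: `B z` then stays bounded along the Yosida
approximations, which `B y` need not do. The mean value inequality reduces the claim to bounding
`exp(sB) B x - y`, and `z` is inserted there. -/
theorem norm_exp_smul_apply_sub_smul_le {B : H →L[ℂ] H}
    (hB : ∀ s : ℝ, 0 ≤ s → ‖NormedSpace.exp (s • B)‖ ≤ 1) {t : ℝ} (ht : 0 ≤ t) (x y z : H) :
    ‖NormedSpace.exp (t • B) x - x - t • y‖ ≤ t * (‖B x - y‖ + 2 * ‖y - z‖ + t * ‖B z‖) := by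
  have hle (s : ℝ) (hs : 0 ≤ s) (v : H) : ‖NormedSpace.exp (s • B) v‖ ≤ ‖v‖ := by
    simpa using ContinuousLinearMap.le_of_opNorm_le _ (hB s hs) v
  have hd (s : ℝ) : HasDerivAt (fun s : ℝ => NormedSpace.exp (s • B) x - s • y)
      (NormedSpace.exp (s • B) (B x) - y) s := by
    have h2 : HasDerivAt (fun s : ℝ => s • y) ((1 : ℝ) • y) s := (hasDerivAt_id s).smul_const y
    rw [one_smul] at h2
    exact (hasDerivAt_exp_smul_apply B x s).sub h2
  have h := norm_image_sub_le_of_norm_deriv_le_segment' (a := 0) (b := t)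
    (C := ‖B x - y‖ + 2 * ‖y - z‖ + t * ‖B z‖)
    (fun s _ => (hd s).hasDerivWithinAt)
    (fun s hs => by
      have e : NormedSpace.exp (s • B) (B x) - y = NormedSpace.exp (s • B) (B x - y) +
          NormedSpace.exp (s • B) (y - z) + (NormedSpace.exp (s • B) z - z) + (z - y) := by
        simp only [_root_.map_sub]; abel
      rw [e]
      have h1 := hle s hs.1 (B x - y)
      have h2 := hle s hs.1 (y - z)
      have h3 := norm_exp_smul_apply_sub_le hB hs.1 z
      have h4 : s * ‖B z‖ ≤ t * ‖B z‖ := mul_le_mul_of_nonneg_right hs.2.le (norm_nonneg _)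
      have h5 : ‖z - y‖ = ‖y - z‖ := norm_sub_rev _ _
      have h6 := norm_add_le (NormedSpace.exp (s • B) (B x - y) +
          NormedSpace.exp (s • B) (y - z) + (NormedSpace.exp (s • B) z - z)) (z - y)
      have h7 := norm_add₃_le (a := NormedSpace.exp (s • B) (B x - y))
        (b := NormedSpace.exp (s • B) (y - z)) (c := NormedSpace.exp (s • B) z - z)
      linarith) t ⟨ht, le_rfl⟩
  simp only [zero_smul, NormedSpace.exp_zero, one_apply_eq_self, sub_zero] at h
  rw [mul_comm]
  convert h using 2
  abel

/-- Interpolate by `s ↦ exp(sB) exp((t - s)C) x`. Since `B` and `C` commute, its derivative is a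
product of contractions applied to `(B - C) x`. -/
theorem norm_exp_smul_sub_exp_smul_le {B C : H →L[ℂ] H} (hBC : Commute B C)
    (hB : ∀ s : ℝ, 0 ≤ s → ‖NormedSpace.exp (s • B)‖ ≤ 1)
    (hC : ∀ s : ℝ, 0 ≤ s → ‖NormedSpace.exp (s • C)‖ ≤ 1) {t : ℝ} (ht : 0 ≤ t) (x : H) :
    ‖NormedSpace.exp (t • B) x - NormedSpace.exp (t • C) x‖ ≤ t * ‖B x - C x‖ := by
  have hle {D : H →L[ℂ] H} (hD : ∀ s : ℝ, 0 ≤ s → ‖NormedSpace.exp (s • D)‖ ≤ 1)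
      (s : ℝ) (hs : 0 ≤ s) (v : H) : ‖NormedSpace.exp (s • D) v‖ ≤ ‖v‖ := by
    simpa using ContinuousLinearMap.le_of_opNorm_le _ (hD s hs) v
  have hcomm (s r : ℝ) : Commute (NormedSpace.exp (s • B)) (NormedSpace.exp (r • C)) :=
    ((hBC.smul_left s).smul_right r).exp
  have hd (s : ℝ) : HasDerivAt
      (fun s : ℝ => (NormedSpace.exp (s • B) * NormedSpace.exp ((t - s) • C)) x)
      (NormedSpace.exp (s • B) (NormedSpace.exp ((t - s) • C) (B x - C x))) s := by
    have h1 := hasDerivAt_exp_smul_const (𝕂 := ℝ) B s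
    have h2 := (hasDerivAt_exp_smul_const (𝕂 := ℝ) C (t - s)).scomp s
      ((hasDerivAt_id s).const_sub t)
    have h := ((ContinuousLinearMap.apply ℂ H x).restrictScalars ℝ).hasFDerivAt.comp_hasDerivAt s
      (h1.mul h2)
    refine h.congr_deriv ?_
    have hB' : Commute B (NormedSpace.exp ((t - s) • C)) := (hBC.smul_right (t - s)).exp_right
    change (NormedSpace.exp (s • B) * B * NormedSpace.exp ((t - s) • C) +
      NormedSpace.exp (s • B) * ((-1 : ℝ) • (NormedSpace.exp ((t - s) • C) * C))) x = _
    rw [mul_assoc, hB'.eq]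
    simp [sub_eq_add_neg]
  have h := norm_image_sub_le_of_norm_deriv_le_segment' (a := 0) (b := t) (C := ‖B x - C x‖)
    (fun s _ => (hd s).hasDerivWithinAt)
    (fun s hs => (hle hB s hs.1 _).trans (hle hC _ (sub_nonneg.2 hs.2.le) _)) t ⟨ht, le_rfl⟩
  simpa [mul_comm] using h

/-- **Lumer–Phillips theorem**: a densely defined closed dissipative operator in a Hilbert space,
whose adjoint is dissipative, generates a contraction semigroup. -/
theorem generatesContractionSemigroup_of_dissipative (hd : Dense (A.domain : Set H))
    (hc : A.IsClosed) (hdis : ∀ p ∈ A.graph, (inner ℂ p.1 p.2).re ≤ 0)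
    (hadj : ∀ v w : H, (∀ p ∈ A.graph, inner ℂ v p.2 = inner ℂ w p.1) → (inner ℂ v w).re ≤ 0) :
    GeneratesContractionSemigroup A := by
  choose R hR using fun n : ℕ => exists_dissipativeResolvent hc hdis hadj n.cast_add_one_pos
  set B : ℕ → H →L[ℂ] H := fun n => yosida ((n : ℝ) + 1) (R n) with hBdef
  have hB (n : ℕ) (t : ℝ) (ht : 0 ≤ t) : ‖NormedSpace.exp (t • B n)‖ ≤ 1 :=
    norm_exp_smul_yosida_le n.cast_add_one_pos (hR n) ht
  have hcomm (n k : ℕ) : Commute (B n) (B k) := commute_yosida (hR n) (hR k)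
  -- On `D(A)` one has `l R z - z = R A z`, of norm at most `‖A z‖ / l` with `l = n + 1`; density
  -- and `‖l R‖ ≤ 1` do the rest.
  have hJ (y : H) : Tendsto (fun n : ℕ => ((((n : ℝ) + 1 : ℝ) : ℂ) • R n) y) atTop (𝓝 y) := by
    refine tendsto_apply_of_dense (fun n => (hR n).norm_smul_le) hd (fun z hz => ?_) y
    obtain ⟨z', hz'⟩ := LinearPMap.mem_domain_iff.1 hz
    rw [tendsto_iff_norm_sub_tendsto_zero]
    refine squeeze_zero (fun _ => norm_nonneg _) (fun n => ?_)
      ((tendsto_one_div_add_atTop_nhds_zero_nat (𝕜 := ℝ)).mul_const ‖z'‖ |>.trans (by simp))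
    have h1 := (hR n).apply_sub _ hz'
    simp only [_root_.map_sub, map_smul] at h1
    have h2 : ((((n : ℝ) + 1 : ℝ) : ℂ) • R n) z - z = R n z' := by
      rw [smul_apply, sub_eq_iff_eq_add.1 h1]; abel
    have h3 : (((n : ℝ) + 1 : ℝ) : ℂ) • R n z' = ((((n : ℝ) + 1 : ℝ) : ℂ) • R n) z' := rfl
    have h4 := norm_apply_le_of_norm_le_one (hR n).norm_smul_le z'
    have hn : (0 : ℝ) < (n : ℝ) + 1 := n.cast_add_one_pos
    rw [← h3, norm_smul, Complex.norm_real, Real.norm_of_nonneg hn.le] at h4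
    rw [h2, one_div, inv_mul_eq_div, le_div_iff₀ hn, mul_comm]
    exact h4
  have hBA {x y : H} (h : (x, y) ∈ A.graph) : Tendsto (fun n => B n x) atTop (𝓝 y) :=
    (hJ y).congr fun n => (yosida_apply (hR n) h).symm
  have hBle {x y : H} (h : (x, y) ∈ A.graph) (n : ℕ) : ‖B n x‖ ≤ ‖y‖ := by
    rw [hBdef, yosida_apply (hR n) h]
    exact norm_apply_le_of_norm_le_one (hR n).norm_smul_le y
  have hlim (t : ℝ≥0) (x : H) :
      ∃ z, Tendsto (fun n => NormedSpace.exp ((t : ℝ) • B n) x) atTop (𝓝 z) := by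
    refine cauchySeq_tendsto_of_complete (cauchySeq_apply_of_dense (fun n => hB n t t.coe_nonneg) hd
      (fun z hz => ?_) x)
    obtain ⟨z', hz'⟩ := LinearPMap.mem_domain_iff.1 hz
    refine Metric.cauchySeq_iff'.2 fun ε hε => ?_
    -- The denominator is `t + 1` because `t` may be zero.
    obtain ⟨N, hN⟩ := Metric.cauchySeq_iff'.1 (hBA hz').cauchySeq (ε / (t + 1)) (by positivity)
    refine ⟨N, fun n hn => ?_⟩
    have h1 := norm_exp_smul_sub_exp_smul_le (hcomm n N) (hB n) (hB N) t.coe_nonneg z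
    have h2 := hN n hn
    rw [dist_eq_norm] at h2 ⊢
    have ht := t.coe_nonneg
    rw [lt_div_iff₀ (by positivity)] at h2
    nlinarith [norm_nonneg (B n z - B N z)]
  choose U hU using hlim
  let T (t : ℝ≥0) : H →L[ℂ] H :=
    LinearMap.mkContinuous
      { toFun := U t
        map_add' := fun x y => tendsto_nhds_unique (hU t (x + y))
          (by simpa only [map_add] using (hU t x).add (hU t y))
        map_smul' := fun c x => tendsto_nhds_unique (hU t (c • x))
          (by simpa only [map_smul, RingHom.id_apply] using (hU t x).const_smul c) } 1 fun x => by
      rw [one_mul]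
      exact le_of_tendsto (hU t x).norm
        (Eventually.of_forall fun n => norm_apply_le_of_norm_le_one (hB n t t.coe_nonneg) x)
  have hTU (t : ℝ≥0) (x : H) : Tendsto (fun n => NormedSpace.exp ((t : ℝ) • B n) x) atTop
    (𝓝 (T t x)) := hU t x
  have hT1 (t : ℝ≥0) : ‖T t‖ ≤ 1 := LinearMap.mkContinuous_norm_le _ zero_le_one _
  -- The limit in `n` of the estimate for the exponentials. It is uniform enough in `t` to identify
  -- the derivative at `0`: dividing by `t` leaves `2 ‖y - z‖ + t ‖z'‖`, and `z` can be chosen close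
  -- to `y`.
  have hest {x y z z' : H} (h : (x, y) ∈ A.graph) (hz : (z, z') ∈ A.graph) (t : ℝ≥0) :
      ‖T t x - x - (t : ℝ) • y‖ ≤ t * (2 * ‖y - z‖ + t * ‖z'‖) := by
    have h1 : Tendsto (fun n => ‖NormedSpace.exp ((t : ℝ) • B n) x - x - (t : ℝ) • y‖) atTop
      (𝓝 ‖T t x - x - (t : ℝ) • y‖) := (((hTU t x).sub_const x).sub_const _).norm
    have h2 : Tendsto (fun n => (t : ℝ) * (‖B n x - y‖ + 2 * ‖y - z‖ + t * ‖z'‖)) atTop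
        (𝓝 (t * (0 + 2 * ‖y - z‖ + t * ‖z'‖))) := by
      have := tendsto_iff_norm_sub_tendsto_zero.1 (hBA h)
      exact ((this.add_const _).add_const _).const_mul _
    rw [zero_add] at h2
    refine le_of_tendsto_of_tendsto h1 h2 (Eventually.of_forall fun n => ?_)
    refine (norm_exp_smul_apply_sub_smul_le (hB n) t.coe_nonneg x y z).trans ?_
    have ht := t.coe_nonneg
    dsimp only
    gcongr
    exact hBle hz n
  have hsemi : IsContractionC0Semigroup T := by
    refine ⟨?_, fun s t => ?_, ?_, hT1⟩
    · ext x
      refine tendsto_nhds_unique (hTU 0 x) ?_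
      simp
    · ext x
      refine tendsto_nhds_unique (hTU (s + t) x) ?_
      have h1 : Tendsto (fun n => NormedSpace.exp ((s : ℝ) • B n)
          (NormedSpace.exp ((t : ℝ) • B n) x - T t x)) atTop (𝓝 0) := by
        refine squeeze_zero_norm (fun n => norm_apply_le_of_norm_le_one (hB n s s.coe_nonneg) _) ?_
        exact tendsto_iff_norm_sub_tendsto_zero.1 (hTU t x)
      have h2 := h1.add (hTU s (T t x))
      rw [zero_add] at h2
      refine h2.congr fun n => ?_
      let +nondep : NormedAlgebra ℚ (H →L[ℂ] H) := .restrictScalars ℚ ℝ _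
      rw [NNReal.coe_add, add_smul, NormedSpace.exp_add_of_commute
        (((Commute.refl (B n)).smul_left _).smul_right _)]
      simp
    · refine tendsto_apply_of_dense hT1 hd fun x hx => ?_
      obtain ⟨y, hy⟩ := LinearPMap.mem_domain_iff.1 hx
      rw [tendsto_iff_norm_sub_tendsto_zero]
      have h0 : Tendsto (fun t : ℝ≥0 => (t : ℝ) * ‖y‖) (𝓝 0) (𝓝 0) := by
        have : Continuous fun t : ℝ≥0 => (t : ℝ) * ‖y‖ := by fun_prop
        exact this.tendsto' 0 0 (by simp)
      refine squeeze_zero (fun _ => norm_nonneg _) (fun t => ?_) h0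
      refine le_of_tendsto ((hTU t x).sub_const x).norm (Eventually.of_forall fun n => ?_)
      refine (norm_exp_smul_apply_sub_le (hB n) t.coe_nonneg x).trans ?_
      exact mul_le_mul_of_nonneg_left (hBle hy n) t.coe_nonneg
  have hgen {x y : H} (h : (x, y) ∈ A.graph) :
      Tendsto (fun t : ℝ≥0 => (((t : ℝ) : ℂ))⁻¹ • (T t x - x)) (𝓝[>] 0) (𝓝 y) := by
    refine Metric.tendsto_nhds.2 fun ε hε => ?_
    obtain ⟨z, hz, hyz⟩ := hd.exists_dist_lt y (ε := ε / 4) (by positivity)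
    obtain ⟨z', hz'⟩ := LinearPMap.mem_domain_iff.1 hz
    have h0 : ∀ᶠ t : ℝ≥0 in 𝓝[>] 0, (t : ℝ) * ‖z'‖ < ε / 2 := by
      have : Continuous fun t : ℝ≥0 => (t : ℝ) * ‖z'‖ := by fun_prop
      exact ((this.tendsto' 0 0 (by simp)).mono_left nhdsWithin_le_nhds).eventually_lt_const
        (by positivity)
    filter_upwards [h0, self_mem_nhdsWithin] with t ht htpos
    have htp : (0 : ℝ) < t := NNReal.coe_pos.2 htpos
    have e : (((t : ℝ) : ℂ))⁻¹ • (T t x - x) - y = (t : ℝ)⁻¹ • (T t x - x - (t : ℝ) • y) := by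
      rw [smul_sub _ _ ((t : ℝ) • y), inv_smul_smul₀ htp.ne', ← Complex.ofReal_inv, Complex.coe_smul]
    rw [dist_eq_norm, e, norm_smul, norm_inv, Real.norm_of_nonneg htp.le, inv_mul_eq_div,
      div_lt_iff₀ htp, mul_comm]
    refine (hest h hz' t).trans_lt (mul_lt_mul_of_pos_left ?_ htp)
    rw [dist_eq_norm] at hyz
    linarith
  refine ⟨T, hsemi, fun x y => ⟨hgen, fun h => ?_⟩⟩
  -- The generator of `T` is dissipative and extends `A`, and `1 - A` is onto.
  obtain ⟨Q, hQ⟩ := exists_dissipativeResolvent hc hdis hadj one_pos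
  have h1 := hQ.mem_graph (x - y)
  simp only [Complex.ofReal_one, one_smul] at h1
  have h2 := (hgen h1).sub h
  have h3 : (inner ℂ (Q (x - y) - x) (Q (x - y) - (x - y) - y)).re ≤ 0 := by
    have h4 := (Complex.continuous_re.tendsto _).comp
      (tendsto_const_nhds (x := Q (x - y) - x).inner (𝕜 := ℂ) h2)
    refine le_of_tendsto h4 (Eventually.of_forall fun t => ?_)
    rw [Function.comp_apply, ← smul_sub, inner_smul_right, ← Complex.ofReal_inv,
      Complex.re_ofReal_mul]
    refine mul_nonpos_of_nonneg_of_nonpos (inv_nonneg.2 t.2) ?_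
    have := hsemi.re_inner_sub_nonpos t (Q (x - y) - x)
    rwa [_root_.map_sub (T t), sub_sub_sub_comm] at this
  have h5 : Q (x - y) = x := by
    have h6 := inner_self_eq_norm_mul_norm (𝕜 := ℂ) (Q (x - y) - x)
    rw [sub_sub, sub_add_cancel] at h3
    have h7 : ‖Q (x - y) - x‖ * ‖Q (x - y) - x‖ ≤ 0 := h6 ▸ h3
    exact sub_eq_zero.1 (norm_eq_zero.1 (by nlinarith [norm_nonneg (Q (x - y) - x)]))
  rw [h5, sub_sub_cancel] at h1
  exact h1

end LumerPhillips

/-! ### Locally absolutely continuous functions -/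

section Primitive

/-- `F` is locally absolutely continuous on `J` with derivative `f`. -/
def IsPrimitiveOn (J : Set ℝ) (F f : ℝ → ℂ) : Prop :=
  ∀ x ∈ J, ∀ y ∈ J, IntervalIntegrable f volume x y ∧ F y - F x = ∫ t in x..y, f t

variable {J : Set ℝ} {F G f g : ℝ → ℂ}

theorem IsPrimitiveOn.mono {K : Set ℝ} (h : IsPrimitiveOn J F f) (hK : K ⊆ J) :
    IsPrimitiveOn K F f := fun x hx y hy => h x (hK hx) y (hK hy)

theorem IsPrimitiveOn.add (hF : IsPrimitiveOn J F f) (hG : IsPrimitiveOn J G g) :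
    IsPrimitiveOn J (fun x => F x + G x) (fun x => f x + g x) := fun x hx y hy => by
  obtain ⟨h1, h2⟩ := hF x hx y hy
  obtain ⟨h3, h4⟩ := hG x hx y hy
  refine ⟨h1.add h3, ?_⟩
  rw [intervalIntegral.integral_add h1 h3, ← h2, ← h4]
  ring

theorem IsPrimitiveOn.const_mul (c : ℂ) (hF : IsPrimitiveOn J F f) :
    IsPrimitiveOn J (fun x => c * F x) (fun x => c * f x) := fun x hx y hy => by
  obtain ⟨h1, h2⟩ := hF x hx y hy
  refine ⟨h1.const_mul c, ?_⟩
  rw [intervalIntegral.integral_const_mul, ← h2]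
  ring

theorem IsPrimitiveOn.sub (hF : IsPrimitiveOn J F f) (hG : IsPrimitiveOn J G g) :
    IsPrimitiveOn J (fun x => F x - G x) (fun x => f x - g x) := by
  have := hF.add (hG.const_mul (-1))
  simpa [sub_eq_add_neg] using this

theorem isPrimitiveOn_const (J : Set ℝ) (c : ℂ) : IsPrimitiveOn J (fun _ => c) (fun _ => 0) :=
  fun _ _ _ _ => ⟨intervalIntegrable_const, by simp⟩

theorem IsPrimitiveOn.const_sub (c : ℂ) (hF : IsPrimitiveOn J F f) :
    IsPrimitiveOn J (fun x => c - F x) (fun x => -f x) := by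
  simpa using (isPrimitiveOn_const J c).sub hF

theorem IsPrimitiveOn.conj (hF : IsPrimitiveOn J F f) :
    IsPrimitiveOn J (fun x => (starRingEnd ℂ) (F x)) (fun x => (starRingEnd ℂ) (f x)) :=
  fun x hx y hy => by
  obtain ⟨h1, h2⟩ := hF x hx y hy
  have h3 : IntervalIntegrable (fun t => Complex.conjCLE (f t)) volume x y := by
    refine ⟨?_, ?_⟩
    · exact Complex.conjCLE.toContinuousLinearMap.integrable_comp h1.1
    · exact Complex.conjCLE.toContinuousLinearMap.integrable_comp h1.2
  refine ⟨h3, ?_⟩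
  rw [← _root_.map_sub, h2]
  exact (Complex.conjCLE.toContinuousLinearMap.intervalIntegral_comp_comm h1).symm

theorem IsPrimitiveOn.congr_deriv (hJ : J.OrdConnected) (hF : IsPrimitiveOn J F f)
    (h : ∀ᵐ x, x ∈ J → f x = g x) : IsPrimitiveOn J F g := fun x hx y hy => by
  obtain ⟨h1, h2⟩ := hF x hx y hy
  have h3 : ∀ᵐ t, t ∈ uIoc x y → f t = g t := by
    filter_upwards [h] with t ht htxy
    exact ht (hJ.uIcc_subset hx hy (uIoc_subset_uIcc htxy))
  refine ⟨h1.congr_ae ((ae_restrict_iff' measurableSet_uIoc).2 h3), ?_⟩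
  rw [h2, intervalIntegral.integral_congr_ae h3]

theorem isPrimitiveOn_of_hasDerivAt (J : Set ℝ) (h : ∀ x, HasDerivAt F (f x) x)
    (hf : Continuous f) : IsPrimitiveOn J F f := fun _ _ _ _ =>
  ⟨hf.intervalIntegrable _ _,
    (intervalIntegral.integral_eq_sub_of_hasDerivAt (fun t _ => h t)
      (hf.intervalIntegrable _ _)).symm⟩

theorem intervalIntegrable_of_locallyIntegrable (hf : LocallyIntegrable f volume) (x y : ℝ) :
    IntervalIntegrable f volume x y :=
  intervalIntegrable_iff.2 ((hf.integrableOn_isCompact isCompact_uIcc).mono_set uIoc_subset_uIcc)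

theorem isPrimitiveOn_integral (J : Set ℝ) (hf : LocallyIntegrable f volume) (c : ℝ) :
    IsPrimitiveOn J (fun x => ∫ t in c..x, f t) f := fun x _ y _ =>
  ⟨intervalIntegrable_of_locallyIntegrable hf x y,
    intervalIntegral.integral_interval_sub_left (intervalIntegrable_of_locallyIntegrable hf c y)
      (intervalIntegrable_of_locallyIntegrable hf c x)⟩

/-- Absolute continuity passes to any function with smaller increments; the comparison function will
be `∫ ‖f‖`. -/
theorem absolutelyContinuousOnInterval_of_dist_le {X Y : Type*} [PseudoMetricSpace X]
    [PseudoMetricSpace Y] {u : ℝ → X} {v : ℝ → Y} {a b : ℝ}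
    (hv : AbsolutelyContinuousOnInterval v a b)
    (h : ∀ x ∈ uIcc a b, ∀ y ∈ uIcc a b, dist (u x) (u y) ≤ dist (v x) (v y)) :
    AbsolutelyContinuousOnInterval u a b := by
  rw [absolutelyContinuousOnInterval_iff] at hv ⊢
  intro ε hε
  obtain ⟨δ, hδ, H⟩ := hv ε hε
  refine ⟨δ, hδ, fun E hE hEδ => (Finset.sum_le_sum fun i hi => ?_).trans_lt (H E hE hEδ)⟩
  obtain ⟨h1, h2⟩ := hE.1 i hi
  exact h _ h1 _ h2

theorem IsPrimitiveOn.absolutelyContinuousOnInterval (hJ : J.OrdConnected)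
    (hF : IsPrimitiveOn J F f) {a b : ℝ} (ha : a ∈ J) (hb : b ∈ J) :
    AbsolutelyContinuousOnInterval F a b := by
  have hsub := hJ.uIcc_subset ha hb
  have hn : IntervalIntegrable (fun t => ‖f t‖) volume a b := (hF a ha b hb).1.norm
  refine absolutelyContinuousOnInterval_of_dist_le
    (hn.absolutelyContinuousOnInterval_intervalIntegral (c := a) left_mem_uIcc) fun x hx y hy => ?_
  rw [dist_comm, dist_eq_norm, (hF x (hsub hx) y (hsub hy)).2, dist_comm, Real.dist_eq,
    intervalIntegral.integral_interval_sub_left (hF a ha y (hsub hy)).1.norm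
      (hF a ha x (hsub hx)).1.norm]
  exact intervalIntegral.norm_integral_le_abs_integral_norm

theorem IsPrimitiveOn.continuousOn (hJ : J.OrdConnected) (hF : IsPrimitiveOn J F f) {a b : ℝ}
    (ha : a ∈ J) (hb : b ∈ J) : ContinuousOn F (uIcc a b) :=
  (hF.absolutelyContinuousOnInterval hJ ha hb).continuousOn

theorem IsPrimitiveOn.ae_hasDerivAt (hJ : J.OrdConnected) (hF : IsPrimitiveOn J F f) {a b : ℝ}
    (ha : a ∈ J) (hb : b ∈ J) : ∀ᵐ x, x ∈ uIcc a b → HasDerivAt F (f x) x := by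
  have hsub := hJ.uIcc_subset ha hb
  have h₁ : ∀ᵐ x : ℝ, x ≠ a := by simp [ae_iff, measure_singleton]
  have h₂ : ∀ᵐ x : ℝ, x ≠ b := by simp [ae_iff, measure_singleton]
  filter_upwards [(hF a ha b hb).1.ae_hasDerivAt_integral, h₁, h₂] with x hx hxa hxb hxI
  have h := (hx hxI a left_mem_uIcc).const_add (F a)
  refine h.congr_of_eventuallyEq ?_
  have hnhds : uIcc a b ∈ 𝓝 x := by
    refine Icc_mem_nhds (lt_of_le_of_ne hxI.1 ?_) (lt_of_le_of_ne hxI.2 ?_)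
    · rcases min_choice a b with h | h <;> rw [h] <;> exact Ne.symm ‹_›
    · rcases max_choice a b with h | h <;> rw [h] <;> assumption
  filter_upwards [hnhds] with y hy
  rw [← (hF a ha y (hsub hy)).2]
  ring

/-- The derivatives are merely integrable, so the product rule holds only almost everywhere. The
difference of `F G` and the integral of the expected derivative is absolutely continuous with
derivative zero almost everywhere, hence constant. -/
theorem IsPrimitiveOn.mul (hJ : J.OrdConnected) (hF : IsPrimitiveOn J F f)
    (hG : IsPrimitiveOn J G g) :
    IsPrimitiveOn J (fun x => F x * G x) (fun x => f x * G x + F x * g x) := fun x hx y hy => by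
  have hi : IntervalIntegrable (fun x => f x * G x + F x * g x) volume x y :=
    ((hF x hx y hy).1.mul_continuousOn (hG.continuousOn hJ hx hy)).add
      ((hG x hx y hy).1.continuousOn_mul (hF.continuousOn hJ hx hy))
  refine ⟨hi, ?_⟩
  set Φ : ℝ → ℂ := fun z => ∫ t in x..z, (f t * G t + F t * g t) with hΦ
  have hΦp : IsPrimitiveOn (uIcc x y) Φ (fun t => f t * G t + F t * g t) := fun u hu v hv => by
    have hsubi (w z : ℝ) (hw : w ∈ uIcc x y) (hz : z ∈ uIcc x y) :
        IntervalIntegrable (fun x => f x * G x + F x * g x) volume w z :=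
      hi.mono_set (uIcc_subset_uIcc hw hz)
    exact ⟨hsubi u v hu hv, intervalIntegral.integral_interval_sub_left
      (hsubi x v left_mem_uIcc hv) (hsubi x u left_mem_uIcc hu)⟩
  have hac : AbsolutelyContinuousOnInterval (fun z => F z * G z - Φ z) x y :=
    ((hF.absolutelyContinuousOnInterval hJ hx hy).fun_smul
      (hG.absolutelyContinuousOnInterval hJ hx hy)).fun_sub
      (hΦp.absolutelyContinuousOnInterval ordConnected_uIcc left_mem_uIcc right_mem_uIcc)
  obtain ⟨C, hC⟩ := hac.const_of_ae_hasDerivAt_zero (by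
    filter_upwards [hF.ae_hasDerivAt hJ hx hy, hG.ae_hasDerivAt hJ hx hy,
      hΦp.ae_hasDerivAt ordConnected_uIcc left_mem_uIcc right_mem_uIcc] with z h1 h2 h3 hz
    exact (((h1 hz).mul (h2 hz)).sub (h3 hz)).congr_deriv (sub_self _))
  have h1 := hC x left_mem_uIcc
  have h2 := hC y right_mem_uIcc
  have h3 : Φ x = 0 := by simp [hΦ]
  simp only [h3, sub_zero] at h1
  rw [← h2] at h1
  have h4 : Φ y = F y * G y - F x * G x := by rw [h1]; ring
  exact h4.symm

/-- Where the derivative is continuous, a locally absolutely continuous function is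
differentiable. -/
theorem IsPrimitiveOn.hasDerivAt (hF : IsPrimitiveOn J F f) {U : Set ℝ} (hU : IsOpen U)
    (hUJ : U ⊆ J) (hf : ContinuousOn f U) {x : ℝ} (hx : x ∈ U) :
    HasDerivAt F (f x) x := by
  have h := intervalIntegral.integral_hasDerivAt_right (a := x) (b := x) (f := f)
    (hF x (hUJ hx) x (hUJ hx)).1 (hf.stronglyMeasurableAtFilter hU x hx)
    (hf.continuousAt (hU.mem_nhds hx))
  refine (h.const_add (F x)).congr_of_eventuallyEq ?_
  filter_upwards [hU.mem_nhds hx] with y hy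
  rw [← (hF x (hUJ hx) y (hUJ hy)).2]
  ring

theorem IsPrimitiveOn.continuous (hF : IsPrimitiveOn univ F f) : Continuous F := by
  refine continuous_iff_continuousAt.2 fun x => ?_
  refine (hF.continuousOn ordConnected_univ (a := x - 1) (b := x + 1) trivial trivial).continuousAt ?_
  rw [uIcc_of_le (by linarith)]
  exact Icc_mem_nhds (by linarith) (by linarith)

end Primitive

/-! ### Distributional derivatives on an interval -/

section Distribution

/-- `φ` is a real test function on `I`. -/
structure IsTest (I : Set ℝ) (φ : ℝ → ℝ) : Prop where
  smooth : ContDiff ℝ ∞ φ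
  hasCompactSupport : HasCompactSupport φ
  tsupport_subset : tsupport φ ⊆ I

variable {I : Set ℝ} {φ ψ : ℝ → ℝ}

theorem IsTest.deriv (h : IsTest I φ) : IsTest I (deriv φ) :=
  ⟨(contDiff_infty_iff_deriv.1 h.smooth).2, h.hasCompactSupport.deriv,
    (closure_mono support_deriv_subset).trans (by
      rw [isClosed_tsupport φ |>.closure_eq]; exact h.tsupport_subset)⟩

theorem IsTest.iteratedDeriv (h : IsTest I φ) (n : ℕ) : IsTest I (iteratedDeriv n φ) := by
  induction n with
  | zero => simpa using h
  | succ n ih => rw [iteratedDeriv_succ]; exact ih.deriv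

theorem IsTest.integrable_smul (h : IsTest I φ) {u : ℝ → ℂ} (hu : LocallyIntegrable u volume) :
    Integrable (fun x => φ x • u x) :=
  hu.integrable_smul_left_of_hasCompactSupport h.smooth.continuous h.hasCompactSupport

theorem IsTest.integrable (h : IsTest I φ) : Integrable φ :=
  h.smooth.continuous.integrable_of_hasCompactSupport h.hasCompactSupport

theorem IsTest.add_smul (hφ : IsTest I φ) (hψ : IsTest I ψ) (c : ℝ) :
    IsTest I (fun x => φ x + c * ψ x) := by
  have h2 : HasCompactSupport fun x => c * ψ x := hψ.hasCompactSupport.mul_left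
  refine ⟨hφ.smooth.add (contDiff_const.mul hψ.smooth), hφ.hasCompactSupport.add h2, ?_⟩
  refine (tsupport_add _ _).trans (union_subset hφ.tsupport_subset ?_)
  exact (tsupport_mul_subset_right (f := fun _ => c)).trans hψ.tsupport_subset

/-- The primitive from `-∞` vanishes to the left of the support, and to the right of it because the
total integral is zero. The interval spanned by the support stays inside `I` by order-connectedness.
-/
theorem IsTest.exists_deriv_eq (hI : I.OrdConnected) (hψ : IsTest I ψ) (h0 : ∫ x, ψ x = 0) :
    ∃ φ, IsTest I φ ∧ _root_.deriv φ = ψ := by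
  rcases (tsupport ψ).eq_empty_or_nonempty with hK | hK
  · refine ⟨0, ⟨contDiff_const, HasCompactSupport.zero, by simp⟩, ?_⟩
    rw [tsupport_eq_empty_iff.1 hK]
    ext; simp
  have hc : IsCompact (tsupport ψ) := hψ.hasCompactSupport
  have hm := hc.sInf_mem hK
  have hM := hc.sSup_mem hK
  have hz (x : ℝ) (hx : x < sInf (tsupport ψ)) : ψ x = 0 :=
    image_eq_zero_of_notMem_tsupport fun h => (csInf_le hc.bddBelow h).not_gt hx
  have hz' (x : ℝ) (hx : sSup (tsupport ψ) < x) : ψ x = 0 :=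
    image_eq_zero_of_notMem_tsupport fun h => (le_csSup hc.bddAbove h).not_gt hx
  set φ : ℝ → ℝ := fun x => ∫ t in Iic x, ψ t with hφ
  have hd (x : ℝ) : HasDerivAt φ (ψ x) x := by
    have h := intervalIntegral.integral_hasDerivAt_right (a := 0) (b := x)
      (hψ.smooth.continuous.intervalIntegrable _ _)
      (hψ.smooth.continuous.stronglyMeasurableAtFilter _ _) hψ.smooth.continuous.continuousAt
    refine (h.const_add (φ 0)).congr_of_eventuallyEq (Eventually.of_forall fun y => ?_)
    have := intervalIntegral.integral_Iic_sub_Iic (a := 0) (b := y) hψ.integrable.integrableOn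
      hψ.integrable.integrableOn
    simp only [hφ, ← this]
    ring
  have hderiv : _root_.deriv φ = ψ := funext fun x => (hd x).deriv
  have hsupp (x : ℝ) (hx : x ∉ Icc (sInf (tsupport ψ)) (sSup (tsupport ψ))) : φ x = 0 := by
    rcases lt_or_ge x (sInf (tsupport ψ)) with h | h
    · exact setIntegral_eq_zero_of_forall_eq_zero fun t ht => hz t (lt_of_le_of_lt ht h)
    · have h' : sSup (tsupport ψ) < x := lt_of_not_ge fun h2 => hx ⟨h, h2⟩
      have h1 := integral_add_compl (μ := volume) (measurableSet_Iic (a := x)) hψ.integrable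
      rw [h0, setIntegral_eq_zero_of_forall_eq_zero (t := (Iic x)ᶜ) fun t ht =>
        hz' t (h'.trans (not_le.1 ht)), add_zero] at h1
      exact h1
  refine ⟨φ, ⟨?_, ?_, ?_⟩, hderiv⟩
  · refine contDiff_infty_iff_deriv.2 ⟨fun x => (hd x).differentiableAt, ?_⟩
    rw [hderiv]; exact hψ.smooth
  · exact HasCompactSupport.intro isCompact_Icc hsupp
  · refine (closure_minimal ?_ isClosed_Icc).trans
      (hI.out (hψ.tsupport_subset hm) (hψ.tsupport_subset hM))
    intro x hx
    by_contra hcon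
    exact hx (hsupp x hcon)

theorem exists_isTest_integral_eq_one (hI : IsOpen I) (hne : I.Nonempty) :
    ∃ η, IsTest I η ∧ ∫ x, η x = 1 := by
  obtain ⟨c, hc⟩ := hne
  obtain ⟨r, hr, hball⟩ := Metric.isOpen_iff.1 hI c hc
  let χ : ContDiffBump c := ⟨r / 4, r / 2, by positivity, by linarith⟩
  refine ⟨χ.normed volume, ⟨χ.contDiff_normed, χ.hasCompactSupport_normed, ?_⟩,
    χ.integral_normed⟩
  rw [χ.tsupport_normed_eq]
  exact (Metric.closedBall_subset_ball (by change r / 2 < r; linarith)).trans hball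

/-- A distribution on an interval with vanishing derivative is constant. -/
theorem exists_eq_integral_smul_of_deriv (hI : IsOpen I) (hIc : I.OrdConnected) (hne : I.Nonempty)
    (D : (ℝ → ℝ) → ℂ)
    (hadd : ∀ φ ψ, IsTest I φ → IsTest I ψ → ∀ c : ℝ, D (fun x => φ x + c * ψ x) = D φ + c * D ψ)
    (hD : ∀ φ, IsTest I φ → D (_root_.deriv φ) = 0) :
    ∃ c : ℂ, ∀ φ, IsTest I φ → D φ = ∫ x, φ x • c := by
  obtain ⟨η, hη, hη1⟩ := exists_isTest_integral_eq_one hI hne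
  refine ⟨D η, fun ψ hψ => ?_⟩
  -- Subtracting `(∫ ψ) η` makes the mean zero, so the result is the derivative of a test function
  -- and `D` kills it.
  have ht := hψ.add_smul hη (-∫ x, ψ x)
  obtain ⟨φ, hφ, hφd⟩ := ht.exists_deriv_eq hIc (by
    rw [integral_add hψ.integrable (hη.integrable.const_mul _), integral_const_mul, hη1]
    ring)
  have h1 := hD φ hφ
  rw [hφd, hadd ψ η hψ hη] at h1
  rw [integral_smul_const]
  rw [Complex.real_smul]
  push_cast at h1
  linear_combination h1

theorem IsTest.integral_smul_eq_neg (hφ : IsTest I φ) {H h : ℝ → ℂ} (hH : IsPrimitiveOn univ H h)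
    (hh : LocallyIntegrable h volume) :
    ∫ x, φ x • h x = -∫ x, _root_.deriv φ x • H x := by
  have hHc : Continuous H := hH.continuous
  have hp : IsPrimitiveOn univ (fun x => (φ x : ℂ)) fun x => ((_root_.deriv φ x : ℝ) : ℂ) := by
    refine isPrimitiveOn_of_hasDerivAt _ (fun x => ?_)
      (Complex.continuous_ofReal.comp hφ.deriv.smooth.continuous)
    exact ((hφ.smooth.differentiable (by simp) x).hasDerivAt).ofReal_comp
  have hm := hp.mul ordConnected_univ hH
  obtain ⟨r, hr⟩ := hφ.hasCompactSupport.isCompact.isBounded.subset_ball_lt 0 0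
  have hz (x : ℝ) (hx : r ≤ |x|) : φ x = 0 := by
    refine image_eq_zero_of_notMem_tsupport fun h => ?_
    have := hr.2 h
    rw [Metric.mem_ball, Real.dist_eq, sub_zero] at this
    exact this.not_ge hx
  have hz' (x : ℝ) (hx : r ≤ |x|) : _root_.deriv φ x = 0 := by
    refine image_eq_zero_of_notMem_tsupport fun h => ?_
    have := hr.2 ((closure_mono support_deriv_subset).trans
      (isClosed_tsupport φ).closure_eq.subset h)
    rw [Metric.mem_ball, Real.dist_eq, sub_zero] at this
    exact this.not_ge hx
  have h1 := (hm (-r) trivial r trivial).2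
  have e (x : ℝ) : ((_root_.deriv φ x : ℝ) : ℂ) * H x + (φ x : ℂ) * h x =
      _root_.deriv φ x • H x + φ x • h x := by simp
  have h2 : ∫ x in (-r)..r, (((_root_.deriv φ x : ℝ) : ℂ) * H x + (φ x : ℂ) * h x) =
      ∫ x, (_root_.deriv φ x • H x + φ x • h x) := by
    simp only [e]
    refine intervalIntegral.integral_eq_integral_of_support_subset fun x hx => ?_
    by_contra hcon
    refine hx ?_
    have : r ≤ |x| := by
      by_contra! h
      rw [abs_lt] at h
      exact hcon ⟨h.1, h.2.le⟩
    simp [hz x this, hz' x this]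
  beta_reduce at h1
  rw [h2, hz r (le_abs_self r), hz (-r) (by rw [abs_neg]; exact le_abs_self r),
    integral_add (hφ.deriv.integrable_smul hHc.locallyIntegrable) (hφ.integrable_smul hh)] at h1
  have h3 : (0 : ℂ) = (∫ x, _root_.deriv φ x • H x) + ∫ x, φ x • h x := by simpa using h1
  linear_combination -h3

end Distribution

/-! ### Regularity of weak solutions -/

section Regularity

/-- `f 0, f 1, f 2, f 3` are successive derivatives on `J`, with `f 0, f 1, f 2` locally absolutely
continuous. -/
def IsJet (J : Set ℝ) (f : ℕ → ℝ → ℂ) : Prop :=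
  ∀ k < 3, IsPrimitiveOn J (f k) (f (k + 1))

/-- The Airy expression `a f''' + b f'`. -/
def airyJet (a b : ℝ) (f : ℕ → ℝ → ℂ) (x : ℝ) : ℂ := (a : ℂ) * f 3 x + (b : ℂ) * f 1 x

variable {I J : Set ℝ}

/-- Each integration removes one derivative from the test function at the price of a constant, until
`a u = c₂ - P` holds almost everywhere with `P` a primitive of a continuous function. The data live
on the whole line, so the jet is continuous across the endpoint of `I`; `J` is meant to be `I` with
its endpoint added. -/
theorem exists_isJet_of_weak (hI : IsOpen I) (hIc : I.OrdConnected) (hne : I.Nonempty)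
    (hJ : J.OrdConnected) (hIJ : ∀ᵐ x, x ∈ J → x ∈ I) {a b : ℝ} (ha : a ≠ 0) {u v : ℝ → ℂ}
    (hu : LocallyIntegrable u volume) (hv : LocallyIntegrable v volume)
    (h : ∀ φ, IsTest I φ →
      ∫ x, (a * iteratedDeriv 3 φ x + b * deriv φ x) • u x = ∫ x, φ x • v x) :
    ∃ f : ℕ → ℝ → ℂ, IsJet J f ∧ (∀ k < 3, Continuous (f k)) ∧ (∀ᵐ x, x ∈ I → u x = f 0 x) ∧
      ∀ x, airyJet a b f x = -v x := by
  have hlin {q : ℝ → ℂ} (hq : LocallyIntegrable q volume) {φ ψ : ℝ → ℝ} (hφ : IsTest I φ)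
      (hψ : IsTest I ψ) (c : ℝ) : ∫ x, (φ x + c * ψ x) • q x =
        (∫ x, φ x • q x) + c * ∫ x, ψ x • q x := by
    have e (x : ℝ) : (φ x + c * ψ x) • q x = φ x • q x + (c : ℂ) * (ψ x • q x) := by
      simp only [Complex.real_smul]; push_cast; ring
    simp only [e]
    rw [integral_add (hφ.integrable_smul hq) ((hψ.integrable_smul hq).const_mul _),
      integral_const_mul]
  have hdadd {φ ψ : ℝ → ℝ} (hφ : IsTest I φ) (hψ : IsTest I ψ) (c : ℝ) :
      deriv (fun x => φ x + c * ψ x) = fun x => deriv φ x + c * deriv ψ x := by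
    ext x
    have h1 := (hφ.smooth.differentiable (by simp) x).hasDerivAt
    have h2 := (hψ.smooth.differentiable (by simp) x).hasDerivAt
    exact (h1.add (h2.const_mul c)).deriv
  -- First integration.
  set V : ℝ → ℂ := fun x => ∫ t in (0 : ℝ)..x, v t with hV
  have hVp : IsPrimitiveOn univ V v := isPrimitiveOn_integral _ hv 0
  have hVc := hVp.continuous.locallyIntegrable (μ := volume)
  -- In the sense of distributions: `a u'' + b u + V = c`. The next two rounds give `-a u' + Q = c₁`
  -- and `a u + P = c₂`.
  obtain ⟨c, hc⟩ := exists_eq_integral_smul_of_deriv hI hIc hne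
    (fun φ => (a : ℂ) * (∫ x, deriv (deriv φ) x • u x) + (b : ℂ) * (∫ x, φ x • u x) +
      ∫ x, φ x • V x)
    (fun φ ψ hφ hψ r => by
      rw [hdadd hφ hψ, hdadd hφ.deriv hψ.deriv, hlin hu hφ.deriv.deriv hψ.deriv.deriv,
        hlin hu hφ hψ, hlin hVc hφ hψ]
      ring)
    (fun φ hφ => by
      have h1 := h φ hφ
      rw [hφ.integral_smul_eq_neg hVp hv] at h1
      have e (x : ℝ) : (a * iteratedDeriv 3 φ x + b * deriv φ x) • u x =
          (a : ℂ) * (iteratedDeriv 3 φ x • u x) + (b : ℂ) * (deriv φ x • u x) := by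
        simp only [Complex.real_smul]; push_cast; ring
      simp only [e] at h1
      rw [integral_add (((hφ.iteratedDeriv 3).integrable_smul hu).const_mul _)
        ((hφ.deriv.integrable_smul hu).const_mul _), integral_const_mul, integral_const_mul] at h1
      have e3 : iteratedDeriv 3 φ = deriv (deriv (deriv φ)) := by
        simp [iteratedDeriv_succ]
      rw [e3] at h1
      linear_combination h1)
  -- Second integration.
  set q : ℝ → ℂ := fun x => c - V x - b * u x with hq
  have hqi : LocallyIntegrable q volume :=
    (continuous_const.locallyIntegrable.sub hVc).sub (hu.smul (b : ℂ))
  set Q : ℝ → ℂ := fun x => ∫ t in (0 : ℝ)..x, q t with hQ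
  have hQp : IsPrimitiveOn univ Q q := isPrimitiveOn_integral _ hqi 0
  have hQc := hQp.continuous.locallyIntegrable (μ := volume)
  obtain ⟨c₁, hc₁⟩ := exists_eq_integral_smul_of_deriv hI hIc hne
    (fun φ => (a : ℂ) * (∫ x, deriv φ x • u x) + ∫ x, φ x • Q x)
    (fun φ ψ hφ hψ r => by
      rw [hdadd hφ hψ, hlin hu hφ.deriv hψ.deriv, hlin hQc hφ hψ]
      ring)
    (fun φ hφ => by
      have h1 := hc φ hφ
      have h2 := hφ.integral_smul_eq_neg hQp hqi
      have e (x : ℝ) : φ x • q x = φ x • c - φ x • V x - (b : ℂ) * (φ x • u x) := by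
        simp only [hq, Complex.real_smul]; ring
      simp only [e] at h2
      have i1 := hφ.integrable_smul (u := fun _ => c) continuous_const.locallyIntegrable
      have i2 := hφ.integrable_smul hVc
      have i3 : Integrable (fun x => φ x • c - φ x • V x) := i1.sub i2
      rw [integral_sub i3 ((hφ.integrable_smul hu).const_mul _), integral_sub i1 i2,
        integral_const_mul] at h2
      linear_combination h1 + h2)
  -- Third integration.
  set p : ℝ → ℂ := fun x => c₁ - Q x with hp
  have hpc : Continuous p := continuous_const.sub hQp.continuous
  set P : ℝ → ℂ := fun x => ∫ t in (0 : ℝ)..x, p t with hP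
  have hPp : IsPrimitiveOn univ P p := isPrimitiveOn_integral _ hpc.locallyIntegrable 0
  have hPc := hPp.continuous.locallyIntegrable (μ := volume)
  obtain ⟨c₂, hc₂⟩ := exists_eq_integral_smul_of_deriv hI hIc hne
    (fun φ => (a : ℂ) * (∫ x, φ x • u x) + ∫ x, φ x • P x)
    (fun φ ψ hφ hψ r => by
      rw [hlin hu hφ hψ, hlin hPc hφ hψ]
      ring)
    (fun φ hφ => by
      have h1 := hc₁ φ hφ
      have h2 := hφ.integral_smul_eq_neg hPp hpc.locallyIntegrable
      have e (x : ℝ) : φ x • p x = φ x • c₁ - φ x • Q x := by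
        simp only [hp, Complex.real_smul]; ring
      simp only [e] at h2
      have i1 := hφ.integrable_smul (u := fun _ => c₁) continuous_const.locallyIntegrable
      rw [integral_sub i1 (hφ.integrable_smul hQc)] at h2
      linear_combination h1 + h2)
  have haC : (a : ℂ) ≠ 0 := by exact_mod_cast ha
  have huP : ∀ᵐ x, x ∈ I → u x = (a : ℂ)⁻¹ * (c₂ - P x) := by
    have hloc : LocallyIntegrable (fun x => u x - (a : ℂ)⁻¹ * (c₂ - P x)) volume :=
      hu.sub (continuous_const.mul (continuous_const.sub hPp.continuous)).locallyIntegrable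
    have := IsOpen.ae_eq_zero_of_integral_contDiff_smul_eq_zero hI (hloc.locallyIntegrableOn I)
      (fun φ h1 h2 h3 => by
        have hφ : IsTest I φ := ⟨h1, h2, h3⟩
        have h4 := hc₂ φ hφ
        have e (x : ℝ) : φ x • (u x - (a : ℂ)⁻¹ * (c₂ - P x)) =
            φ x • u x - (a : ℂ)⁻¹ * (φ x • c₂ - φ x • P x) := by
          simp only [Complex.real_smul]; ring
        have i1 := hφ.integrable_smul (u := fun _ => c₂) continuous_const.locallyIntegrable
        have i2 := hφ.integrable_smul hPc
        have i3 : Integrable (fun x => φ x • c₂ - φ x • P x) := i1.sub i2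
        simp only [e]
        rw [integral_sub (hφ.integrable_smul hu) (i3.const_mul _), integral_const_mul,
          integral_sub i1 i2, ← h4]
        field_simp
        ring)
    filter_upwards [this] with x hx hxI
    exact sub_eq_zero.1 (hx hxI)
  -- The three integrated equations and the original one, solved for the derivatives of `u`. In `f2`
  -- the function `u` is replaced by `f0`, which makes `f2` continuous everywhere; it agrees with `q
  -- / a` only almost everywhere on `J`, so `f1` is its primitive on `J` alone.
  let f0 : ℝ → ℂ := fun x => (a : ℂ)⁻¹ * (c₂ - P x)
  let f1 : ℝ → ℂ := fun x => (a : ℂ)⁻¹ * (-p x)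
  let f2 : ℝ → ℂ := fun x => (a : ℂ)⁻¹ * (c - V x - b * f0 x)
  let f3 : ℝ → ℂ := fun x => (a : ℂ)⁻¹ * (-v x - b * f1 x)
  have hP0 : IsPrimitiveOn univ f0 f1 := (hPp.const_sub c₂).const_mul _
  have hP1 : IsPrimitiveOn J f1 f2 := by
    have h1 : IsPrimitiveOn J f1 (fun x => (a : ℂ)⁻¹ * q x) := by
      have h2 := ((hQp.const_sub c₁).const_mul (-(a : ℂ)⁻¹)).mono (subset_univ J)
      have e1 : f1 = fun x => -(a : ℂ)⁻¹ * (c₁ - Q x) := by ext x; simp only [f1, hp]; ring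
      have e2 : (fun x => (a : ℂ)⁻¹ * q x) = fun x => -(a : ℂ)⁻¹ * -q x := by ext x; ring
      rw [e1, e2]; exact h2
    refine h1.congr_deriv hJ ?_
    filter_upwards [huP, hIJ] with x hx1 hx2 hxJ
    simp only [hq, f2, f0, hx1 (hx2 hxJ)]
  have hP2 : IsPrimitiveOn univ f2 f3 :=
    ((hVp.const_sub c).sub (hP0.const_mul _)).const_mul _
  refine ⟨fun k => match k with | 0 => f0 | 1 => f1 | 2 => f2 | _ => f3, ?_, ?_, huP, ?_⟩
  · intro k hk
    interval_cases k
    · exact hP0.mono (subset_univ J)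
    · exact hP1
    · exact hP2.mono (subset_univ J)
  · intro k hk
    interval_cases k
    · exact hP0.continuous
    · exact continuous_const.mul hpc.neg
    · exact hP2.continuous
  · intro x
    simp only [airyJet, f3]
    field_simp
    ring

/-- Continuity of the next member turns absolute continuity into classical differentiability on `I`,
and continuity across `0` supplies the limits. -/
theorem IsJet.hasEndpointValues {f : ℕ → ℝ → ℂ} (hf : IsJet J f) (hfc : ∀ k < 3, Continuous (f k))
    (hI : IsOpen I) (hIJ : I ⊆ J) {u : ℝ → ℂ} (hu : u =ᵐ[volume.restrict I] f 0) :
    HasEndpointValues I u fun k => f k 0 := by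
  have hd (k : ℕ) (hk : k < 2) (x : ℝ) (hx : x ∈ I) : HasDerivAt (f k) (f (k + 1) x) x :=
    (hf k (by lia)).hasDerivAt hI hIJ (hfc (k + 1) (by lia)).continuousOn hx
  have hit (k : ℕ) (hk : k < 3) : ∀ x ∈ I, iteratedDeriv k (f 0) x = f k x := by
    induction k with
    | zero => intro x _; simp
    | succ k ih =>
      intro x hx
      rw [iteratedDeriv_succ]
      have : iteratedDeriv k (f 0) =ᶠ[𝓝 x] f k := by
        filter_upwards [hI.mem_nhds hx] with y hy using ih (by lia) y hy
      rw [this.deriv_eq, (hd k (by lia) x hx).deriv]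
  refine ⟨f 0, ?_, hu, fun k => ?_⟩
  · have e1 : EqOn (deriv (f 0)) (f 1) I := fun x hx => (hd 0 (by lia) x hx).deriv
    have e2 : EqOn (deriv (f 1)) (f 2) I := fun x hx => (hd 1 (by lia) x hx).deriv
    have h2 : ContDiffOn ℝ 0 (f 2) I := contDiffOn_zero.2 (hfc 2 (by lia)).continuousOn
    have h1 : ContDiffOn ℝ (0 + 1) (f 1) I := (contDiffOn_succ_iff_deriv_of_isOpen hI).2
      ⟨fun x hx => (hd 1 (by lia) x hx).differentiableAt.differentiableWithinAt, by simp,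
        h2.congr e2⟩
    have h0 : ContDiffOn ℝ (0 + 1 + 1) (f 0) I := (contDiffOn_succ_iff_deriv_of_isOpen hI).2
      ⟨fun x hx => (hd 0 (by lia) x hx).differentiableAt.differentiableWithinAt, by simp,
        h1.congr e1⟩
    have e : (2 : WithTop ℕ∞) = 0 + 1 + 1 := by norm_num
    rw [e]; exact h0
  · refine (((hfc k k.2).tendsto 0).mono_left nhdsWithin_le_nhds).congr' ?_
    filter_upwards [self_mem_nhdsWithin] with x hx
    exact (hit k k.2 x hx).symm

/-- Endpoint values are unique. -/
theorem HasEndpointValues.unique (hI : IsOpen I) [(𝓝[I] (0 : ℝ)).NeBot] {u : ℝ → ℂ}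
    {a b : Fin 3 → ℂ} (ha : HasEndpointValues I u a) (hb : HasEndpointValues I u b) : a = b := by
  obtain ⟨f, hf, huf, hfa⟩ := ha
  obtain ⟨g, hg, hug, hgb⟩ := hb
  have hfg : EqOn f g I := Measure.eqOn_open_of_ae_eq (huf.symm.trans hug) hI hf.continuousOn
    hg.continuousOn
  ext k
  refine tendsto_nhds_unique (hfa k) ((hgb k).congr' ?_)
  filter_upwards [self_mem_nhdsWithin] with x hx
  have : f =ᶠ[𝓝 x] g := hfg.eventuallyEq_of_mem (hI.mem_nhds hx)
  exact (this.iteratedDeriv_eq _).symm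

end Regularity

/-! ### Green's formula on bounded intervals -/

section Green

/-- The boundary form of Green's formula for the Airy expression. -/
def bdryForm (a b : ℝ) (f g : ℕ → ℝ → ℂ) (x : ℝ) : ℂ :=
  (a : ℂ) * (f 2 x * (starRingEnd ℂ) (g 0 x) - f 1 x * (starRingEnd ℂ) (g 1 x) +
    f 0 x * (starRingEnd ℂ) (g 2 x)) + (b : ℂ) * (f 0 x * (starRingEnd ℂ) (g 0 x))

/-- The alternating signs in `bdryForm` make the mixed terms `f'' ḡ'` and `f' ḡ''` cancel. -/
theorem IsJet.isPrimitiveOn_bdryForm {J : Set ℝ} (hJ : J.OrdConnected) {f g : ℕ → ℝ → ℂ}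
    (hf : IsJet J f) (hg : IsJet J g) (a b : ℝ) :
    IsPrimitiveOn J (bdryForm a b f g) fun x => airyJet a b f x * (starRingEnd ℂ) (g 0 x) +
      f 0 x * (starRingEnd ℂ) (airyJet a b g x) := by
  have h1 := (hf 2 (by lia)).mul hJ (hg 0 (by lia)).conj
  have h2 := (hf 1 (by lia)).mul hJ (hg 1 (by lia)).conj
  have h3 := (hf 0 (by lia)).mul hJ (hg 2 (by lia)).conj
  have h4 := (hf 0 (by lia)).mul hJ (hg 0 (by lia)).conj
  have h := (((h1.sub h2).add h3).const_mul a).add (h4.const_mul b)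
  convert h using 1
  all_goals
    ext x
    simp only [bdryForm, airyJet, map_add, map_mul, Complex.conj_ofReal] <;> ring

theorem isJet_iteratedDeriv (J : Set ℝ) {g : ℝ → ℂ} (hg : ContDiff ℝ ∞ g) :
    IsJet J fun k => iteratedDeriv k g := fun k _ => by
  refine isPrimitiveOn_of_hasDerivAt J (fun x => ?_) (hg.continuous_iteratedDeriv _ (by
    exact_mod_cast le_top))
  beta_reduce
  rw [iteratedDeriv_succ]
  exact ((hg.differentiable_iteratedDeriv k (by exact_mod_cast WithTop.coe_lt_top _)) x).hasDerivAt

theorem IsJet.comp_sub {J : Set ℝ} {f : ℕ → ℝ → ℂ} (hf : IsJet univ f) (t : ℝ) :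
    IsJet J fun k x => f k (x - t) := fun k hk x _ y _ => by
  obtain ⟨h1, h2⟩ := hf k hk (x - t) trivial (y - t) trivial
  refine ⟨?_, ?_⟩
  · simpa using h1.comp_sub_right t
  · rw [intervalIntegral.integral_comp_sub_right (fun x => f (k + 1) x)]; exact h2

end Green

/-! ### Cutoff functions with prescribed derivatives at the origin -/

section Cutoff

/-- A smooth cutoff function at the origin. -/
def cutoffBump : ContDiffBump (0 : ℝ) := ⟨1 / 4, 1 / 2, by norm_num, by norm_num⟩

/-- A compactly supported smooth function that equals `x ^ k / k!` near the origin. -/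
def cutoff (k : ℕ) (x : ℝ) : ℂ := ((x ^ k / (k.factorial : ℝ) * cutoffBump x : ℝ) : ℂ)

theorem contDiff_cutoff (k : ℕ) : ContDiff ℝ ∞ (cutoff k) :=
  Complex.ofRealCLM.contDiff.comp
    (((contDiff_id.pow k).div_const _).mul cutoffBump.contDiff)

theorem tsupport_cutoff_subset (k : ℕ) : tsupport (cutoff k) ⊆ Metric.closedBall 0 (1 / 2) := by
  refine closure_minimal (fun x hx => ?_) Metric.isClosed_closedBall
  by_contra hcon
  refine hx ?_
  have : cutoffBump x = 0 := cutoffBump.zero_of_le_dist (not_le.1 hcon).le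
  simp [cutoff, this]

theorem tsupport_iteratedDeriv_subset (g : ℝ → ℂ) (n : ℕ) :
    tsupport (iteratedDeriv n g) ⊆ tsupport g := by
  induction n with
  | zero => simp
  | succ n ih => rw [iteratedDeriv_succ]; exact tsupport_deriv_subset.trans ih

theorem iteratedDeriv_cutoff_eq_zero (k n : ℕ) {x : ℝ} (hx : 1 ≤ |x|) :
    iteratedDeriv n (cutoff k) x = 0 := by
  refine image_eq_zero_of_notMem_tsupport fun h => ?_
  have h2 := tsupport_cutoff_subset k (tsupport_iteratedDeriv_subset _ n h)
  rw [Metric.mem_closedBall, Real.dist_eq, sub_zero] at h2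
  linarith

theorem cutoff_eventuallyEq (k : ℕ) :
    cutoff k =ᶠ[𝓝 0] fun x => ((x ^ k / (k.factorial : ℝ) : ℝ) : ℂ) := by
  filter_upwards [cutoffBump.eventuallyEq_one] with x hx
  simp [cutoff, hx]

theorem iteratedDeriv_cutoff_zero {k n : ℕ} (hk : k < 3) (hn : n < 3) :
    iteratedDeriv n (cutoff k) 0 = if n = k then 1 else 0 := by
  rw [(cutoff_eventuallyEq k).iteratedDeriv_eq]
  have e : (fun x : ℝ => ((x ^ k / (k.factorial : ℝ) : ℝ) : ℂ)) =
      fun x : ℝ => ((k.factorial : ℂ))⁻¹ * (x : ℂ) ^ k := by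
    ext x; push_cast; ring
  have hd (m : ℕ) : deriv (fun x : ℝ => (x : ℂ) ^ m) = fun x : ℝ => (m : ℂ) * (x : ℂ) ^ (m - 1) := by
    ext x
    exact ((((hasDerivAt_id x).ofReal_comp).pow m).congr_deriv (by simp)).deriv
  have hd1 : deriv Complex.ofReal = fun _ => 1 := by
    ext x
    exact (((hasDerivAt_id x).ofReal_comp).congr_deriv (by simp)).deriv
  rw [e]
  interval_cases k <;> interval_cases n <;>
    simp [iteratedDeriv_succ, hd, hd1, Nat.factorial]

theorem exists_bound_iteratedDeriv_cutoff :
    ∃ M : ℝ, 0 ≤ M ∧ ∀ k < 3, ∀ n < 4, ∀ x, ‖iteratedDeriv n (cutoff k) x‖ ≤ M := by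
  have h (k n : ℕ) : ∃ M : ℝ, ∀ x, ‖iteratedDeriv n (cutoff k) x‖ ≤ M := by
    refine ((contDiff_cutoff k).continuous_iteratedDeriv n (by
      exact_mod_cast le_top)).bounded_above_of_compact_support ?_
    exact HasCompactSupport.intro isCompact_Icc (K := Icc (-1) 1) fun x hx =>
      iteratedDeriv_cutoff_eq_zero k n (by
        by_contra! hcon
        exact hx ⟨(abs_lt.1 hcon).1.le, (abs_lt.1 hcon).2.le⟩)
  choose M hM using h
  refine ⟨∑ k ∈ Finset.range 3, ∑ n ∈ Finset.range 4, |M k n|, by positivity,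
    fun k hk n hn x => ((hM k n x).trans (le_abs_self _)).trans ?_⟩
  refine (Finset.single_le_sum (f := fun n => |M k n|) (fun _ _ => abs_nonneg _)
    (Finset.mem_range.2 hn)).trans ?_
  exact Finset.single_le_sum (f := fun k => ∑ n ∈ Finset.range 4, |M k n|)
    (fun _ _ => by positivity) (Finset.mem_range.2 hk)

end Cutoff

/-! ### Pointwise bounds for solutions -/

section Trace

/-- Green's formula between `t` and `s` against a cutoff centred at `t`, which vanishes at `s`: the
boundary form at `t` is an integral involving only `f` and its Airy expression, never `f'` or `f''`.
The constant depends on `K` alone, so it will serve all edges at once. -/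
theorem exists_bdryForm_bound (K : ℝ) : ∃ C : ℝ, 0 ≤ C ∧ ∀ (a b : ℝ) (J : Set ℝ) (f : ℕ → ℝ → ℂ)
    (t s : ℝ), |a| ≤ K → |b| ≤ K → J.OrdConnected → IsJet J f → t ∈ J → s ∈ J → |s - t| = 1 →
    IntegrableOn (fun x => ‖f 0 x‖ ^ 2 + ‖airyJet a b f x‖ ^ 2) (uIoc t s) →
    ∀ k < 3, ‖bdryForm a b f (fun n x => iteratedDeriv n (cutoff k) (x - t)) t‖ ^ 2 ≤
      C * ∫ x in uIoc t s, (‖f 0 x‖ ^ 2 + ‖airyJet a b f x‖ ^ 2) := by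
  obtain ⟨M, hM0, hM⟩ := exists_bound_iteratedDeriv_cutoff
  refine ⟨2 * M ^ 2 + 8 * K ^ 2 * M ^ 2, by positivity, fun a b J f t s ha hb hJ hf ht hs hts he k
    hk => ?_⟩
  set g : ℕ → ℝ → ℂ := fun n x => iteratedDeriv n (cutoff k) (x - t) with hg
  set h : ℝ → ℂ := fun x => airyJet a b f x * (starRingEnd ℂ) (g 0 x) +
      f 0 x * (starRingEnd ℂ) (airyJet a b g x) with hh
  have hgj : IsJet J g := (isJet_iteratedDeriv univ (contDiff_cutoff k)).comp_sub t
  obtain ⟨h1, h2⟩ := hf.isPrimitiveOn_bdryForm hJ hgj a b t ht s hs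
  have h3 : bdryForm a b f g s = 0 := by
    have hgs (n : ℕ) : g n s = 0 := iteratedDeriv_cutoff_eq_zero k n hts.ge
    simp [bdryForm, hgs]
  rw [h3, zero_sub] at h2
  have hle := intervalIntegral.norm_integral_le_integral_norm_uIoc (f := h) (a := t) (b := s)
    (μ := volume)
  rw [← h2, norm_neg] at hle
  set m : ℝ := ∫ x in uIoc t s, ‖h x‖ with hm
  have hm0 : 0 ≤ m := integral_nonneg fun _ => norm_nonneg _
  refine (pow_le_pow_left₀ (norm_nonneg _) hle 2).trans ?_
  have hi : IntegrableOn h (uIoc t s) := intervalIntegrable_iff.1 h1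
  have hvol : volume.real (uIoc t s) = 1 := by
    rw [measureReal_def, uIoc, Real.volume_Ioc, max_sub_min_eq_abs, hts]; simp
  -- Integrating `2 m ‖h‖ ≤ ‖h‖² + m²` over an interval of length one, with `m = ∫ ‖h‖`, gives the
  -- Cauchy–Schwarz bound `m² ≤ ∫ ‖h‖²`. The constant comes from `(p + q)² ≤ 2 p² + 2 q²` with `p =
  -- M ‖airyJet a b f x‖` and `q = 2 K M ‖f 0 x‖`.
  have hpt (x : ℝ) : 2 * m * ‖h x‖ ≤ (2 * M ^ 2 + 8 * K ^ 2 * M ^ 2) *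
      (‖f 0 x‖ ^ 2 + ‖airyJet a b f x‖ ^ 2) + m ^ 2 := by
    have n1 : ‖airyJet a b g x‖ ≤ 2 * K * M := by
      refine (norm_add_le _ _).trans ?_
      rw [norm_mul, norm_mul, Complex.norm_real, Complex.norm_real, Real.norm_eq_abs,
        Real.norm_eq_abs]
      have := mul_le_mul ha (hM k hk 3 (by lia) (x - t)) (norm_nonneg _) ((abs_nonneg a).trans ha)
      have := mul_le_mul hb (hM k hk 1 (by lia) (x - t)) (norm_nonneg _) ((abs_nonneg a).trans ha)
      linarith
    have n2 : ‖h x‖ ≤ ‖airyJet a b f x‖ * M + ‖f 0 x‖ * (2 * K * M) := by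
      refine (norm_add_le _ _).trans ?_
      rw [norm_mul, norm_mul, RCLike.norm_conj, RCLike.norm_conj]
      gcongr
      exact hM k hk 0 (by lia) (x - t)
    have n3 : ‖h x‖ ^ 2 ≤ (‖airyJet a b f x‖ * M + ‖f 0 x‖ * (2 * K * M)) ^ 2 :=
      pow_le_pow_left₀ (norm_nonneg _) n2 2
    nlinarith [sq_nonneg (m - ‖h x‖), sq_nonneg (‖airyJet a b f x‖ * M - ‖f 0 x‖ * (2 * K * M)),
      sq_nonneg (M * ‖f 0 x‖), sq_nonneg (K * M * ‖airyJet a b f x‖)]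
  have hint := setIntegral_mono (μ := volume) (s := uIoc t s) (hi.norm.const_mul (2 * m))
    ((he.const_mul _).add (integrableOn_const (C := m ^ 2) (by simp [uIoc]))) hpt
  simp only [Pi.add_apply] at hint
  rw [integral_const_mul, ← hm, integral_add (he.const_mul _)
    (integrableOn_const (C := m ^ 2) (by simp [uIoc])), integral_const_mul, setIntegral_const,
    hvol, one_smul] at hint
  linarith

/-- The cutoffs of order `2`, `1`, `0` turn the boundary form at `t` into `a f`, `-a f'` and `a f''
+ b f`. This triangular system is solved with the bounds on `a⁻¹` and `b`. -/
theorem exists_trace_bound (K : ℝ) : ∃ C : ℝ, 0 ≤ C ∧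
    ∀ (a b : ℝ) (J : Set ℝ) (f : ℕ → ℝ → ℂ) (t s : ℝ), |a| ≤ K → a ≠ 0 → |a⁻¹| ≤ K → |b| ≤ K →
    J.OrdConnected → IsJet J f → t ∈ J → s ∈ J → |s - t| = 1 →
    IntegrableOn (fun x => ‖f 0 x‖ ^ 2 + ‖airyJet a b f x‖ ^ 2) (uIoc t s) →
    ∀ k < 3, ‖f k t‖ ^ 2 ≤ C * ∫ x in uIoc t s, (‖f 0 x‖ ^ 2 + ‖airyJet a b f x‖ ^ 2) := by
  obtain ⟨C, hC0, hC⟩ := exists_bdryForm_bound K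
  -- The first summand serves `f` and `f'`; the second serves `f''`, for which `b f` has to be
  -- subtracted.
  refine ⟨K ^ 2 * C + 2 * K ^ 2 * (C + K ^ 2 * (K ^ 2 * C)), by positivity,
    fun a b J f t s ha ha0 ha' hb hJ hf ht hs hts he k hk => ?_⟩
  have hB := hC a b J f t s ha hb hJ hf ht hs hts he
  set E := ∫ x in uIoc t s, (‖f 0 x‖ ^ 2 + ‖airyJet a b f x‖ ^ 2) with hE
  have hE0 : 0 ≤ E := integral_nonneg fun _ => by positivity
  have haC : (a : ℂ) ≠ 0 := by exact_mod_cast ha0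
  have hz (j n : ℕ) (hj : j < 3) (hn : n < 3) :
      iteratedDeriv n (cutoff j) (t - t) = if n = j then 1 else 0 := by
    rw [sub_self, iteratedDeriv_cutoff_zero hj hn]
  have e2 : bdryForm a b f (fun n x => iteratedDeriv n (cutoff 2) (x - t)) t = a * f 0 t := by
    simp only [bdryForm, hz 2 _ (by lia : 2 < 3) (by lia : 0 < 3), hz 2 _ (by lia : 2 < 3) (by lia : 1 < 3),
      hz 2 _ (by lia : 2 < 3) (by lia : 2 < 3)]
    simp
  have e1 : bdryForm a b f (fun n x => iteratedDeriv n (cutoff 1) (x - t)) t = -(a * f 1 t) := by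
    simp only [bdryForm, hz 1 _ (by lia : 1 < 3) (by lia : 0 < 3), hz 1 _ (by lia : 1 < 3) (by lia : 1 < 3),
      hz 1 _ (by lia : 1 < 3) (by lia : 2 < 3)]
    simp
  have e0 : bdryForm a b f (fun n x => iteratedDeriv n (cutoff 0) (x - t)) t =
      a * f 2 t + b * f 0 t := by
    simp only [bdryForm, hz 0 _ (by lia : 0 < 3) (by lia : 0 < 3), hz 0 _ (by lia : 0 < 3) (by lia : 1 < 3),
      hz 0 _ (by lia : 0 < 3) (by lia : 2 < 3)]
    simp
  have h2 := hB 2 (by lia)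
  have h1 := hB 1 (by lia)
  have h0 := hB 0 (by lia)
  rw [e2] at h2
  rw [e1, norm_neg] at h1
  rw [e0] at h0
  have hinv : ‖(a : ℂ)⁻¹‖ ^ 2 ≤ K ^ 2 := by
    rw [← Complex.ofReal_inv, Complex.norm_real, Real.norm_eq_abs]
    exact pow_le_pow_left₀ (abs_nonneg _) ha' 2
  have key (z : ℂ) (D : ℝ) (hz : ‖(a : ℂ) * z‖ ^ 2 ≤ D) : ‖z‖ ^ 2 ≤ K ^ 2 * D := by
    have : z = (a : ℂ)⁻¹ * (a * z) := by field_simp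
    rw [this, norm_mul, mul_pow]
    gcongr
  have f0 := key _ _ h2
  have f1 := key _ _ h1
  have hb2 : ‖(b : ℂ) * f 0 t‖ ^ 2 ≤ K ^ 2 * (K ^ 2 * (C * E)) := by
    rw [norm_mul, mul_pow, Complex.norm_real, Real.norm_eq_abs]
    gcongr
  have f2 := key (f 2 t) (2 * (C * E + K ^ 2 * (K ^ 2 * (C * E)))) (by
    have : (a : ℂ) * f 2 t = (a * f 2 t + b * f 0 t) - b * f 0 t := by ring
    rw [this]
    have n1 := norm_sub_le ((a : ℂ) * f 2 t + b * f 0 t) (b * f 0 t)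
    have n2 := pow_le_pow_left₀ (norm_nonneg _) n1 2
    nlinarith [sq_nonneg (‖(a : ℂ) * f 2 t + b * f 0 t‖ - ‖(b : ℂ) * f 0 t‖)])
  have p1 : 0 ≤ K ^ 2 * C * E := by positivity
  have p2 : 0 ≤ 2 * K ^ 2 * (C + K ^ 2 * (K ^ 2 * C)) * E := by positivity
  interval_cases k <;> linarith

end Trace

/-! ### Green's formula on a half-line -/

section Ray

/-- The open half-line with endpoint `0` in the direction `σ`. -/
def openRay (σ : ℝ) : Set ℝ := {x | 0 < σ * x}

/-- The closed half-line with endpoint `0` in the direction `σ`. -/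
def closedRay (σ : ℝ) : Set ℝ := {x | 0 ≤ σ * x}

theorem openRay_one : openRay 1 = Ioi 0 := by ext; simp [openRay]

theorem openRay_neg_one : openRay (-1) = Iio 0 := by ext; simp [openRay]

theorem isOpen_openRay (σ : ℝ) : IsOpen (openRay σ) :=
  isOpen_lt continuous_const (continuous_const.mul continuous_id)

theorem openRay_subset_closedRay (σ : ℝ) : openRay σ ⊆ closedRay σ :=
  fun x (h : 0 < σ * x) => (h.le : 0 ≤ σ * x)

theorem ordConnected_closedRay (σ : ℝ) : (closedRay σ).OrdConnected := by
  have : Convex ℝ (closedRay σ) := by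
    have := (convex_Ici (𝕜 := ℝ) (0 : ℝ)).linear_preimage (LinearMap.mulLeft ℝ σ)
    exact this
  exact this.ordConnected

theorem ordConnected_openRay (σ : ℝ) : (openRay σ).OrdConnected := by
  have : Convex ℝ (openRay σ) := by
    have := (convex_Ioi (𝕜 := ℝ) (0 : ℝ)).linear_preimage (LinearMap.mulLeft ℝ σ)
    exact this
  exact this.ordConnected

variable {σ : ℝ}

theorem zero_mem_closedRay : (0 : ℝ) ∈ closedRay σ := by simp [closedRay]

theorem ray_sq (hσ : σ = 1 ∨ σ = -1) : σ * σ = 1 := by rcases hσ with rfl | rfl <;> norm_num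

theorem mul_mem_closedRay (hσ : σ = 1 ∨ σ = -1) {r : ℝ} (hr : 0 ≤ r) : σ * r ∈ closedRay σ := by
  change 0 ≤ σ * (σ * r)
  rw [← mul_assoc, ray_sq hσ, one_mul]
  exact hr

theorem openRay_nonempty (hσ : σ = 1 ∨ σ = -1) : (openRay σ).Nonempty :=
  ⟨σ, by change 0 < σ * σ; rw [ray_sq hσ]; exact one_pos⟩

theorem closedRay_ae (hσ : σ = 1 ∨ σ = -1) : ∀ᵐ x, x ∈ closedRay σ → x ∈ openRay σ := by
  have h₁ : ∀ᵐ x : ℝ, x ≠ 0 := by simp [ae_iff, measure_singleton]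
  filter_upwards [h₁] with x hx h
  refine lt_of_le_of_ne h (mul_ne_zero ?_ hx).symm
  rcases hσ with rfl | rfl <;> norm_num

theorem nhdsWithin_openRay_neBot (hσ : σ = 1 ∨ σ = -1) : (𝓝[openRay σ] (0 : ℝ)).NeBot := by
  rcases hσ with rfl | rfl
  · rw [openRay_one]; infer_instance
  · rw [openRay_neg_one]; infer_instance

theorem tendsto_integral_ray (hσ : σ = 1 ∨ σ = -1) {E : Type*} [NormedAddCommGroup E]
    [NormedSpace ℝ E] {q : ℝ → E} (hq : IntegrableOn q (openRay σ)) :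
    Tendsto (fun r => ∫ x in (0 : ℝ)..σ * r, q x) atTop (𝓝 (σ • ∫ x in openRay σ, q x)) := by
  rcases hσ with rfl | rfl
  · rw [openRay_one] at hq ⊢
    simpa using intervalIntegral_tendsto_integral_Ioi 0 hq tendsto_id
  · rw [openRay_neg_one] at hq ⊢
    rw [← integral_Iic_eq_integral_Iio]
    have := intervalIntegral_tendsto_integral_Iic (f := q) (μ := volume) 0
      ((integrableOn_Iic_iff_integrableOn_Iio (by simp)).2 hq) tendsto_neg_atTop_atBot
    simp only [neg_mul, one_mul, neg_smul, one_smul]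
    refine this.neg.congr fun r => ?_
    rw [intervalIntegral.integral_symm 0, neg_neg]

theorem uIoc_ray_subset (hσ : σ = 1 ∨ σ = -1) {r : ℝ} (hr : 0 ≤ r) :
    uIoc (σ * r) (σ * (r + 1)) ⊆ closedRay σ :=
  uIoc_subset_uIcc.trans ((ordConnected_closedRay σ).uIcc_subset (mul_mem_closedRay hσ hr)
    (mul_mem_closedRay hσ (by linarith)))

theorem closedRay_ae_eq (hσ : σ = 1 ∨ σ = -1) : openRay σ =ᵐ[volume] closedRay σ := by
  filter_upwards [closedRay_ae hσ] with x hx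
  exact propext ⟨fun h => openRay_subset_closedRay σ h, hx⟩

theorem tendsto_integral_uIoc_ray (hσ : σ = 1 ∨ σ = -1) {q : ℝ → ℝ} (hq : IntegrableOn q (openRay σ))
    (h0 : ∀ x, 0 ≤ q x) :
    Tendsto (fun r => ∫ x in uIoc (σ * r) (σ * (r + 1)), q x) atTop (𝓝 0) := by
  have h1 := tendsto_integral_ray hσ hq
  have h2 := ((h1.comp (tendsto_atTop_add_const_right atTop 1 tendsto_id)).sub h1).abs
  rw [sub_self, abs_zero] at h2
  have hqc : IntegrableOn q (closedRay σ) := (integrableOn_congr_set_ae (closedRay_ae_eq hσ)).1 hq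
  refine h2.congr' ?_
  filter_upwards [eventually_ge_atTop 0] with r hr
  have hint (s : ℝ) (hs : 0 ≤ s) : IntervalIntegrable q volume 0 (σ * s) :=
    intervalIntegrable_iff.2 (hqc.mono_set (uIoc_subset_uIcc.trans
      ((ordConnected_closedRay σ).uIcc_subset zero_mem_closedRay (mul_mem_closedRay hσ hs))))
  simp only [Function.comp_apply, id]
  rw [intervalIntegral.integral_interval_sub_left (hint _ (by linarith)) (hint r hr),
    intervalIntegral.abs_integral_eq_abs_integral_uIoc, abs_of_nonneg]
  exact integral_nonneg h0

/-- `f` is a solution on the half-line with square integrable data. -/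
structure IsRaySol (a b σ : ℝ) (f : ℕ → ℝ → ℂ) : Prop where
  isJet : IsJet (closedRay σ) f
  memLp : MemLp (f 0) 2 (volume.restrict (openRay σ))
  memLp_airy : MemLp (airyJet a b f) 2 (volume.restrict (openRay σ))

variable {a b : ℝ} {f g : ℕ → ℝ → ℂ}

theorem IsRaySol.integrableOn (hf : IsRaySol a b σ f) :
    IntegrableOn (fun x => ‖f 0 x‖ ^ 2 + ‖airyJet a b f x‖ ^ 2) (openRay σ) :=
  (hf.memLp.integrable_norm_pow (by norm_num)).add (hf.memLp_airy.integrable_norm_pow (by norm_num))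

theorem exists_ray_trace_bound (K : ℝ) : ∃ C : ℝ, 0 ≤ C ∧
    ∀ (a b σ : ℝ) (f : ℕ → ℝ → ℂ) (r : ℝ), (σ = 1 ∨ σ = -1) → |a| ≤ K → a ≠ 0 → |a⁻¹| ≤ K →
    |b| ≤ K → IsRaySol a b σ f → 0 ≤ r → ∀ k < 3, ‖f k (σ * r)‖ ^ 2 ≤
      C * ∫ x in uIoc (σ * r) (σ * (r + 1)), (‖f 0 x‖ ^ 2 + ‖airyJet a b f x‖ ^ 2) := by
  obtain ⟨C, hC0, hC⟩ := exists_trace_bound K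
  refine ⟨C, hC0, fun a b σ f r hσ ha ha0 ha' hb hf hr => ?_⟩
  refine hC a b (closedRay σ) f (σ * r) (σ * (r + 1)) ha ha0 ha' hb (ordConnected_closedRay σ)
    hf.isJet (mul_mem_closedRay hσ hr) (mul_mem_closedRay hσ (by linarith)) ?_ ?_
  · rw [← mul_sub, add_sub_cancel_left, mul_one]
    rcases hσ with rfl | rfl <;> norm_num
  · exact ((integrableOn_congr_set_ae (closedRay_ae_eq hσ)).1 hf.integrableOn).mono_set
      (uIoc_ray_subset hσ hr)

theorem exists_endpoint_bound (K : ℝ) : ∃ C : ℝ, 0 ≤ C ∧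
    ∀ (a b σ : ℝ) (f : ℕ → ℝ → ℂ), (σ = 1 ∨ σ = -1) → |a| ≤ K → a ≠ 0 → |a⁻¹| ≤ K →
    |b| ≤ K → IsRaySol a b σ f → ∀ k < 3, ‖f k 0‖ ^ 2 ≤
      C * ∫ x in openRay σ, (‖f 0 x‖ ^ 2 + ‖airyJet a b f x‖ ^ 2) := by
  obtain ⟨C, hC0, hC⟩ := exists_ray_trace_bound K
  refine ⟨C, hC0, fun a b σ f hσ ha ha0 ha' hb hf k hk => ?_⟩
  have h := hC a b σ f 0 hσ ha ha0 ha' hb hf le_rfl k hk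
  rw [mul_zero] at h
  refine h.trans (mul_le_mul_of_nonneg_left ?_ hC0)
  rw [setIntegral_congr_set (closedRay_ae_eq hσ)]
  refine setIntegral_mono_set ((integrableOn_congr_set_ae (closedRay_ae_eq hσ)).1 hf.integrableOn)
    (Eventually.of_forall fun x => by positivity) ?_
  have := uIoc_ray_subset hσ le_rfl
  rw [mul_zero] at this
  exact this.eventuallyLE

/-- The trace bound at distance `r` involves only the `L²` mass between distances `r` and `r + 1`,
which tends to zero. -/
theorem IsRaySol.tendsto_zero (hσ : σ = 1 ∨ σ = -1) (ha : a ≠ 0) (hf : IsRaySol a b σ f) {k : ℕ}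
    (hk : k < 3) : Tendsto (fun r => f k (σ * r)) atTop (𝓝 0) := by
  obtain ⟨C, hC0, hC⟩ := exists_ray_trace_bound (|a| + |a⁻¹| + |b|)
  have h1 := (tendsto_integral_uIoc_ray hσ hf.integrableOn fun x => by positivity).const_mul C
  rw [mul_zero] at h1
  have h2 : Tendsto (fun r => ‖f k (σ * r)‖ ^ 2) atTop (𝓝 0) := by
    refine squeeze_zero' (Eventually.of_forall fun _ => by positivity) ?_ h1
    filter_upwards [eventually_ge_atTop 0] with r hr
    have := abs_nonneg a
    have := abs_nonneg a⁻¹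
    have := abs_nonneg b
    exact hC a b σ f r hσ (by linarith) ha (by linarith) (by linarith) hf hr k hk
  have h3 := h2.sqrt
  simp only [Real.sqrt_zero, Real.sqrt_sq (norm_nonneg _)] at h3
  exact tendsto_zero_iff_norm_tendsto_zero.2 h3

/-- The boundary form vanishes at infinity, leaving the term at `0`. The factor `-σ` records the
orientation: integrals from `0` to `σ r` tend to `σ` times the integral over the ray. -/
theorem IsRaySol.green (hσ : σ = 1 ∨ σ = -1) (ha : a ≠ 0) (hf : IsRaySol a b σ f)
    (hg : IsRaySol a b σ g) :
    (∫ x in openRay σ, airyJet a b f x * (starRingEnd ℂ) (g 0 x)) +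
      ∫ x in openRay σ, f 0 x * (starRingEnd ℂ) (airyJet a b g x) = -σ * bdryForm a b f g 0 := by
  have i1 : IntegrableOn (fun x => airyJet a b f x * (starRingEnd ℂ) (g 0 x)) (openRay σ) :=
    hf.memLp_airy.integrable_mul hg.memLp.star
  have i2 : IntegrableOn (fun x => f 0 x * (starRingEnd ℂ) (airyJet a b g x)) (openRay σ) :=
    hf.memLp.integrable_mul hg.memLp_airy.star
  rw [← integral_add i1 i2]
  have h1 := tendsto_integral_ray hσ (i1.add i2)
  have hc {k : ℕ} (hk : k < 3) : Tendsto (fun r => (starRingEnd ℂ) (g k (σ * r))) atTop (𝓝 0) := by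
    have := (Complex.continuous_conj.tendsto _).comp (hg.tendsto_zero hσ ha hk)
    rwa [map_zero] at this
  have h2 : Tendsto (fun r => bdryForm a b f g (σ * r)) atTop (𝓝 0) := by
    have l1 := (hf.tendsto_zero hσ ha (k := 2) (by lia)).mul (hc (k := 0) (by lia))
    have l2 := (hf.tendsto_zero hσ ha (k := 1) (by lia)).mul (hc (k := 1) (by lia))
    have l3 := (hf.tendsto_zero hσ ha (k := 0) (by lia)).mul (hc (k := 2) (by lia))
    have l4 := (hf.tendsto_zero hσ ha (k := 0) (by lia)).mul (hc (k := 0) (by lia))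
    simpa [bdryForm] using (((l1.sub l2).add l3).const_mul (a : ℂ)).add (l4.const_mul (b : ℂ))
  have hp := hf.isJet.isPrimitiveOn_bdryForm (ordConnected_closedRay σ) hg.isJet a b
  have h3 := tendsto_nhds_unique (h1.congr' (by
    filter_upwards [eventually_ge_atTop 0] with r hr
    exact (hp 0 zero_mem_closedRay _ (mul_mem_closedRay hσ hr)).2.symm)) (h2.sub_const _)
  have h4 : ((σ * σ : ℝ) : ℂ) = 1 := by rw [ray_sq hσ]; simp
  push_cast at h4
  rw [Complex.real_smul] at h3
  simp only [Pi.add_apply] at h3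
  linear_combination (σ : ℂ) * h3 - (∫ x in openRay σ, (airyJet a b f x * (starRingEnd ℂ) (g 0 x) +
    f 0 x * (starRingEnd ℂ) (airyJet a b g x))) * h4

end Ray

/-! ### The maximal Airy operator -/

section Maximal

variable {Em Ep : Type*}

/-- The direction of the half-line carrying an edge. -/
def edgeSign : Em ⊕ Ep → ℝ := Sum.elim (fun _ => -1) fun _ => 1

theorem edgeSign_eq (e : Em ⊕ Ep) : edgeSign e = 1 ∨ edgeSign e = -1 := by
  cases e
  · exact Or.inr rfl
  · exact Or.inl rfl

theorem halfLine_eq (e : Em ⊕ Ep) : halfLine e = openRay (edgeSign e) := by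
  cases e
  · exact openRay_neg_one.symm
  · exact openRay_one.symm

/-- `f` is the jet of a representative of `u` on a half-line that solves `a f''' + b f' = w`. -/
structure IsEdgeSol (a b σ : ℝ) (u w : ℝ → ℂ) (f : ℕ → ℝ → ℂ) : Prop where
  isJet : IsJet (closedRay σ) f
  continuous : ∀ k < 3, Continuous (f k)
  ae_eq : u =ᵐ[volume.restrict (openRay σ)] f 0
  ae_eq_airy : w =ᵐ[volume.restrict (openRay σ)] airyJet a b f

theorem IsEdgeSol.isRaySol {a b σ : ℝ} {u w : ℝ → ℂ} {f : ℕ → ℝ → ℂ} (h : IsEdgeSol a b σ u w f)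
    (hu : MemLp u 2 (volume.restrict (openRay σ))) (hw : MemLp w 2 (volume.restrict (openRay σ))) :
    IsRaySol a b σ f := ⟨h.isJet, hu.ae_eq h.ae_eq, hw.ae_eq h.ae_eq_airy⟩

variable (cm : EdgeCoeffs Em) (cp : EdgeCoeffs Ep)

theorem edgeCoeff_pos (e : Em ⊕ Ep) : 0 < Sum.elim cm.α cp.α e := by
  cases e
  · exact cm.α_pos _
  · exact cp.α_pos _

theorem memLp_edge (u : L2Graph Em Ep) (e : Em ⊕ Ep) :
    MemLp (u e) 2 (volume.restrict (openRay (edgeSign e))) := by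
  have h : ∀ S, S = halfLine e → MemLp (u e) 2 (volume.restrict S) := by
    rintro _ rfl
    exact Lp.memLp _
  exact h _ (halfLine_eq e).symm

theorem airyExpr_eq_airyJet (e : Em ⊕ Ep) (φ : ℝ → ℂ) : airyExpr cm cp e φ =
    airyJet (Sum.elim cm.α cp.α e) (Sum.elim cm.β cp.β e) fun k => iteratedDeriv k φ := by
  ext x
  simp [airyExpr, airyJet, iteratedDeriv_one]

theorem continuous_airyExpr (e : Em ⊕ Ep) {φ : ℝ → ℂ} (hφ : ContDiff ℝ ∞ φ) :
    Continuous (airyExpr cm cp e φ) := by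
  have h (n : ℕ) : Continuous (iteratedDeriv n φ) :=
    hφ.continuous_iteratedDeriv n (by exact_mod_cast le_top)
  rw [airyExpr_eq_airyJet]
  exact (continuous_const.mul (h 3)).add (continuous_const.mul (h 1))

theorem hasCompactSupport_airyExpr (e : Em ⊕ Ep) {φ : ℝ → ℂ} (hφ : HasCompactSupport φ) :
    HasCompactSupport (airyExpr cm cp e φ) := by
  have h (n : ℕ) : HasCompactSupport (iteratedDeriv n φ) :=
    hφ.of_isClosed_subset (isClosed_tsupport _) (tsupport_iteratedDeriv_subset φ n)
  rw [airyExpr_eq_airyJet]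
  exact (h 3).mul_left.add (h 1).mul_left

/-- Test families carried by one edge suffice to localise duality arguments to that edge. -/
theorem exists_single_mem_A₀Graph [DecidableEq (Em ⊕ Ep)] (e : Em ⊕ Ep) {φ : ℝ → ℂ}
    (h1 : ContDiff ℝ ∞ φ) (h2 : HasCompactSupport φ) (h3 : tsupport φ ⊆ halfLine e) :
    ∃ x y : Lp ℂ 2 ((volume : Measure ℝ).restrict (halfLine e)),
      x =ᵐ[volume.restrict (halfLine e)] φ ∧
      y =ᵐ[volume.restrict (halfLine e)] airyExpr cm cp e φ ∧
      ((lp.single 2 e x : L2Graph Em Ep), (lp.single 2 e y : L2Graph Em Ep)) ∈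
        A₀Graph cm cp := by
  have m1 : MemLp φ 2 (volume.restrict (halfLine e)) :=
    (h1.continuous.memLp_of_hasCompactSupport h2)
  have m2 : MemLp (airyExpr cm cp e φ) 2 (volume.restrict (halfLine e)) :=
    ((continuous_airyExpr cm cp e h1).memLp_of_hasCompactSupport
      (hasCompactSupport_airyExpr cm cp e h2))
  refine ⟨m1.toLp, m2.toLp, m1.coeFn_toLp, m2.coeFn_toLp, fun e' => if e' = e then φ else 0,
    ⟨fun e' => ?_, fun e' => ?_, fun e' => ?_, ?_⟩, fun e' => ?_, fun e' => ?_⟩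
  · split_ifs
    exacts [h1, contDiff_const]
  · split_ifs
    exacts [h2, HasCompactSupport.zero]
  · split_ifs with h
    · subst h; exact h3
    · simp
  · refine (finite_singleton e).subset fun e' he' => ?_
    by_contra hne
    exact he' (if_neg hne)
  · rcases eq_or_ne e' e with rfl | hne
    · simp only [↓reduceIte, lp.single_apply_self]
      exact m1.coeFn_toLp
    · simp only [if_neg hne, lp.single_apply_ne _ _ _ hne]
      exact Lp.coeFn_zero ℂ 2 _
  · rcases eq_or_ne e' e with rfl | hne
    · simp only [↓reduceIte, lp.single_apply_self]
      exact m2.coeFn_toLp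
    · simp only [if_neg hne, lp.single_apply_ne _ _ _ hne]
      refine (Lp.coeFn_zero ℂ 2 _).trans (Eventually.of_forall fun x => ?_)
      simp [airyExpr]

theorem coeFn_neg_edge (w : L2Graph Em Ep) (e : Em ⊕ Ep) :
    ((-w : L2Graph Em Ep) e : ℝ → ℂ) =ᵐ[volume.restrict (halfLine e)] -(w e : ℝ → ℂ) :=
  Lp.coeFn_neg (w e)

theorem isTest_ofReal {I : Set ℝ} {φ : ℝ → ℝ} (hφ : IsTest I φ) :
    ContDiff ℝ ∞ (fun x => (φ x : ℂ)) ∧ HasCompactSupport (fun x => (φ x : ℂ)) ∧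
      tsupport (fun x => (φ x : ℂ)) ⊆ I := by
  refine ⟨Complex.ofRealCLM.contDiff.comp hφ.smooth,
    hφ.hasCompactSupport.comp_left (g := ((↑) : ℝ → ℂ)) Complex.ofReal_zero, ?_⟩
  refine (closure_mono fun x hx => ?_).trans hφ.tsupport_subset
  intro h
  exact hx (by simp [h])

theorem iteratedDeriv_ofReal {φ : ℝ → ℝ} (hφ : ContDiff ℝ ∞ φ) (n : ℕ) :
    iteratedDeriv n (fun x => (φ x : ℂ)) = fun x => ((iteratedDeriv n φ x : ℝ) : ℂ) := by
  induction n with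
  | zero => simp
  | succ n ih =>
    ext x
    rw [iteratedDeriv_succ, ih, iteratedDeriv_succ]
    exact ((hφ.differentiable_iteratedDeriv n (by exact_mod_cast WithTop.coe_lt_top _) x).hasDerivAt
      |>.ofReal_comp).deriv

theorem inner_Lp_eq {S : Set ℝ} (x y : Lp ℂ 2 ((volume : Measure ℝ).restrict S)) {f g : ℝ → ℂ}
    (hf : x =ᵐ[volume.restrict S] f) (hg : y =ᵐ[volume.restrict S] g) :
    inner ℂ x y = ∫ t in S, g t * (starRingEnd ℂ) (f t) := by
  rw [L2.inner_def]
  refine integral_congr_ae ?_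
  filter_upwards [hf, hg] with t h1 h2
  rw [h1, h2, RCLike.inner_apply]

theorem setIntegral_conj_smul {S T : Set ℝ} (hT : MeasurableSet T) (hST : S = T) (φ : ℝ → ℝ)
    (v : ℝ → ℂ) :
    (starRingEnd ℂ) (∫ t in S, (φ t : ℂ) * (starRingEnd ℂ) (v t)) = ∫ t, φ t • T.indicator v t := by
  subst hST
  rw [← integral_conj, ← integral_indicator hT]
  congr 1 with t
  by_cases ht : t ∈ S <;> simp [ht]

theorem locallyIntegrable_indicator {S : Set ℝ} (hS : MeasurableSet S) {v : ℝ → ℂ}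
    (hv : MemLp v 2 (volume.restrict S)) : LocallyIntegrable (S.indicator v) volume :=
  ((memLp_indicator_iff_restrict hS).2 hv).locallyIntegrable (by norm_num)

/-- A vector orthogonal to all test functions on single edges vanishes almost everywhere on each
edge. -/
theorem dense_A₀_domain : Dense ((A₀ cm cp).domain : Set (L2Graph Em Ep)) := by
  classical
  rw [Submodule.dense_iff_topologicalClosure_eq_top, Submodule.topologicalClosure_eq_top_iff,
    Submodule.eq_bot_iff]
  intro v hv
  ext e : 2
  refine Lp.ext ?_
  refine EventuallyEq.trans ?_ (Lp.coeFn_zero ℂ 2 (volume.restrict (halfLine e))).symm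
  have hS : MeasurableSet (halfLine e) := (isOpen_halfLine e).measurableSet
  have hloc := locallyIntegrable_indicator hS (Lp.memLp (v e))
  have h := IsOpen.ae_eq_zero_of_integral_contDiff_smul_eq_zero (isOpen_halfLine e)
    (hloc.locallyIntegrableOn _) (fun φ h1 h2 h3 => by
      obtain ⟨c1, c2, c3⟩ := isTest_ofReal (I := halfLine e) ⟨h1, h2, h3⟩
      obtain ⟨x, y, hx, -, hxy⟩ := exists_single_mem_A₀Graph cm cp e c1 c2 c3
      rw [← A₀_graph] at hxy
      have h0 := (Submodule.mem_orthogonal' _ _).1 hv _ (LinearPMap.mem_domain_of_mem_graph hxy)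
      rw [lp.inner_single_right, inner_Lp_eq _ _ EventuallyEq.rfl hx] at h0
      rw [← setIntegral_conj_smul hS rfl, h0, map_zero])
  refine (ae_restrict_iff' hS).2 ?_
  filter_upwards [h] with t ht hts
  simpa [hts] using ht hts

theorem isRaySol_of_test (e : Em ⊕ Ep) {φ : ℝ → ℂ} (h1 : ContDiff ℝ ∞ φ)
    (h2 : HasCompactSupport φ) :
    IsRaySol (Sum.elim cm.α cp.α e) (Sum.elim cm.β cp.β e) (edgeSign e)
      fun k => iteratedDeriv k φ := by
  refine ⟨isJet_iteratedDeriv _ h1, ?_, ?_⟩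
  · simp only [iteratedDeriv_zero]
    exact h1.continuous.memLp_of_hasCompactSupport h2
  · rw [← airyExpr_eq_airyJet]
    exact (continuous_airyExpr cm cp e h1).memLp_of_hasCompactSupport
      (hasCompactSupport_airyExpr cm cp e h2)

/-- Testing the adjoint relation on one edge gives the weak equation there, to which the regularity
theorem applies. Conversely, in Green's formula against a test family the boundary form vanishes,
and the edges are summed. -/
theorem mem_graph_neg_adjoint_iff (u w : L2Graph Em Ep) : (u, w) ∈ (-(A₀ cm cp)†).graph ↔
    ∀ e, ∃ f, IsEdgeSol (Sum.elim cm.α cp.α e) (Sum.elim cm.β cp.β e) (edgeSign e) (u e) (w e) f := by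
  classical
  have hd := dense_A₀_domain cm cp
  constructor
  · intro h e
    obtain ⟨y, hy1, hy2⟩ := (LinearPMap.mem_graph_iff _).1 h
    simp only at hy1 hy2
    set σ := edgeSign e
    have hσ := edgeSign_eq e
    have hS : MeasurableSet (openRay σ) := (isOpen_openRay σ).measurableSet
    have hadj := LinearPMap.adjoint_isFormalAdjoint hd
    obtain ⟨f, hf1, hf2, hf3, hf4⟩ := exists_isJet_of_weak (isOpen_openRay σ)
      (ordConnected_openRay σ) (openRay_nonempty hσ) (ordConnected_closedRay σ) (closedRay_ae hσ)
      (b := Sum.elim cm.β cp.β e) (edgeCoeff_pos cm cp e).ne'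
      (locallyIntegrable_indicator hS (memLp_edge u e))
      (locallyIntegrable_indicator hS (memLp_edge w e).neg) (fun φ hφ => by
        obtain ⟨c1, c2, c3⟩ := isTest_ofReal hφ
        rw [← halfLine_eq] at c3
        obtain ⟨x, x', hx, hx', hxy⟩ := exists_single_mem_A₀Graph cm cp e c1 c2 c3
        rw [← A₀_graph] at hxy
        obtain ⟨z, hz1, hz2⟩ := (LinearPMap.mem_graph_iff _).1 hxy
        simp only at hz1 hz2
        have h0 := hadj y z
        rw [hz1, hz2, hy1] at h0
        have hy3 : (A₀ cm cp)† y = -w := by rw [← hy2, LinearPMap.neg_apply, neg_neg]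
        rw [hy3, lp.inner_single_right, lp.inner_single_right,
          inner_Lp_eq _ _ (coeFn_neg_edge w e) hx,
          inner_Lp_eq _ _ EventuallyEq.rfl hx'] at h0
        -- The inner product conjugates `u` and `w`; since `φ` is real, conjugating the identity
        -- gives the unconjugated weak equation.
        have h4 := congrArg (starRingEnd ℂ) h0
        have e1 (t : ℝ) : airyExpr cm cp e (fun x => (φ x : ℂ)) t =
            ((Sum.elim cm.α cp.α e * iteratedDeriv 3 φ t + Sum.elim cm.β cp.β e * deriv φ t : ℝ) :
              ℂ) := by
          rw [airyExpr, iteratedDeriv_ofReal hφ.smooth, ← iteratedDeriv_one,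
            iteratedDeriv_ofReal hφ.smooth, iteratedDeriv_one]
          push_cast
          rfl
        simp only [e1] at h4
        rw [setIntegral_conj_smul hS (halfLine_eq e) φ (-(w e)), setIntegral_conj_smul hS (halfLine_eq e) (fun t =>
          Sum.elim cm.α cp.α e * iteratedDeriv 3 φ t + Sum.elim cm.β cp.β e * deriv φ t) (u e)] at h4
        exact h4.symm)
    refine ⟨f, hf1, hf2, (ae_restrict_iff' hS).2 ?_, (ae_restrict_iff' hS).2 ?_⟩
    · filter_upwards [hf3] with t ht hts
      rw [← ht hts, indicator_of_mem hts]
    · refine Eventually.of_forall fun t hts => ?_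
      rw [hf4 t, indicator_of_mem hts, Pi.neg_apply, neg_neg]
  · intro h
    choose f hf using h
    have key (x : (A₀ cm cp).domain) : inner ℂ (-w) (x : L2Graph Em Ep) =
        inner ℂ u (A₀ cm cp x) := by
      have hx : ((x : L2Graph Em Ep), A₀ cm cp x) ∈ A₀Graph cm cp := by
        rw [← A₀_graph]; exact LinearPMap.mem_graph _ x
      obtain ⟨φ, hφ, hφ1, hφ2⟩ := hx
      rw [lp.inner_eq_tsum, lp.inner_eq_tsum]
      refine tsum_congr fun e => ?_
      have hray := (hf e).isRaySol (memLp_edge u e) (memLp_edge w e)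
      have hg := (isRaySol_of_test cm cp e (hφ.smooth e) (hφ.hasCompactSupport e)).green
        (edgeSign_eq e) (edgeCoeff_pos cm cp e).ne' hray
      have hz (n : ℕ) : iteratedDeriv n (φ e) 0 = 0 := by
        refine image_eq_zero_of_notMem_tsupport fun h => ?_
        have := hφ.tsupport_subset e (tsupport_iteratedDeriv_subset _ n h)
        rw [halfLine_eq] at this
        have h2 : 0 < edgeSign e * 0 := this
        simp at h2
      have hb : bdryForm (Sum.elim cm.α cp.α e) (Sum.elim cm.β cp.β e)
          (fun k => iteratedDeriv k (φ e)) (f e) 0 = 0 := by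
        simp only [bdryForm, hz]; simp
      rw [hb, mul_zero, ← airyExpr_eq_airyJet] at hg
      have e1 : inner ℂ ((-w) e) ((x : L2Graph Em Ep) e) = -∫ t in openRay (edgeSign e),
          φ e t * (starRingEnd ℂ) (airyJet (Sum.elim cm.α cp.α e) (Sum.elim cm.β cp.β e) (f e) t) := by
        have h1 := (hf e).ae_eq_airy
        rw [← halfLine_eq] at h1 ⊢
        rw [lp.coeFn_neg, Pi.neg_apply, inner_neg_left, inner_Lp_eq _ _ h1 (hφ1 e)]
      have e2 : inner ℂ (u e) ((A₀ cm cp x) e) = ∫ t in openRay (edgeSign e),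
          airyExpr cm cp e (φ e) t * (starRingEnd ℂ) (f e 0 t) := by
        have h1 := (hf e).ae_eq
        rw [← halfLine_eq] at h1 ⊢
        rw [inner_Lp_eq _ _ h1 (hφ2 e)]
      rw [e1, e2]
      simp only [iteratedDeriv_zero] at hg
      linear_combination -hg
    have hmem : u ∈ (A₀ cm cp)†.domain := LinearPMap.mem_adjoint_domain_of_exists u ⟨-w, key⟩
    have happ : (A₀ cm cp)† ⟨u, hmem⟩ = -w := LinearPMap.adjoint_apply_eq hd ⟨u, hmem⟩ key
    refine (LinearPMap.mem_graph_iff _).2 ⟨⟨u, hmem⟩, rfl, ?_⟩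
    rw [LinearPMap.neg_apply]
    exact neg_eq_iff_eq_neg.2 happ

end Maximal

/-! ### Square-summable families -/

section Families

variable {E E' : Type*}

theorem hasSum_norm_sq {G : E → Type*} [∀ e, NormedAddCommGroup (G e)] (u : lp G 2) :
    HasSum (fun e => ‖u e‖ ^ 2) (‖u‖ ^ 2) := by
  simpa using lp.hasSum_norm (by simp) u

theorem exists_lp_of_norm_sq_le {G : E → Type*} [∀ e, NormedAddCommGroup (G e)] (v : ∀ e, G e)
    {q : E → ℝ} {a : ℝ} (hq : HasSum q a) (h : ∀ e, ‖v e‖ ^ 2 ≤ q e) :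
    ∃ V : lp G 2, (∀ e, V e = v e) ∧ ‖V‖ ^ 2 ≤ a := by
  have hv : Memℓp v 2 := memℓp_gen (by
    simpa using Summable.of_nonneg_of_le (fun e => sq_nonneg _) h hq.summable)
  exact ⟨⟨v, hv⟩, fun _ => rfl, hasSum_le h (hasSum_norm_sq (⟨v, hv⟩ : lp G 2)) hq⟩

theorem norm_sq_bdSpace (ξ : BdSpace E) : ‖ξ‖ ^ 2 = ∑ k, ‖ξ k‖ ^ 2 :=
  PiLp.norm_sq_eq_of_L2 _ ξ

theorem hasSum_bdSpace (ξ : BdSpace E) : HasSum (fun e => ∑ k, ‖ξ k e‖ ^ 2) (‖ξ‖ ^ 2) := by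
  rw [norm_sq_bdSpace]
  exact hasSum_sum fun k _ => hasSum_norm_sq (ξ k)

/-- The injection `i` places one kind of edge among all edges, so a sum over all of them serves as
majorant; the factor `3` counts the components. -/
theorem exists_bdSpace_of_norm_sq_le {i : E → E'} (hi : Function.Injective i)
    (v : Fin 3 → E → ℂ) {q : E' → ℝ} {a : ℝ} (hq0 : ∀ e, 0 ≤ q e) (hq : HasSum q a)
    (h : ∀ k e, ‖v k e‖ ^ 2 ≤ q (i e)) :
    ∃ ξ : BdSpace E, (∀ k e, ξ k e = v k e) ∧ ‖ξ‖ ^ 2 ≤ 3 * a := by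
  have hs : Summable fun e => q (i e) := hq.summable.comp_injective hi
  have hle : ∑' e, q (i e) ≤ a :=
    hasSum_le_inj i hi (fun e _ => hq0 e) (fun _ => le_rfl) hs.hasSum hq
  choose V hV hVa using fun k => exists_lp_of_norm_sq_le (v k) hs.hasSum (h k)
  refine ⟨WithLp.toLp 2 V, fun k e => hV k e, ?_⟩
  rw [norm_sq_bdSpace]
  calc ∑ k, ‖V k‖ ^ 2 ≤ ∑ _k : Fin 3, a := Finset.sum_le_sum fun k _ => (hVa k).trans hle
    _ = 3 * a := by simp

/-- Edge by edge, the Krein form is minus the boundary form at the vertex; this links the Gram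
operators to Green's formula. -/
theorem hasSum_kreinForm (c : EdgeCoeffs E) (ξ η : BdSpace E) :
    HasSum (fun e => -((c.α e : ℂ) * (ξ 2 e * (starRingEnd ℂ) (η 0 e) -
        ξ 1 e * (starRingEnd ℂ) (η 1 e) + ξ 0 e * (starRingEnd ℂ) (η 2 e)) +
        (c.β e : ℂ) * (ξ 0 e * (starRingEnd ℂ) (η 0 e)))) (kreinForm c.gram ξ η) := by
  rw [kreinForm, PiLp.inner_apply]
  have h := hasSum_sum fun (k : Fin 3) (_ : k ∈ Finset.univ) =>
    lp.hasSum_inner (𝕜 := ℂ) (η k) (c.gram ξ k)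
  convert! h using 2 with e
  simp only [Fin.sum_univ_three, RCLike.inner_apply]
  have h0 : c.gram ξ 0 e = -((c.β e : ℂ) * ξ 0 e) - (c.α e : ℂ) * ξ 2 e := rfl
  have h1 : c.gram ξ 1 e = (c.α e : ℂ) * ξ 1 e := rfl
  have h2 : c.gram ξ 2 e = -((c.α e : ℂ) * ξ 0 e) := rfl
  rw [h0, h1, h2]
  ring

theorem norm_sq_Lp_eq {S : Set ℝ} (x : Lp ℂ 2 ((volume : Measure ℝ).restrict S)) {f : ℝ → ℂ}
    (hf : x =ᵐ[volume.restrict S] f) : ‖x‖ ^ 2 = ∫ t in S, ‖f t‖ ^ 2 := by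
  have h := inner_Lp_eq x x hf hf
  rw [inner_self_eq_norm_sq_to_K] at h
  simp only [Complex.mul_conj, Complex.normSq_eq_norm_sq] at h
  exact_mod_cast h.trans integral_ofReal

theorem exists_Lp_of_bound (S : Set ℝ) {f : ℝ → ℂ} (hf : Continuous f) {B : ℝ}
    (hB : ∀ x, ‖f x‖ ≤ B) (h0 : ∀ x, 1 ≤ |x| → f x = 0) :
    ∃ x : Lp ℂ 2 ((volume : Measure ℝ).restrict S), x =ᵐ[volume.restrict S] f ∧
      ‖x‖ ^ 2 ≤ 2 * B ^ 2 := by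
  have h0' : ∀ x, x ∉ Icc (-1 : ℝ) 1 → f x = 0 := fun x hx =>
    h0 x (le_of_not_ge fun h => hx (abs_le.1 h))
  have hc : HasCompactSupport f := HasCompactSupport.intro isCompact_Icc h0'
  have hm : MemLp f 2 (volume.restrict S) := hf.memLp_of_hasCompactSupport hc
  refine ⟨hm.toLp, hm.coeFn_toLp, ?_⟩
  have hi : Integrable fun t => ‖f t‖ ^ 2 :=
    (hf.norm.pow 2).integrable_of_hasCompactSupport
      (HasCompactSupport.intro (K := Icc (-1) 1) isCompact_Icc fun x hx => by simp [h0' x hx])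
  rw [norm_sq_Lp_eq _ hm.coeFn_toLp]
  calc ∫ t in S, ‖f t‖ ^ 2 ≤ ∫ t, ‖f t‖ ^ 2 :=
        setIntegral_le_integral hi (Eventually.of_forall fun t => sq_nonneg _)
    _ ≤ ∫ t, (Icc (-1 : ℝ) 1).indicator (fun _ => B ^ 2) t := by
        refine integral_mono hi ((integrable_indicator_iff measurableSet_Icc).2
          (integrableOn_const (by simp))) fun t => ?_
        by_cases ht : t ∈ Icc (-1 : ℝ) 1
        · simp only [ht, indicator_of_mem]
          exact pow_le_pow_left₀ (norm_nonneg _) (hB t) 2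
        · simp [ht, h0' t ht]
    _ = 2 * B ^ 2 := by
        rw [integral_indicator measurableSet_Icc, setIntegral_const]
        simp [Measure.real]
        norm_num

end Families

/-! ### Boundary values of the maximal operator -/

section Trace

variable {Em Ep : Type*}

theorem IsEdgeSol.add {a b σ : ℝ} {u w u' w' : ℝ → ℂ} {f g : ℕ → ℝ → ℂ}
    (hf : IsEdgeSol a b σ u w f) (hg : IsEdgeSol a b σ u' w' g) :
    IsEdgeSol a b σ (u + u') (w + w') (f + g) where
  isJet k hk := (hf.isJet k hk).add (hg.isJet k hk)
  continuous k hk := (hf.continuous k hk).add (hg.continuous k hk)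
  ae_eq := hf.ae_eq.add hg.ae_eq
  ae_eq_airy := by
    filter_upwards [hf.ae_eq_airy, hg.ae_eq_airy] with t h1 h2
    simp only [Pi.add_apply, h1, h2, airyJet]
    ring

theorem IsEdgeSol.neg {a b σ : ℝ} {u w : ℝ → ℂ} {f : ℕ → ℝ → ℂ}
    (hf : IsEdgeSol a b σ u w f) : IsEdgeSol a b σ (-u) (-w) (-f) where
  isJet k hk := by
    have h := (hf.isJet k hk).const_mul (-1)
    simp only [neg_one_mul] at h
    exact h
  continuous k hk := (hf.continuous k hk).neg
  ae_eq := hf.ae_eq.neg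
  ae_eq_airy := by
    filter_upwards [hf.ae_eq_airy] with t h1
    simp only [Pi.neg_apply, h1, airyJet]
    ring

theorem IsEdgeSol.congr {a b σ : ℝ} {u w u' w' : ℝ → ℂ} {f : ℕ → ℝ → ℂ}
    (hf : IsEdgeSol a b σ u w f) (hu : u' =ᵐ[volume.restrict (openRay σ)] u)
    (hw : w' =ᵐ[volume.restrict (openRay σ)] w) : IsEdgeSol a b σ u' w' f :=
  ⟨hf.isJet, hf.continuous, hu.trans hf.ae_eq, hw.trans hf.ae_eq_airy⟩

variable (cm : EdgeCoeffs Em) (cp : EdgeCoeffs Ep)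

/-- `w = -A₀^* u`, witnessed on the edges by the jets `f`, with boundary values `ξ` and `η`. -/
structure IsMaxSol (u w : L2Graph Em Ep) (ξ : BdSpace Em) (η : BdSpace Ep)
    (f : Em ⊕ Ep → ℕ → ℝ → ℂ) : Prop where
  edge : ∀ e, IsEdgeSol (Sum.elim cm.α cp.α e) (Sum.elim cm.β cp.β e) (edgeSign e) (u e) (w e) (f e)
  left : ∀ (k : Fin 3) e, ξ k e = f (Sum.inl e) k 0
  right : ∀ (k : Fin 3) e, η k e = f (Sum.inr e) k 0

/-- `w = -A₀^* u`, and `u` has the boundary values `ξ` and `η`. -/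
def MaxRel (u w : L2Graph Em Ep) (ξ : BdSpace Em) (η : BdSpace Ep) : Prop :=
  ∃ f, IsMaxSol cm cp u w ξ η f

variable {cm cp}

theorem MaxRel.add {u w u' w' : L2Graph Em Ep} {ξ ξ' : BdSpace Em} {η η' : BdSpace Ep}
    (h : MaxRel cm cp u w ξ η) (h' : MaxRel cm cp u' w' ξ' η') :
    MaxRel cm cp (u + u') (w + w') (ξ + ξ') (η + η') := by
  obtain ⟨f, hf⟩ := h
  obtain ⟨g, hg⟩ := h'
  refine ⟨f + g, fun e => ((hf.edge e).add (hg.edge e)).congr ?_ ?_, fun k e => ?_, fun k e => ?_⟩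
  · rw [← halfLine_eq]; exact Lp.coeFn_add (u e) (u' e)
  · rw [← halfLine_eq]; exact Lp.coeFn_add (w e) (w' e)
  · simp [hf.left, hg.left]
  · simp [hf.right, hg.right]

theorem MaxRel.neg {u w : L2Graph Em Ep} {ξ : BdSpace Em} {η : BdSpace Ep}
    (h : MaxRel cm cp u w ξ η) : MaxRel cm cp (-u) (-w) (-ξ) (-η) := by
  obtain ⟨f, hf⟩ := h
  refine ⟨-f, fun e => (hf.edge e).neg.congr ?_ ?_, fun k e => ?_, fun k e => ?_⟩
  · rw [← halfLine_eq]; exact Lp.coeFn_neg (u e)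
  · rw [← halfLine_eq]; exact Lp.coeFn_neg (w e)
  · simp [hf.left]
  · simp [hf.right]

theorem MaxRel.sub {u w u' w' : L2Graph Em Ep} {ξ ξ' : BdSpace Em} {η η' : BdSpace Ep}
    (h : MaxRel cm cp u w ξ η) (h' : MaxRel cm cp u' w' ξ' η') :
    MaxRel cm cp (u - u') (w - w') (ξ - ξ') (η - η') := by
  simpa only [sub_eq_add_neg] using h.add h'.neg

theorem norm_sq_edge {u : L2Graph Em Ep} {e : Em ⊕ Ep} {f : ℝ → ℂ}
    (hf : (u e : ℝ → ℂ) =ᵐ[volume.restrict (openRay (edgeSign e))] f) :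
    ‖u e‖ ^ 2 = ∫ t in openRay (edgeSign e), ‖f t‖ ^ 2 := by
  rw [← halfLine_eq] at hf ⊢
  exact norm_sq_Lp_eq _ hf

theorem inner_edge {u v : L2Graph Em Ep} {e : Em ⊕ Ep} {f g : ℝ → ℂ}
    (hf : (u e : ℝ → ℂ) =ᵐ[volume.restrict (openRay (edgeSign e))] f)
    (hg : (v e : ℝ → ℂ) =ᵐ[volume.restrict (openRay (edgeSign e))] g) :
    inner ℂ (u e) (v e) = ∫ t in openRay (edgeSign e), g t * (starRingEnd ℂ) (f t) := by
  rw [← halfLine_eq] at hf hg ⊢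
  exact inner_Lp_eq _ _ hf hg

variable (cm cp)

theorem exists_edgeCoeff_bound : ∃ K, ∀ e : Em ⊕ Ep, |Sum.elim cm.α cp.α e| ≤ K ∧
    |(Sum.elim cm.α cp.α e)⁻¹| ≤ K ∧ |Sum.elim cm.β cp.β e| ≤ K := by
  obtain ⟨a, ha⟩ := cm.α_abs_bdd
  obtain ⟨b, hb⟩ := cp.α_abs_bdd
  obtain ⟨a', ha'⟩ := cm.α_inv_bdd
  obtain ⟨b', hb'⟩ := cp.α_inv_bdd
  obtain ⟨a'', ha''⟩ := cm.β_bdd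
  obtain ⟨b'', hb''⟩ := cp.β_bdd
  refine ⟨max (max a b) (max (max a' b') (max a'' b'')), ?_⟩
  rintro (e | e)
  · have h := ha' e
    rw [one_div, ← abs_of_pos (inv_pos.2 (cm.α_pos e))] at h
    simp only [Sum.elim_inl, le_max_iff]
    exact ⟨.inl (.inl (ha e)), .inr (.inl (.inl h)), .inr (.inr (.inl (ha'' e)))⟩
  · have h := hb' e
    rw [one_div, ← abs_of_pos (inv_pos.2 (cp.α_pos e))] at h
    simp only [Sum.elim_inr, le_max_iff]
    exact ⟨.inl (.inr (hb e)), .inr (.inl (.inr h)), .inr (.inr (.inr (hb'' e)))⟩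

/-- The endpoint bound holds with one constant for all edges, because `α`, `1/α` and `β` are
bounded, so it can be summed. This is why boundary values lie in `ℓ²`. -/
theorem exists_boundaryValue_bound : ∃ C, 0 ≤ C ∧ ∀ (u w : L2Graph Em Ep) (f : Em ⊕ Ep → ℕ → ℝ → ℂ),
    (∀ e, IsEdgeSol (Sum.elim cm.α cp.α e) (Sum.elim cm.β cp.β e) (edgeSign e) (u e) (w e) (f e)) →
    ∃ ξ η, IsMaxSol cm cp u w ξ η f ∧ ‖ξ‖ ^ 2 ≤ C * (‖u‖ ^ 2 + ‖w‖ ^ 2) ∧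
      ‖η‖ ^ 2 ≤ C * (‖u‖ ^ 2 + ‖w‖ ^ 2) := by
  obtain ⟨K, hK⟩ := exists_edgeCoeff_bound cm cp
  obtain ⟨C, hC0, hC⟩ := exists_endpoint_bound K
  refine ⟨3 * C, by positivity, fun u w f hf => ?_⟩
  have hq : HasSum (fun e => C * (‖u e‖ ^ 2 + ‖w e‖ ^ 2)) (C * (‖u‖ ^ 2 + ‖w‖ ^ 2)) :=
    ((hasSum_norm_sq u).add (hasSum_norm_sq w)).mul_left C
  have hb (e : Em ⊕ Ep) (k : Fin 3) : ‖f e k 0‖ ^ 2 ≤ C * (‖u e‖ ^ 2 + ‖w e‖ ^ 2) := by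
    have hr := (hf e).isRaySol (memLp_edge u e) (memLp_edge w e)
    obtain ⟨h1, h2, h3⟩ := hK e
    refine (hC _ _ _ _ (edgeSign_eq e) h1 (edgeCoeff_pos cm cp e).ne' h2 h3 hr k k.2).trans_eq ?_
    rw [norm_sq_edge (hf e).ae_eq, norm_sq_edge (hf e).ae_eq_airy, integral_add]
    · exact hr.memLp.integrable_norm_pow (by norm_num)
    · exact hr.memLp_airy.integrable_norm_pow (by norm_num)
  obtain ⟨ξ, hξ, hξC⟩ := exists_bdSpace_of_norm_sq_le Sum.inl_injective
    (fun k e => f (Sum.inl e) k 0) (fun e => by positivity) hq fun k e => hb (Sum.inl e) k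
  obtain ⟨η, hη, hηC⟩ := exists_bdSpace_of_norm_sq_le Sum.inr_injective
    (fun k e => f (Sum.inr e) k 0) (fun e => by positivity) hq fun k e => hb (Sum.inr e) k
  exact ⟨ξ, η, ⟨hf, hξ, hη⟩, by rwa [mul_assoc], by rwa [mul_assoc]⟩

theorem mem_graph_neg_adjoint_iff_maxRel (u w : L2Graph Em Ep) :
    (u, w) ∈ (-(A₀ cm cp)†).graph ↔ ∃ ξ η, MaxRel cm cp u w ξ η := by
  rw [mem_graph_neg_adjoint_iff]
  constructor
  · intro h
    choose f hf using h
    obtain ⟨C, -, hC⟩ := exists_boundaryValue_bound cm cp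
    obtain ⟨ξ, η, h, -⟩ := hC u w f hf
    exact ⟨ξ, η, f, h⟩
  · rintro ⟨ξ, η, f, hf⟩ e
    exact ⟨f e, hf.edge e⟩

theorem exists_maxRel_bound : ∃ C, 0 ≤ C ∧ ∀ (u w : L2Graph Em Ep) ξ η, MaxRel cm cp u w ξ η →
    ‖ξ‖ ^ 2 ≤ C * (‖u‖ ^ 2 + ‖w‖ ^ 2) ∧ ‖η‖ ^ 2 ≤ C * (‖u‖ ^ 2 + ‖w‖ ^ 2) := by
  obtain ⟨C, hC0, hC⟩ := exists_boundaryValue_bound cm cp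
  refine ⟨C, hC0, ?_⟩
  rintro u w ξ η ⟨f, hf⟩
  obtain ⟨ξ', η', h, h1, h2⟩ := hC u w f hf.edge
  obtain rfl : ξ = ξ' := by
    ext k e
    rw [hf.left, h.left]
  obtain rfl : η = η' := by
    ext k e
    rw [hf.right, h.right]
  exact ⟨h1, h2⟩

variable {cm cp}

/-- Green's formula for the maximal operator. -/
theorem MaxRel.green {u w u' w' : L2Graph Em Ep} {ξ ξ' : BdSpace Em} {η η' : BdSpace Ep}
    (h : MaxRel cm cp u w ξ η) (h' : MaxRel cm cp u' w' ξ' η') :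
    inner ℂ u' w + inner ℂ w' u = kreinForm cp.gram η η' - kreinForm cm.gram ξ ξ' := by
  obtain ⟨f, hf⟩ := h
  obtain ⟨g, hg⟩ := h'
  have he (e : Em ⊕ Ep) : inner ℂ (u' e) (w e) + inner ℂ (w' e) (u e) =
      -edgeSign e * bdryForm (Sum.elim cm.α cp.α e) (Sum.elim cm.β cp.β e) (f e) (g e) 0 := by
    rw [inner_edge (hg.edge e).ae_eq (hf.edge e).ae_eq_airy,
      inner_edge (hg.edge e).ae_eq_airy (hf.edge e).ae_eq]
    exact IsRaySol.green (edgeSign_eq e) (edgeCoeff_pos cm cp e).ne'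
      ((hf.edge e).isRaySol (memLp_edge u e) (memLp_edge w e))
      ((hg.edge e).isRaySol (memLp_edge u' e) (memLp_edge w' e))
  have h1 := (lp.hasSum_inner (𝕜 := ℂ) u' w).add (lp.hasSum_inner (𝕜 := ℂ) w' u)
  simp only [he] at h1
  refine h1.unique ?_
  -- The sum splits over the two kinds of edges, whose opposite orientations give the two Krein
  -- forms opposite signs.
  rw [sub_eq_neg_add]
  refine HasSum.sum ?_ ?_
  · convert! (hasSum_kreinForm cm ξ ξ').neg using 2 with e
    simp [hf.left, hg.left, bdryForm, edgeSign]
  · convert! hasSum_kreinForm cp η η' using 2 with e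
    simp [hf.right, hg.right, bdryForm, edgeSign]

/-- The energy balance: Green's formula for `u` against itself. -/
theorem MaxRel.two_re_inner {u w : L2Graph Em Ep} {ξ : BdSpace Em} {η : BdSpace Ep}
    (h : MaxRel cm cp u w ξ η) : 2 * (inner ℂ u w).re =
      (kreinForm cp.gram η η).re - (kreinForm cm.gram ξ ξ).re := by
  have h1 := congrArg Complex.re (h.green h)
  rw [Complex.add_re, Complex.sub_re, ← inner_conj_symm w u, Complex.conj_re] at h1
  rw [← h1]; ring

end Trace

/-! ### Lifting of boundary values -/

section Lift

variable {Em Ep : Type*}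

/-- The jet of the function `∑ z k x^k / k!`, cut off away from `0`. -/
def liftJet (z : Fin 3 → ℂ) (n : ℕ) (x : ℝ) : ℂ :=
  z 0 * iteratedDeriv n (cutoff 0) x + z 1 * iteratedDeriv n (cutoff 1) x +
    z 2 * iteratedDeriv n (cutoff 2) x

theorem isJet_liftJet (J : Set ℝ) (z : Fin 3 → ℂ) : IsJet J (liftJet z) := fun k hk =>
  (((isJet_iteratedDeriv J (contDiff_cutoff 0) k hk).const_mul (z 0)).add
    ((isJet_iteratedDeriv J (contDiff_cutoff 1) k hk).const_mul (z 1))).add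
    ((isJet_iteratedDeriv J (contDiff_cutoff 2) k hk).const_mul (z 2))

theorem continuous_liftJet (z : Fin 3 → ℂ) (n : ℕ) : Continuous (liftJet z n) := by
  have h (k : ℕ) : Continuous (iteratedDeriv n (cutoff k)) :=
    (contDiff_cutoff k).continuous_iteratedDeriv n (by exact_mod_cast le_top)
  exact ((continuous_const.mul (h 0)).add (continuous_const.mul (h 1))).add
    (continuous_const.mul (h 2))

theorem liftJet_eq_zero (z : Fin 3 → ℂ) (n : ℕ) {x : ℝ} (hx : 1 ≤ |x|) : liftJet z n x = 0 := by
  simp [liftJet, iteratedDeriv_cutoff_eq_zero _ n hx]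

theorem liftJet_zero (z : Fin 3 → ℂ) (k : Fin 3) : liftJet z k 0 = z k := by
  have h (j : ℕ) (hj : j < 3) := iteratedDeriv_cutoff_zero hj k.2
  rw [liftJet, h 0 (by lia), h 1 (by lia), h 2 (by lia)]
  fin_cases k <;> simp

theorem exists_norm_liftJet_le : ∃ M, 0 ≤ M ∧ ∀ z, ∀ n < 4, ∀ x,
    ‖liftJet z n x‖ ≤ M * ∑ k, ‖z k‖ := by
  obtain ⟨M, hM0, hM⟩ := exists_bound_iteratedDeriv_cutoff
  refine ⟨M, hM0, fun z n hn x => ?_⟩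
  have h (k : ℕ) (hk : k < 3) (c : ℂ) : ‖c * iteratedDeriv n (cutoff k) x‖ ≤ M * ‖c‖ := by
    rw [norm_mul, mul_comm]
    exact mul_le_mul_of_nonneg_right (hM k hk n hn x) (norm_nonneg _)
  rw [Fin.sum_univ_three, mul_add, mul_add]
  exact norm_add₃_le.trans (add_le_add (add_le_add (h 0 (by lia) _) (h 1 (by lia) _))
    (h 2 (by lia) _))

theorem exists_isEdgeSol_lift (K : ℝ) : ∃ C, 0 ≤ C ∧ ∀ (a b : ℝ) (e : Em ⊕ Ep) (z : Fin 3 → ℂ),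
    |a| ≤ K → |b| ≤ K → ∃ x y : Lp ℂ 2 ((volume : Measure ℝ).restrict (halfLine e)),
      IsEdgeSol a b (edgeSign e) x y (liftJet z) ∧ ‖x‖ ^ 2 ≤ C * ∑ k, ‖z k‖ ^ 2 ∧
      ‖y‖ ^ 2 ≤ C * ∑ k, ‖z k‖ ^ 2 := by
  obtain ⟨M, hM0, hM⟩ := exists_norm_liftJet_le
  -- With `s = ∑ ‖z k‖`, the support has length at most `2`, the sup bounds are `M s` and `2 K M s`,
  -- and `s² ≤ 3 ∑ ‖z k‖²`.
  refine ⟨6 * M ^ 2 + 24 * K ^ 2 * M ^ 2, by positivity, fun a b e z ha hb => ?_⟩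
  have hK : 0 ≤ K := (abs_nonneg a).trans ha
  set s := ∑ k, ‖z k‖ with hs
  have hs0 : 0 ≤ s := Finset.sum_nonneg fun k _ => norm_nonneg _
  have hcs : s ^ 2 ≤ 3 * ∑ k, ‖z k‖ ^ 2 := by
    simpa using sq_sum_le_card_mul_sum_sq (s := Finset.univ) (f := fun k => ‖z k‖)
  have hA (x : ℝ) : ‖airyJet a b (liftJet z) x‖ ≤ 2 * K * (M * s) := by
    have h3 := hM z 3 (by lia) x
    have h1 := hM z 1 (by lia) x
    calc ‖airyJet a b (liftJet z) x‖ ≤ |a| * ‖liftJet z 3 x‖ + |b| * ‖liftJet z 1 x‖ := by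
          refine (norm_add_le _ _).trans_eq ?_
          simp
      _ ≤ K * (M * s) + K * (M * s) := by gcongr
      _ = 2 * K * (M * s) := by ring
  obtain ⟨x, hx, hxB⟩ := exists_Lp_of_bound (halfLine e) (continuous_liftJet z 0)
    (hM z 0 (by lia)) fun t ht => liftJet_eq_zero z 0 ht
  obtain ⟨y, hy, hyB⟩ := exists_Lp_of_bound (halfLine e) (f := airyJet a b (liftJet z))
    ((continuous_const.mul (continuous_liftJet z 3)).add
      (continuous_const.mul (continuous_liftJet z 1))) hA fun t ht => by
        simp [airyJet, liftJet_eq_zero z _ ht]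
  refine ⟨x, y, ⟨isJet_liftJet _ z, fun k _ => continuous_liftJet z k, ?_, ?_⟩, ?_, ?_⟩
  · rwa [← halfLine_eq]
  · rwa [← halfLine_eq]
  · have := mul_le_mul_of_nonneg_left hcs (sq_nonneg M)
    have h2 : 0 ≤ K ^ 2 * M ^ 2 * ∑ k, ‖z k‖ ^ 2 := by positivity
    linarith
  · have := mul_le_mul_of_nonneg_left hcs (sq_nonneg (K * M))
    have h2 : 0 ≤ M ^ 2 * ∑ k, ‖z k‖ ^ 2 := by positivity
    linarith

/-- The boundary map is onto, with norm control: on each edge take the cut-off Taylor polynomial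
with the prescribed jet. Its `L²` bounds are uniform over the edges and hence summable. -/
theorem exists_maxRel_lift (cm : EdgeCoeffs Em) (cp : EdgeCoeffs Ep) : ∃ C, 0 ≤ C ∧ ∀ ξ η,
    ∃ u w, MaxRel cm cp u w ξ η ∧ ‖u‖ ^ 2 ≤ C * (‖ξ‖ ^ 2 + ‖η‖ ^ 2) ∧
      ‖w‖ ^ 2 ≤ C * (‖ξ‖ ^ 2 + ‖η‖ ^ 2) := by
  obtain ⟨K, hK⟩ := exists_edgeCoeff_bound cm cp
  obtain ⟨C, hC0, hC⟩ := exists_isEdgeSol_lift (Em := Em) (Ep := Ep) K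
  refine ⟨C, hC0, fun ξ η => ?_⟩
  let z : Em ⊕ Ep → Fin 3 → ℂ := Sum.elim (fun e k => ξ k e) fun e k => η k e
  choose x y hxy hx hy using fun e => hC _ _ e (z e) (hK e).1 (hK e).2.2
  have hq : HasSum (fun e => C * ∑ k, ‖z e k‖ ^ 2) (C * (‖ξ‖ ^ 2 + ‖η‖ ^ 2)) :=
    (HasSum.sum (f := fun e => ∑ k, ‖z e k‖ ^ 2) (hasSum_bdSpace ξ) (hasSum_bdSpace η)).mul_left C
  obtain ⟨u, hu, huC⟩ := exists_lp_of_norm_sq_le x hq hx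
  obtain ⟨w, hw, hwC⟩ := exists_lp_of_norm_sq_le y hq hy
  refine ⟨u, w, ⟨fun e => liftJet (z e), fun e => ?_, fun k e => ?_, fun k e => ?_⟩, huC, hwC⟩
  · rw [hu, hw]
    exact hxy e
  · rw [liftJet_zero]; rfl
  · rw [liftJet_zero]; rfl

end Lift

/-! ### The Airy operator -/

section AiryOp

variable {Em Ep : Type*} (cm : EdgeCoeffs Em) (cp : EdgeCoeffs Ep)
  (L : BdSpace Em →ₗ.[ℂ] BdSpace Ep)

theorem hasEndpointValues_of_isEdgeSol {a b : ℝ} {u w : ℝ → ℂ} {f : ℕ → ℝ → ℂ} {e : Em ⊕ Ep}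
    (h : IsEdgeSol a b (edgeSign e) u w f) : HasEndpointValues (halfLine e) u fun k => f k 0 := by
  rw [halfLine_eq]
  exact h.isJet.hasEndpointValues h.continuous (isOpen_openRay _) (openRay_subset_closedRay _)
    h.ae_eq

theorem hasEndpointValues_halfLine_unique {e : Em ⊕ Ep} {u : ℝ → ℂ} {a b : Fin 3 → ℂ}
    (ha : HasEndpointValues (halfLine e) u a) (hb : HasEndpointValues (halfLine e) u b) :
    a = b := by
  rw [halfLine_eq] at ha hb
  have := nhdsWithin_openRay_neBot (edgeSign_eq e)
  exact HasEndpointValues.unique (isOpen_openRay _) ha hb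

variable {cm cp} in
theorem MaxRel.hasBoundaryValues {u w : L2Graph Em Ep} {ξ : BdSpace Em} {η : BdSpace Ep}
    (h : MaxRel cm cp u w ξ η) : HasBoundaryValues u ξ η := by
  obtain ⟨f, hf⟩ := h
  refine ⟨fun e => ?_, fun e => ?_⟩
  · simp only [hf.left]
    exact hasEndpointValues_of_isEdgeSol (hf.edge _)
  · simp only [hf.right]
    exact hasEndpointValues_of_isEdgeSol (hf.edge _)

theorem HasBoundaryValues.unique {u : L2Graph Em Ep} {ξ ξ' : BdSpace Em} {η η' : BdSpace Ep}
    (h : HasBoundaryValues u ξ η) (h' : HasBoundaryValues u ξ' η') : ξ = ξ' ∧ η = η' := by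
  constructor
  · ext k e
    exact congrFun (hasEndpointValues_halfLine_unique (h.1 e) (h'.1 e)) k
  · ext k e
    exact congrFun (hasEndpointValues_halfLine_unique (h.2 e) (h'.2 e)) k

theorem mem_graph_domRestrict {V W : Type*} [AddCommGroup V] [Module ℂ V] [AddCommGroup W]
    [Module ℂ W] (T : V →ₗ.[ℂ] W) (S : Submodule ℂ V) (u : V) (w : W) :
    (u, w) ∈ (T.domRestrict S).graph ↔ u ∈ S ∧ (u, w) ∈ T.graph := by
  simp only [LinearPMap.mem_graph_iff]
  constructor
  · rintro ⟨⟨y, hy⟩, rfl, h⟩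
    exact ⟨hy.1, ⟨y, hy.2⟩, rfl, h ▸ (LinearPMap.domRestrict_apply rfl).symm⟩
  · rintro ⟨hu, ⟨y, hy⟩, rfl, h⟩
    exact ⟨⟨y, hu, hy⟩, rfl, h ▸ LinearPMap.domRestrict_apply rfl⟩

/-- Boundary values are unique, so the transmission condition is a condition on the pair that
`MaxRel` supplies. -/
theorem mem_graph_airyOp_iff (u w : L2Graph Em Ep) :
    (u, w) ∈ (airyOp cm cp L).graph ↔ ∃ ξ η, (ξ, η) ∈ L.graph ∧ MaxRel cm cp u w ξ η := by
  rw [airyOp, mem_graph_domRestrict, mem_graph_neg_adjoint_iff_maxRel]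
  constructor
  · rintro ⟨⟨ζ, hζ⟩, ξ, η, h⟩
    obtain ⟨h1, h2⟩ := h.hasBoundaryValues.unique hζ
    subst h1 h2
    exact ⟨_, _, L.mem_graph ζ, h⟩
  · rintro ⟨ξ, η, hL, h⟩
    obtain ⟨ζ, h1, h2⟩ := (LinearPMap.mem_graph_iff _).1 hL
    simp only at h1 h2
    subst h1 h2
    exact ⟨⟨ζ, h.hasBoundaryValues⟩, _, _, h⟩

theorem isClosed_graph_neg_adjoint : IsClosed ((-(A₀ cm cp)†).graph : Set (L2Graph Em Ep × L2Graph Em Ep)) := by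
  have h : ((-(A₀ cm cp)†).graph : Set (L2Graph Em Ep × L2Graph Em Ep)) =
      (fun p => (p.1, -p.2)) ⁻¹' ((A₀ cm cp)†.graph : Set (L2Graph Em Ep × L2Graph Em Ep)) := by
    ext ⟨u, w⟩
    simp only [LinearPMap.neg_graph, Submodule.map_coe, mem_image, SetLike.mem_coe, mem_preimage]
    constructor
    · rintro ⟨⟨a, b⟩, hab, h⟩
      simp only [LinearMap.prodMap_apply, LinearMap.id_apply, LinearMap.neg_apply,
        Prod.mk.injEq] at h
      rw [← h.1, ← h.2, neg_neg]
      exact hab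
    · intro h
      exact ⟨_, h, by simp⟩
  rw [h]
  exact (LinearPMap.adjoint_isClosed (dense_A₀_domain cm cp)).preimage
    (continuous_fst.prodMk continuous_snd.neg)

/-- `A₀` is skew-symmetric, so `-A₀^*` extends it; with zero boundary values every `A_L` extends it
too. -/
theorem maxRel_of_mem_A₀_graph {u w : L2Graph Em Ep} (h : (u, w) ∈ (A₀ cm cp).graph) :
    MaxRel cm cp u w 0 0 := by
  rw [A₀_graph] at h
  obtain ⟨φ, hφ, h1, h2⟩ := h
  have hz (e : Em ⊕ Ep) (n : ℕ) : iteratedDeriv n (φ e) 0 = 0 := by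
    refine image_eq_zero_of_notMem_tsupport fun h => ?_
    have := hφ.tsupport_subset e (tsupport_iteratedDeriv_subset _ n h)
    rw [halfLine_eq] at this
    have h2 : 0 < edgeSign e * 0 := this
    simp at h2
  refine ⟨fun e k => iteratedDeriv k (φ e), fun e => ⟨isJet_iteratedDeriv _ (hφ.smooth e),
    fun k _ => (hφ.smooth e).continuous_iteratedDeriv k (by exact_mod_cast le_top), ?_, ?_⟩,
    fun k e => (hz _ _).symm, fun k e => (hz _ _).symm⟩
  · rw [← halfLine_eq]
    simpa using h1 e
  · rw [← halfLine_eq, ← airyExpr_eq_airyJet]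
    exact h2 e

theorem dense_airyOp_domain : Dense ((airyOp cm cp L).domain : Set (L2Graph Em Ep)) := by
  refine (dense_A₀_domain cm cp).mono fun u hu => ?_
  exact LinearPMap.mem_domain_of_mem_graph ((mem_graph_airyOp_iff cm cp L u _).2
    ⟨0, 0, L.graph.zero_mem, maxRel_of_mem_A₀_graph cm cp (LinearPMap.mem_graph _ ⟨u, hu⟩)⟩)

theorem isKreinContraction_iff {K₁ K₂ : Type*} [NormedAddCommGroup K₁] [InnerProductSpace ℂ K₁]
    [NormedAddCommGroup K₂] [InnerProductSpace ℂ K₂] (B₁ : K₁ →ₗ[ℂ] K₁) (B₂ : K₂ →ₗ[ℂ] K₂)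
    (L : K₁ →ₗ.[ℂ] K₂) : IsKreinContraction B₁ B₂ L ↔
      ∀ x y, (x, y) ∈ L.graph → (kreinForm B₂ y y).re ≤ (kreinForm B₁ x x).re := by
  constructor
  · intro h x y hxy
    obtain ⟨z, rfl, rfl⟩ := (LinearPMap.mem_graph_iff _).1 hxy
    exact h z
  · exact fun h x => h _ _ (L.mem_graph x)

variable {L}

/-- The Airy operator and the Krein adjoint of the transmission operator: the elements of the
adjoint of `A_L` are those whose boundary values are related by `L^♯`. -/
theorem mem_graph_kreinAdjoint_iff_of_maxRel (hL : Dense (L.domain : Set (BdSpace Em)))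
    {v w : L2Graph Em Ep} {z : BdSpace Em} {y : BdSpace Ep} (h : MaxRel cm cp v w z y) :
    (y, z) ∈ (kreinAdjoint cm.gram cp.gram L).graph ↔
      ∀ p ∈ (airyOp cm cp L).graph, inner ℂ v p.2 = inner ℂ (-w) p.1 := by
  rw [mem_graph_kreinAdjoint cm.gram_isSymmetric cm.gram_injective cp.gram L hL]
  constructor
  · rintro hy ⟨u, u'⟩ hu
    obtain ⟨ξ, η, hξ, hm⟩ := (mem_graph_airyOp_iff cm cp L _ _).1 hu
    obtain ⟨x, rfl, rfl⟩ := (LinearPMap.mem_graph_iff _).1 hξ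
    have hg := hm.green h
    rw [hy x, sub_self] at hg
    rw [inner_neg_left]
    exact eq_neg_of_add_eq_zero_left hg
  · intro hv x
    -- Every pair `(x, L x)` is the boundary value of some element of `D(A_L)`, so the functional
    -- identity on `D(A_L)` reaches all of `D(L)`.
    obtain ⟨C, -, hC⟩ := exists_maxRel_lift cm cp
    obtain ⟨u, u', hm, -⟩ := hC x (L x)
    have h1 := hv _ ((mem_graph_airyOp_iff cm cp L u u').2 ⟨_, _, L.mem_graph x, hm⟩)
    have hg := hm.green h
    rw [inner_neg_left] at h1
    rw [h1, neg_add_cancel] at hg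
    exact (sub_eq_zero.1 hg.symm)

theorem tendsto_zero_of_norm_sq_le {V : Type*} [NormedAddCommGroup V] {v : ℕ → V} {q : ℕ → ℝ}
    (h : ∀ n, ‖v n‖ ^ 2 ≤ q n) (hq : Tendsto q atTop (𝓝 0)) : Tendsto v atTop (𝓝 0) := by
  rw [tendsto_zero_iff_norm_tendsto_zero]
  have h1 : Tendsto (fun n => ‖v n‖ ^ 2) atTop (𝓝 0) :=
    squeeze_zero (fun n => sq_nonneg _) h hq
  simpa using h1.sqrt

theorem tendsto_bound_zero {V W : Type*} [NormedAddCommGroup V] [NormedAddCommGroup W]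
    {v : ℕ → V} {w : ℕ → W} (C : ℝ) (hv : Tendsto v atTop (𝓝 0)) (hw : Tendsto w atTop (𝓝 0)) :
    Tendsto (fun n => C * (‖v n‖ ^ 2 + ‖w n‖ ^ 2)) atTop (𝓝 0) := by
  simpa using ((hv.norm.pow 2).add (hw.norm.pow 2)).const_mul C

/-- The graph of `A_L` is the preimage of that of `L` under the boundary map, which is continuous on
the closed graph of `-A₀^*` and admits norm-controlled lifts. -/
theorem isClosed_airyOp_iff : (airyOp cm cp L).IsClosed ↔ L.IsClosed := by
  simp only [LinearPMap.IsClosed, ← isSeqClosed_iff_isClosed]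
  constructor
  · intro hA p ⟨ξ, η⟩ hp hlim
    obtain ⟨C, -, hC⟩ := exists_maxRel_lift cm cp
    obtain ⟨u, w, h, -⟩ := hC ξ η
    -- A fixed lift of the limit is corrected by lifts of the differences, which tend to zero
    -- together with them.
    choose d d' hd hd1 hd2 using fun n => hC ((p n).1 - ξ) ((p n).2 - η)
    have h1 : Tendsto (fun n => (p n).1 - ξ) atTop (𝓝 0) := by
      simpa using (hlim.fst_nhds).sub_const ξ
    have h2 : Tendsto (fun n => (p n).2 - η) atTop (𝓝 0) := by
      simpa using (hlim.snd_nhds).sub_const η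
    have hq := tendsto_bound_zero C h1 h2
    have hu : Tendsto (fun n => (u + d n, w + d' n)) atTop (𝓝 (u, w)) := by
      refine Tendsto.prodMk_nhds ?_ ?_
      · simpa using (tendsto_zero_of_norm_sq_le hd1 hq).const_add u
      · simpa using (tendsto_zero_of_norm_sq_le hd2 hq).const_add w
    have hmem := hA (fun n => (mem_graph_airyOp_iff cm cp L _ _).2
      ⟨(p n).1, (p n).2, hp n, by simpa using h.add (hd n)⟩) hu
    obtain ⟨ξ', η', hL, h'⟩ := (mem_graph_airyOp_iff cm cp L _ _).1 hmem
    obtain ⟨rfl, rfl⟩ := h.hasBoundaryValues.unique h'.hasBoundaryValues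
    exact hL
  · intro hL p ⟨u, w⟩ hp hlim
    obtain ⟨C, -, hC⟩ := exists_maxRel_bound cm cp
    choose ξ η hξη hm using fun n => (mem_graph_airyOp_iff cm cp L (p n).1 (p n).2).1 (hp n)
    -- Closedness of the maximal operator first gives the limit boundary values at all; the trace
    -- bound for the differences then shows convergence to them.
    have hmem : (u, w) ∈ (-(A₀ cm cp)†).graph :=
      (isClosed_graph_neg_adjoint cm cp).isSeqClosed (fun n =>
        (mem_graph_neg_adjoint_iff_maxRel cm cp (p n).1 (p n).2).2 ⟨_, _, hm n⟩) hlim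
    obtain ⟨ξ', η', h⟩ := (mem_graph_neg_adjoint_iff_maxRel cm cp u w).1 hmem
    have h1 : Tendsto (fun n => (p n).1 - u) atTop (𝓝 0) := by
      simpa using (hlim.fst_nhds).sub_const u
    have h2 : Tendsto (fun n => (p n).2 - w) atTop (𝓝 0) := by
      simpa using (hlim.snd_nhds).sub_const w
    have hq := tendsto_bound_zero C h1 h2
    have hξ : Tendsto ξ atTop (𝓝 ξ') := by
      simpa using (tendsto_zero_of_norm_sq_le (fun n => (hC _ _ _ _ ((hm n).sub h)).1) hq).add_const ξ'
    have hη : Tendsto η atTop (𝓝 η') := by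
      simpa using (tendsto_zero_of_norm_sq_le (fun n => (hC _ _ _ _ ((hm n).sub h)).2) hq).add_const η'
    exact (mem_graph_airyOp_iff cm cp L u w).2 ⟨ξ', η', hL hξη (hξ.prodMk_nhds hη), h⟩

theorem generatesContractionSemigroup_airyOp_iff (hL : Dense (L.domain : Set (BdSpace Em))) :
    GeneratesContractionSemigroup (airyOp cm cp L) ↔
      L.IsClosed ∧ IsKreinContraction cm.gram cp.gram L ∧
      IsKreinContraction cp.gram cm.gram (kreinAdjoint cm.gram cp.gram L) := by
  simp only [isKreinContraction_iff]
  constructor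
  · rintro ⟨T, hT, hA⟩
    obtain ⟨C, -, hC⟩ := exists_maxRel_lift cm cp
    refine ⟨(isClosed_airyOp_iff cm cp).1 (IsGeneratorOf.isClosed hT hA), fun ξ η h => ?_,
      fun y z h => ?_⟩
    · obtain ⟨u, w, hm, -⟩ := hC ξ η
      have h1 := IsGeneratorOf.re_inner_nonpos hT hA
        ((mem_graph_airyOp_iff cm cp L u w).2 ⟨ξ, η, h, hm⟩)
      have h2 := hm.two_re_inner
      linarith
    -- Here `z = L^♯ y`, so the lift `v` lies in the domain of the adjoint of `A_L`, which sends it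
    -- to `-w`; this sign reverses the inequality in the energy balance.
    · obtain ⟨v, w, hm, -⟩ := hC z y
      have h1 := IsGeneratorOf.re_inner_adjoint_nonpos hT hA (v := v) (w := -w) fun x =>
        (mem_graph_kreinAdjoint_iff_of_maxRel cm cp hL hm).1 h _ (LinearPMap.mem_graph _ x)
      have h2 := hm.two_re_inner
      rw [inner_neg_right, Complex.neg_re] at h1
      linarith
  · rintro ⟨hc, h1, h2⟩
    refine generatesContractionSemigroup_of_dissipative (dense_airyOp_domain cm cp L)
      ((isClosed_airyOp_iff cm cp).2 hc) ?_ fun v w hvw => ?_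
    · rintro ⟨u, w⟩ h
      obtain ⟨ξ, η, hξη, hm⟩ := (mem_graph_airyOp_iff cm cp L u w).1 h
      have h3 := hm.two_re_inner
      have h4 := h1 _ _ hξη
      dsimp only
      linarith
    -- Since `A_L` extends `A₀`, the adjoint relation for `A_L` implies that for `A₀`; so `v` has
    -- boundary values, and these are related by `L^♯`.
    · have hA (x : (A₀ cm cp).domain) : inner ℂ w (x : L2Graph Em Ep) = inner ℂ v (A₀ cm cp x) :=
        (hvw ((x : L2Graph Em Ep), A₀ cm cp x) ((mem_graph_airyOp_iff cm cp L _ _).2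
          ⟨0, 0, L.graph.zero_mem, maxRel_of_mem_A₀_graph cm cp (LinearPMap.mem_graph _ x)⟩)).symm
      have hmem : v ∈ (A₀ cm cp)†.domain := LinearPMap.mem_adjoint_domain_of_exists v ⟨w, hA⟩
      have happ : (A₀ cm cp)† ⟨v, hmem⟩ = w :=
        LinearPMap.adjoint_apply_eq (dense_A₀_domain cm cp) ⟨v, hmem⟩ hA
      obtain ⟨ξ, η, hm⟩ := (mem_graph_neg_adjoint_iff_maxRel cm cp v (-w)).1
        ((LinearPMap.mem_graph_iff _).2 ⟨⟨v, hmem⟩, rfl, by rw [LinearPMap.neg_apply, happ]⟩)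
      have h3 := h2 _ _ ((mem_graph_kreinAdjoint_iff_of_maxRel cm cp hL hm).2 (by rwa [neg_neg]))
      have h4 := hm.two_re_inner
      rw [inner_neg_right, Complex.neg_re] at h4
      linarith

end AiryOp

end AiryStar

end

theorem theorem3p12 {Em Ep : Type*} [Countable Em] [Countable Ep]
    (cm : AiryStar.EdgeCoeffs Em) (cp : AiryStar.EdgeCoeffs Ep)
    (L : AiryStar.BdSpace Em →ₗ.[ℂ] AiryStar.BdSpace Ep)
    (hL : Dense (L.domain : Set (AiryStar.BdSpace Em))) :
    AiryStar.GeneratesContractionSemigroup (AiryStar.airyOp cm cp L) ↔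
      L.IsClosed ∧
      AiryStar.IsKreinContraction cm.gram cp.gram L ∧
      AiryStar.IsKreinContraction cp.gram cm.gram
        (AiryStar.kreinAdjoint cm.gram cp.gram L) := by
  exact AiryStar.generatesContractionSemigroup_airyOp_iff cm cp hL
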